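/- All graphs are finite and loopless; parallel edges are allowed. For a graph $G$ and a matching $M$ of $G$ (a set of edges no two of which share an end-vertex), let $V(M)$ be the set of end-vertices of the edges of $M$. The matching $M$ is *semistrong* if every edge of $M$ has an end-vertex of degree one in the subgraph induced by $V(M)$ in the underlying simple graph of $G$ (the graph in which any two vertices adjacent in $G$ are joined by exactly one edge). A *semistrong edge-coloring* of $G$ is a proper edge-coloring in which every color class is a semistrong matching, and the *semistrong chromatic index* $\chi'_{ss}(G)$ is the least integer $k$ such that $G$ admits a semistrong edge-coloring with at most $k$ colors. **Theorem 2.** Every connected graph $G$ of maximum degree at most $3$ that is not isomorphic to $K_{3,3}$ satisfies $$\chi'_{ss}(G)\le 8.$$ The bound is tight: the $5$-prism $C_5\,\square\,K_2$ is a connected simple graph of maximum degree $3$, is not isomorphic to $K_{3,3}$, and has $\chi'_{ss}(C_5\,\square\,K_2)=8$. -/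

import Mathlib

/-!
Multigraphs are Mathlib's `Graph α β` (vertex set `V(G) : Set α`, edge set `E(G) : Set β`,
parallel edges allowed, no loops when `G.Loopless`). The underlying simple graph, in which
adjacent vertices are joined by exactly one edge, is `G.toSimpleGraph`.
-/

namespace SemistrongColoring

open scoped Graph

/-- The degree of `x`: the number of edges incident with `x`, loops being counted twice. -/
noncomputable def degree {α β : Type*} (G : Graph α β) (x : α) : ℕ∞ :=
  {e | G.Inc e x}.encard + {e | G.IsLoopAt e x}.encard

/-- The maximum degree `Δ(G)`. -/
noncomputable def maxDegree {α β : Type*} (G : Graph α β) : ℕ∞ :=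
  ⨆ x ∈ V(G), degree G x

/-- `V(M)`: the set of end-vertices of the edges of `M`. -/
def endSet {α β : Type*} (G : Graph α β) (M : Set β) : Set α :=
  {x | ∃ e ∈ M, G.Inc e x}

/-- `M` is a matching of `G`: a set of edges of which no two have a common end-vertex. -/
def IsMatching {α β : Type*} (G : Graph α β) (M : Set β) : Prop :=
  M ⊆ E(G) ∧ ∀ e ∈ M, ∀ f ∈ M, e ≠ f → ∀ x, ¬ (G.Inc e x ∧ G.Inc f x)

/-- For `x ∈ X`, the degree of `x` in the subgraph that `X` induces in the underlying simple
graph of `G`. -/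
noncomputable def inducedDegree {α β : Type*} (G : Graph α β) (X : Set α) (x : α) : ℕ∞ :=
  {y | y ∈ X ∧ x ≠ y ∧ G.Adj x y}.encard

/-- A matching `M` is semistrong if each of its edges has an end-vertex of degree one in the
subgraph induced by `V(M)` (in the underlying simple graph, so that parallel edges are
harmless). -/
def IsSemistrongMatching {α β : Type*} (G : Graph α β) (M : Set β) : Prop :=
  IsMatching G M ∧ ∀ e ∈ M, ∃ x, G.Inc e x ∧ inducedDegree G (endSet G M) x = 1

/-- The set of edges that have color `i`. -/
def colorClass {α β C : Type*} (G : Graph α β) (c : E(G) → C) (i : C) : Set β :=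
  {e | ∃ h : e ∈ E(G), c ⟨e, h⟩ = i}

/-- A semistrong edge-coloring: every color class is a semistrong matching. (That the coloring is
proper is the statement that every color class is a matching.) -/
def IsSemistrongColoring {α β C : Type*} (G : Graph α β) (c : E(G) → C) : Prop :=
  ∀ i, IsSemistrongMatching G (colorClass G c i)

/-- The semistrong chromatic index: the least `k` such that `G` has a semistrong edge-coloring
with at most `k` colors (`⊤` if there is no such `k`). -/
noncomputable def semistrongChromaticIndex {α β : Type*} (G : Graph α β) : ℕ∞ :=
  ⨅ (k : ℕ) (_ : ∃ c : E(G) → Fin k, IsSemistrongColoring G c), (k : ℕ∞)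

/-- `G` is (isomorphic to) the complete bipartite graph `K_{3,3}`. -/
def IsK33 {α β : Type*} (G : Graph α β) : Prop :=
  G.Simple ∧ Nonempty (G.toSimpleGraph ≃g completeBipartiteGraph (Fin 3) (Fin 3))

/-- The 5-prism `C₅ □ K₂`. -/
def fivePrism : Graph (Fin 5 × Fin 2) (Sym2 (Fin 5 × Fin 2)) :=
  Graph.ofSimpleGraph ((SimpleGraph.cycleGraph 5).boxProd (⊤ : SimpleGraph (Fin 2)))

end SemistrongColoring

/-! Edges of the underlying simple graph are colored one at a time, and each colored edge `uv` gets
a designated end `v`, meant to have degree one in its color class. When the designated end is `v`, a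
color is forbidden for `uv` only if it occurs at a neighbor of `v` other than `u` (at most six
colors, which include those at `v`), occurs at `u`, or belongs to an edge designated at a neighbor
of `u` other than `v`. Eight colors tolerate seven forbidden ones, so six are harmless, and
everything depends on keeping few edges designated at the vertices next to the part not yet colored.

The central claim, `exists_good`, treats a connected vertex set `S` with a root `r` of degree at
most two in the subgraph induced by `S`. The edges inside `S` can be colored so that every vertex of
degree two is designated at most once, and `r` not at all unless `S` induces a cycle. The induction
removes `r` and later restores its edges, designated away from `r`: the first faces 6 + 1 forbidden
colors, the second 6 + 0 and the color of the first. If both neighbors of `r` become leaves, neither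
may carry a designation beforehand; `TwoRooted` provides this except when a path remains. The claim
settles graphs with a vertex of degree at most two. It also colors what remains of a connected cubic
graph after some vertices are removed, because then every component has such a vertex
(`light_sdiff`).

In a cubic graph a suitable small piece is removed, the rest is colored by the claim, and the
missing edges are restored by counting. The pieces are a complete graph on four vertices, a diamond,
a triangle outside diamonds, and two vertices with three common neighbors; in the last case the
count fails only for `K_{3,3}`. Without such pieces, a shortest cycle `c 0, …, c (k - 1)` is
induced, has length at least four, and its vertices have distinct neighbors `d i` off the cycle. The
vertices `c 1, …, c (k - 1)` are restored in order. At the end each of the three edges at `c 0` has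
two available colors, and distinct choices are impossible only if the three pairs coincide. The
edges around `c 1`, `c 2`, `c 3` are colored so as to prevent this (`RootedCycle.exists_stage`), and
the later steps do not disturb it (`Stage.succ`).

For multigraphs, an edge parallel to a colored one can conflict with at most seven other edges, so
it is colored greedily. In the 5-prism a semistrong matching has at most two edges, and seven such
matchings cannot cover fifteen edges. -/

namespace SemistrongColoring

/-! ### Partial colorings with designated ends -/

section Partial

variable {V : Type*}

/-- A partial coloring of a simple graph by eight colors together with a designated end for every
colored edge is encoded by a relation `K`: `K u v a` means that the edge `uv` has color `a` and
that `v` is its designated end. `Col K u v a` forgets the designation. -/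
def Col (K : V → V → Fin 8 → Prop) (u v : V) (a : Fin 8) : Prop := K u v a ∨ K v u a

lemma Col.symm {K : V → V → Fin 8 → Prop} {u v : V} {a : Fin 8} (h : Col K u v a) : Col K v u a :=
  Or.symm h

/-- Validity of a partial coloring with designated ends: it is proper, and no neighbor of the
designated end of an edge, other than its second end, meets an edge of the same color. -/
structure Ok (G : SimpleGraph V) (K : V → V → Fin 8 → Prop) : Prop where
  adj : ∀ {u v a}, K u v a → G.Adj u v
  uniq : ∀ {u v a b}, Col K u v a → Col K u v b → a = b
  proper : ∀ {u v w a}, Col K u v a → Col K u w a → v = w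
  des : ∀ {u v w x a}, K u v a → G.Adj v w → w ≠ u → ¬ Col K w x a

lemma Ok.col_adj {G : SimpleGraph V} {K : V → V → Fin 8 → Prop} (h : Ok G K) {u v : V} {a : Fin 8}
    (hc : Col K u v a) : G.Adj u v :=
  hc.elim h.adj fun h' => (h.adj h').symm

open scoped Classical in
/-- The colors of the edges at `w`. -/
noncomputable def colAt (K : V → V → Fin 8 → Prop) (w : V) : Finset (Fin 8) :=
  Finset.univ.filter fun a => ∃ x, Col K w x a

open scoped Classical in
/-- The colors of the edges designated at `w`. -/
noncomputable def inAt (K : V → V → Fin 8 → Prop) (w : V) : Finset (Fin 8) :=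
  Finset.univ.filter fun a => ∃ x, K x w a

lemma mem_colAt {K : V → V → Fin 8 → Prop} {w : V} {a : Fin 8} :
    a ∈ colAt K w ↔ ∃ x, Col K w x a := by simp [colAt]

lemma mem_inAt {K : V → V → Fin 8 → Prop} {w : V} {a : Fin 8} :
    a ∈ inAt K w ↔ ∃ x, K x w a := by simp [inAt]

lemma inAt_subset_colAt (K : V → V → Fin 8 → Prop) (w : V) : inAt K w ⊆ colAt K w := by
  intro a ha
  obtain ⟨x, hx⟩ := mem_inAt.1 ha
  exact mem_colAt.2 ⟨x, Or.inr hx⟩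

/-- Add the edge `uv` with color `a` and designated end `v`. -/
def addArc (K : V → V → Fin 8 → Prop) (u v : V) (a : Fin 8) : V → V → Fin 8 → Prop :=
  fun x y b => K x y b ∨ (x = u ∧ y = v ∧ b = a)

lemma col_addArc {K : V → V → Fin 8 → Prop} {u v x y : V} {a b : Fin 8} :
    Col (addArc K u v a) x y b ↔
      Col K x y b ∨ (b = a ∧ ((x = u ∧ y = v) ∨ (x = v ∧ y = u))) := by
  unfold Col addArc
  tauto

lemma colAt_card_le {G : SimpleGraph V} {K : V → V → Fin 8 → Prop} (h : Ok G K) {w : V}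
    (X : Finset V) (hX : ∀ x a, Col K w x a → x ∈ X) : (colAt K w).card ≤ X.card := by
  classical
  have hch : ∀ a ∈ colAt K w, ∃ x, Col K w x a := fun a ha => mem_colAt.1 ha
  rcases isEmpty_or_nonempty V with hV | hV
  · exact (hV.false w).elim
  choose! f hf using hch
  refine Finset.card_le_card_of_injOn f (fun a ha => hX _ a (hf a ha)) ?_
  intro a ha b hb hab
  have h1 := hf a ha
  rw [hab] at h1
  exact h.uniq h1 (hf b hb)

lemma colAt_card_le_degree [Fintype V] {G : SimpleGraph V} [DecidableRel G.Adj]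
    {K : V → V → Fin 8 → Prop} (h : Ok G K) (w : V) : (colAt K w).card ≤ G.degree w :=
  colAt_card_le h (G.neighborFinset w) fun x a hx => by simpa using h.col_adj hx

lemma colAt_eq_empty {K : V → V → Fin 8 → Prop} {w : V} (h : ∀ x a, ¬ Col K w x a) :
    colAt K w = ∅ := by
  ext a
  simp [mem_colAt, h]

lemma inAt_eq_empty {K : V → V → Fin 8 → Prop} {w : V} (h : ∀ x a, ¬ K x w a) :
    inAt K w = ∅ := by
  ext a
  simp [mem_inAt, h]

lemma colAt_addArc_of_ne {K : V → V → Fin 8 → Prop} {u v w : V} {a : Fin 8}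
    (hu : w ≠ u) (hv : w ≠ v) : colAt (addArc K u v a) w = colAt K w := by
  ext b
  simp [mem_colAt, col_addArc, hu, hv]

lemma colAt_addArc_left {K : V → V → Fin 8 → Prop} {u v : V} {a : Fin 8} :
    colAt (addArc K u v a) u = insert a (colAt K u) := by
  ext b
  simp only [mem_colAt, col_addArc, Finset.mem_insert]
  constructor
  · rintro ⟨x, h | ⟨rfl, -⟩⟩
    · exact Or.inr ⟨x, h⟩
    · exact Or.inl rfl
  · rintro (rfl | ⟨x, h⟩)
    · exact ⟨v, Or.inr (by simp)⟩
    · exact ⟨x, Or.inl h⟩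

lemma colAt_addArc_right {K : V → V → Fin 8 → Prop} {u v : V} {a : Fin 8} :
    colAt (addArc K u v a) v = insert a (colAt K v) := by
  ext b
  simp only [mem_colAt, col_addArc, Finset.mem_insert]
  constructor
  · rintro ⟨x, h | ⟨rfl, -⟩⟩
    · exact Or.inr ⟨x, h⟩
    · exact Or.inl rfl
  · rintro (rfl | ⟨x, h⟩)
    · exact ⟨u, Or.inr (by simp)⟩
    · exact ⟨x, Or.inl h⟩

lemma inAt_addArc_of_ne {K : V → V → Fin 8 → Prop} {u v w : V} {a : Fin 8}
    (hv : w ≠ v) : inAt (addArc K u v a) w = inAt K w := by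
  ext b
  simp [mem_inAt, addArc, hv]

lemma inAt_addArc_head {K : V → V → Fin 8 → Prop} {u v : V} {a : Fin 8} :
    inAt (addArc K u v a) v = insert a (inAt K v) := by
  ext b
  simp only [mem_inAt, addArc, Finset.mem_insert]
  constructor
  · rintro ⟨x, h | ⟨-, -, rfl⟩⟩
    · exact Or.inr ⟨x, h⟩
    · exact Or.inl rfl
  · rintro (rfl | ⟨x, h⟩)
    · exact ⟨u, Or.inr (by simp)⟩
    · exact ⟨x, Or.inl h⟩

end Partial

/-! ### Forbidden colors of a new edge -/

section Extend

variable {V : Type*} [Fintype V] [DecidableEq V] (G : SimpleGraph V) [DecidableRel G.Adj]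

/-- The colors at the neighbors of `v` other than `u`. -/
noncomputable def near (K : V → V → Fin 8 → Prop) (u v : V) : Finset (Fin 8) :=
  ((G.neighborFinset v).erase u).biUnion (colAt K)

/-- The colors of the edges designated at neighbors of `u` other than `v`. -/
noncomputable def back (K : V → V → Fin 8 → Prop) (u v : V) : Finset (Fin 8) :=
  ((G.neighborFinset u).erase v).biUnion (inAt K)

variable {G}

lemma mem_near {K : V → V → Fin 8 → Prop} {u v : V} {a : Fin 8} :
    a ∈ near G K u v ↔ ∃ w, w ≠ u ∧ G.Adj v w ∧ ∃ x, Col K w x a := by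
  simp [near, mem_colAt, and_assoc]

lemma mem_back {K : V → V → Fin 8 → Prop} {u v : V} {a : Fin 8} :
    a ∈ back G K u v ↔ ∃ w, w ≠ v ∧ G.Adj u w ∧ ∃ x, K x w a := by
  simp [back, mem_inAt, and_assoc]

/-- A color that avoids the colors near the new edge extends a valid partial coloring. -/
lemma Ok.extend {K : V → V → Fin 8 → Prop} (h : Ok G K) {u v : V} (huv : G.Adj u v)
    (hnew : ∀ b, ¬ Col K u v b) {a : Fin 8} (h1 : a ∉ near G K u v) (h2 : a ∉ colAt K u)
    (h3 : a ∉ back G K u v) : Ok G (addArc K u v a) := by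
  have hv : ∀ x, ¬ Col K v x a := by
    intro x hx
    have hxu : x ≠ u := by rintro rfl; exact hnew a hx.symm
    exact h1 (mem_near.2 ⟨x, hxu, h.col_adj hx, v, hx.symm⟩)
  have hu : ∀ x, ¬ Col K u x a := fun x hx => h2 (mem_colAt.2 ⟨x, hx⟩)
  refine ⟨?_, ?_, ?_, ?_⟩
  · rintro x y b (hb | ⟨rfl, rfl, -⟩)
    exacts [h.adj hb, huv]
  · intro x y b b' hb hb'
    rw [col_addArc] at hb hb'
    rcases hb with hb | ⟨rfl, hb⟩ <;> rcases hb' with hb' | ⟨rfl, hb'⟩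
    · exact h.uniq hb hb'
    · rcases hb' with ⟨rfl, rfl⟩ | ⟨rfl, rfl⟩
      exacts [(hnew _ hb).elim, (hnew _ hb.symm).elim]
    · rcases hb with ⟨rfl, rfl⟩ | ⟨rfl, rfl⟩
      exacts [(hnew _ hb').elim, (hnew _ hb'.symm).elim]
    · rfl
  · intro x y z b hb hb'
    rw [col_addArc] at hb hb'
    rcases hb with hb | ⟨hba, hb⟩ <;> rcases hb' with hb' | ⟨hba', hb'⟩
    · exact h.proper hb hb'
    · subst hba'
      rcases hb' with ⟨rfl, rfl⟩ | ⟨rfl, rfl⟩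
      exacts [(hu _ hb).elim, (hv _ hb).elim]
    · subst hba
      rcases hb with ⟨rfl, rfl⟩ | ⟨rfl, rfl⟩
      exacts [(hu _ hb').elim, (hv _ hb').elim]
    · have := huv.ne
      rcases hb with ⟨rfl, rfl⟩ | ⟨rfl, rfl⟩ <;> rcases hb' with ⟨h, rfl⟩ | ⟨h, rfl⟩ <;> simp_all
  · intro x y w t b hb hyw hwx hc
    rw [col_addArc] at hc
    rcases hb with hb | ⟨rfl, rfl, rfl⟩
    · rcases hc with hc | ⟨rfl, ⟨rfl, rfl⟩ | ⟨rfl, rfl⟩⟩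
      · exact h.des hb hyw hwx hc
      · by_cases hyt : y = t
        · subst hyt
          exact hv _ (Or.inr hb)
        · exact h3 (mem_back.2 ⟨y, hyt, hyw.symm, x, hb⟩)
      · by_cases hyt : y = t
        · subst hyt
          exact hu _ (Or.inr hb)
        · exact h1 (mem_near.2 ⟨y, hyt, hyw.symm, x, Or.inr hb⟩)
    · rcases hc with hc | ⟨-, ⟨rfl, rfl⟩ | ⟨rfl, rfl⟩⟩
      · exact h1 (mem_near.2 ⟨w, hwx, hyw, t, hc⟩)
      · exact hwx rfl
      · exact G.loopless.irrefl _ hyw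

lemma exists_notMem_of_card_le {F : Finset (Fin 8)} (hF : F.card ≤ 7) : ∃ a, a ∉ F := by
  by_contra! h
  have : F = Finset.univ := by ext a; simp [h a]
  rw [this] at hF
  simp at hF

/-- One more edge can be colored if few colors are forbidden; up to the bound, further colors
can be avoided. -/
lemma Ok.exists_extend {K : V → V → Fin 8 → Prop} (h : Ok G K) {u v : V} (huv : G.Adj u v)
    (hnew : ∀ b, ¬ Col K u v b) (F : Finset (Fin 8))
    (hF : (near G K u v ∪ colAt K u ∪ back G K u v ∪ F).card ≤ 7) :
    ∃ a, a ∉ near G K u v ∧ a ∉ colAt K u ∧ a ∉ back G K u v ∧ a ∉ F ∧ Ok G (addArc K u v a) := by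
  obtain ⟨a, ha⟩ := exists_notMem_of_card_le hF
  simp only [Finset.mem_union, not_or] at ha
  obtain ⟨⟨⟨h1, h2⟩, h3⟩, h4⟩ := ha
  exact ⟨a, h1, h2, h3, h4, h.extend huv hnew h1 h2 h3⟩

/-- Two neighbors of `v` remain, with three colors each. The colors at `v` are among these, since
every other edge at `v` is seen from its far end. -/
lemma near_card_le (hG : ∀ v, G.degree v ≤ 3) {K : V → V → Fin 8 → Prop} (h : Ok G K) {u v : V} (huv : G.Adj u v) :
    (near G K u v).card ≤ 6 := by
  refine (Finset.card_biUnion_le_card_mul _ _ 3 fun w _ =>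
    (colAt_card_le_degree h w).trans (hG w)).trans ?_
  have : ((G.neighborFinset v).erase u).card ≤ 2 := by
    rw [Finset.card_erase_of_mem (by simpa using huv.symm), G.card_neighborFinset_eq_degree]
    have := hG v
    omega
  omega

end Extend

/-! ### Connected vertex sets and their components -/

section Connectivity

variable {V : Type*} (G : SimpleGraph V)

/-- `T` contains every neighbor in `S` of each of its elements. -/
def ClosedIn (S T : Finset V) : Prop := ∀ a ∈ T, ∀ b ∈ S, G.Adj a b → b ∈ T

/-- The set `S` induces a connected subgraph. -/
def ConnOn (S : Finset V) : Prop :=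
  S.Nonempty ∧ ∀ T ⊆ S, T.Nonempty → ClosedIn G S T → T = S

variable {G}

lemma ClosedIn.sdiff [DecidableEq V] {S T : Finset V} (hT : ClosedIn G S T) : ClosedIn G S (S \ T) := by
  intro a ha b hb hab
  simp only [Finset.mem_sdiff] at ha ⊢
  exact ⟨hb, fun hbT => ha.2 (hT b hbT a ha.1 hab.symm)⟩

lemma ClosedIn.trans {S T U : Finset V} (hT : ClosedIn G S T) (hU : ClosedIn G T U) (hUT : U ⊆ T) :
    ClosedIn G S U := fun a ha b hb hab => hU a ha b (hT a (hUT ha) b hb hab) hab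

/-- Every vertex lies in a closed connected set. -/
lemma exists_component [DecidableEq V] (S : Finset V) {r : V} (hr : r ∈ S) :
    ∃ T ⊆ S, r ∈ T ∧ ClosedIn G S T ∧ ConnOn G T := by
  classical
  -- The intersection of all closed subsets containing `r`. It is connected because complements of
  -- closed sets are closed.
  let T := S.filter fun w => ∀ U ⊆ S, ClosedIn G S U → r ∈ U → w ∈ U
  have hT : ∀ w, w ∈ T ↔ w ∈ S ∧ ∀ U ⊆ S, ClosedIn G S U → r ∈ U → w ∈ U := by simp [T]
  have hTS : T ⊆ S := Finset.filter_subset _ _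
  have hrT : r ∈ T := (hT r).2 ⟨hr, fun U _ _ h => h⟩
  have hcl : ClosedIn G S T := by
    intro a ha b hb hab
    rw [hT] at ha ⊢
    exact ⟨hb, fun U hU hc hrU => hc a (ha.2 U hU hc hrU) b hb hab⟩
  refine ⟨T, hTS, hrT, hcl, ⟨r, hrT⟩, ?_⟩
  intro U hUT hne hU
  have hUS := hcl.trans hU hUT
  by_cases hrU : r ∈ U
  · exact hUT.antisymm fun w hw => ((hT w).1 hw).2 U (hUT.trans hTS) hUS hrU
  · obtain ⟨x, hx⟩ := hne
    have := ((hT x).1 (hUT hx)).2 (S \ U) Finset.sdiff_subset hUS.sdiff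
      (by simp [hr, hrU])
    simp [hx] at this

end Connectivity

end SemistrongColoring

namespace SemistrongColoring

/-! ### Adding a vertex to a colored set -/

section Claim

set_option linter.unusedSectionVars false

variable {V : Type*} [Fintype V] [DecidableEq V] (G : SimpleGraph V) [DecidableRel G.Adj]

/-- The colored edges are exactly the edges with both ends in `S`. -/
def Cov (K : V → V → Fin 8 → Prop) (S : Finset V) : Prop :=
  ∀ u v, (∃ a, Col K u v a) ↔ (G.Adj u v ∧ u ∈ S ∧ v ∈ S)

/-- The degree of `w` in the subgraph induced by `S` (for `w ∈ S`). -/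
def degOn (S : Finset V) (w : V) : ℕ := (G.neighborFinset w ∩ S).card

/-- A valid coloring of the edges inside `S` such that every vertex that has degree two in the
subgraph induced by `S` is the designated end of at most one edge. -/
structure Good (S : Finset V) (K : V → V → Fin 8 → Prop) : Prop where
  ok : Ok G K
  cov : Cov G K S
  in_le : ∀ w ∈ S, degOn G S w = 2 → (inAt K w).card ≤ 1

variable {G}

lemma Cov.colAt_eq_empty {K : V → V → Fin 8 → Prop} {S : Finset V} (h : Cov G K S) {w : V}
    (hw : w ∉ S) : colAt K w = ∅ :=
  SemistrongColoring.colAt_eq_empty fun x a hx => hw ((h w x).1 ⟨a, hx⟩).2.1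

lemma Cov.inAt_eq_empty {K : V → V → Fin 8 → Prop} {S : Finset V} (h : Cov G K S) {w : V}
    (hw : w ∉ S) : inAt K w = ∅ :=
  SemistrongColoring.inAt_eq_empty fun x a hx => hw ((h x w).1 ⟨a, Or.inl hx⟩).2.2

lemma Cov.colAt_card_le {K : V → V → Fin 8 → Prop} {S : Finset V} (h : Cov G K S) (hK : Ok G K)
    (w : V) : (colAt K w).card ≤ degOn G S w :=
  SemistrongColoring.colAt_card_le hK _ fun x a hx => by
    have := (h w x).1 ⟨a, hx⟩
    simp [this.1, this.2.2]

lemma Cov.inAt_card_le {K : V → V → Fin 8 → Prop} {S : Finset V} (h : Cov G K S) (hK : Ok G K)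
    (w : V) : (inAt K w).card ≤ degOn G S w :=
  (Finset.card_le_card (inAt_subset_colAt K w)).trans (h.colAt_card_le hK w)

lemma Cov.not_col {K : V → V → Fin 8 → Prop} {S : Finset V} (h : Cov G K S) {u v : V}
    (hu : u ∉ S) (a : Fin 8) : ¬ Col K u v a := fun hc => hu ((h u v).1 ⟨a, hc⟩).2.1

lemma degOn_erase_of_adj {S : Finset V} {r w : V} (hr : r ∈ S) (h : G.Adj w r) :
    degOn G (S.erase r) w + 1 = degOn G S w := by
  unfold degOn
  rw [Finset.inter_erase, Finset.card_erase_add_one]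
  simp [hr, h]

lemma degOn_erase_of_not_adj {S : Finset V} {r w : V} (h : ¬ G.Adj w r) :
    degOn G (S.erase r) w = degOn G S w := by
  unfold degOn
  rw [Finset.inter_erase, Finset.erase_eq_of_notMem]
  simp [h]

lemma degOn_erase_le {S : Finset V} {r w : V} : degOn G (S.erase r) w ≤ degOn G S w :=
  Finset.card_le_card (Finset.inter_subset_inter_left (Finset.erase_subset _ _))

lemma degOn_le_degree (S : Finset V) (w : V) : degOn G S w ≤ G.degree w :=
  (Finset.card_le_card Finset.inter_subset_left).trans_eq (G.card_neighborFinset_eq_degree w)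

lemma degOn_congr_of_closed {S T : Finset V} (hTS : T ⊆ S) (hT : ClosedIn G S T) {w : V}
    (hw : w ∈ T) : degOn G T w = degOn G S w := by
  unfold degOn
  congr 1
  ext x
  simp only [Finset.mem_inter, SimpleGraph.mem_neighborFinset]
  exact ⟨fun h => ⟨h.1, hTS h.2⟩, fun h => ⟨h.1, hT w hw x h.2 h.1⟩⟩

lemma degOn_eq_zero {S : Finset V} {r : V} (h : degOn G S r = 0) {x : V} (hx : x ∈ S) :
    ¬ G.Adj r x := by
  intro hrx
  have : x ∈ G.neighborFinset r ∩ S := by simp [hrx, hx]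
  rw [degOn, Finset.card_eq_zero] at h
  simp [h] at this

lemma degOn_eq_one {S : Finset V} {r : V} (h : degOn G S r = 1) :
    ∃ z ∈ S, ∀ x ∈ S, G.Adj r x ↔ x = z := by
  obtain ⟨z, hz⟩ := Finset.card_eq_one.1 h
  have key : ∀ x, (G.Adj r x ∧ x ∈ S) ↔ x = z := fun x => by
    rw [← Finset.mem_singleton, ← hz]; simp
  exact ⟨z, ((key z).2 rfl).2, fun x hx => by simpa [hx] using key x⟩

lemma degOn_eq_two {S : Finset V} {r : V} (h : degOn G S r = 2) :
    ∃ z ∈ S, ∃ z' ∈ S, z ≠ z' ∧ ∀ x ∈ S, G.Adj r x ↔ x = z ∨ x = z' := by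
  obtain ⟨z, z', hne, hz⟩ := Finset.card_eq_two.1 h
  have key : ∀ x, (G.Adj r x ∧ x ∈ S) ↔ x = z ∨ x = z' := fun x => by
    have : x ∈ G.neighborFinset r ∩ S ↔ x ∈ ({z, z'} : Finset V) := by rw [hz]
    simpa using this
  exact ⟨z, ((key z).2 (Or.inl rfl)).2, z', ((key z').2 (Or.inr rfl)).2, hne,
    fun x hx => by simpa [hx] using key x⟩

lemma cov_insert {K K' : V → V → Fin 8 → Prop} {S : Finset V} (hc : Cov G K S) {r z z' : V}
    (hr : r ∉ S) (hz : z ∈ S) (hz' : z' ∈ S) (hN : ∀ x ∈ S, G.Adj r x ↔ x = z ∨ x = z')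
    (hK' : ∀ x y, (∃ b, Col K' x y b) ↔ (∃ b, Col K x y b) ∨ (x = r ∧ (y = z ∨ y = z')) ∨
      (y = r ∧ (x = z ∨ x = z'))) : Cov G K' (insert r S) := by
  intro x y
  rw [hK', hc]
  simp only [Finset.mem_insert]
  constructor
  · rintro (⟨h1, h2, h3⟩ | ⟨rfl, h⟩ | ⟨rfl, h⟩)
    · exact ⟨h1, Or.inr h2, Or.inr h3⟩
    · have hy : y ∈ S := by rcases h with rfl | rfl <;> assumption
      exact ⟨(hN y hy).2 h, Or.inl rfl, Or.inr hy⟩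
    · have hx : x ∈ S := by rcases h with rfl | rfl <;> assumption
      exact ⟨((hN x hx).2 h).symm, Or.inr hx, Or.inl rfl⟩
  · rintro ⟨h1, rfl | h2, rfl | h3⟩
    · exact (G.loopless.irrefl _ h1).elim
    · exact Or.inr (Or.inl ⟨rfl, (hN y h3).1 h1⟩)
    · exact Or.inr (Or.inr ⟨rfl, (hN x h2).1 h1.symm⟩)
    · exact Or.inl ⟨h1, h2, h3⟩

lemma exists_col_addArc {K : V → V → Fin 8 → Prop} {u v x y : V} {a : Fin 8} :
    (∃ b, Col (addArc K u v a) x y b) ↔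
      (∃ b, Col K x y b) ∨ (x = u ∧ y = v) ∨ (x = v ∧ y = u) := by
  simp only [col_addArc, exists_or, exists_eq_left]

lemma back_subset {K : V → V → Fin 8 → Prop} {S : Finset V} (hc : Cov G K S) {r z z' : V}
    (hN : ∀ x ∈ S, G.Adj r x → x = z ∨ x = z') : back G K r z ⊆ inAt K z' := by
  intro a ha
  obtain ⟨w, hwz, hrw, x, hx⟩ := mem_back.1 ha
  have hwS : w ∈ S := ((hc x w).1 ⟨a, Or.inl hx⟩).2.2
  rcases hN w hwS hrw with rfl | rfl
  · exact (hwz rfl).elim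
  · exact mem_inAt.2 ⟨x, hx⟩

lemma near_addArc_subset {K : V → V → Fin 8 → Prop} {u v r z : V} {a : Fin 8} :
    near G (addArc K u v a) r z ⊆ insert a (near G K r z) := by
  intro b hb
  obtain ⟨w, h1, h2, x, hx⟩ := mem_near.1 hb
  rw [col_addArc] at hx
  rcases hx with hx | ⟨rfl, -⟩
  · exact Finset.mem_insert_of_mem (mem_near.2 ⟨w, h1, h2, x, hx⟩)
  · exact Finset.mem_insert_self _ _

/-- Adding to `S` a vertex with a single neighbor in `S`. -/
lemma extend_one (hG : ∀ v, G.degree v ≤ 3) {K : V → V → Fin 8 → Prop} {S : Finset V}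
    (hK : Ok G K) (hc : Cov G K S) {r z : V} (hr : r ∉ S) (hz : z ∈ S)
    (hN : ∀ x ∈ S, G.Adj r x ↔ x = z) :
    ∃ a, Ok G (addArc K r z a) ∧ Cov G (addArc K r z a) (insert r S) := by
  have hrz : G.Adj r z := (hN z hz).2 rfl
  have hb : back G K r z = ∅ := by
    rw [Finset.eq_empty_iff_forall_notMem]
    intro a ha
    obtain ⟨w, hwz, hrw, x, hx⟩ := mem_back.1 ha
    exact hwz ((hN w ((hc x w).1 ⟨a, Or.inl hx⟩).2.2).1 hrw)
  obtain ⟨a, -, -, -, -, ha⟩ := hK.exists_extend hrz (hc.not_col hr) ∅ (by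
    rw [hb, hc.colAt_eq_empty hr]
    simpa using (near_card_le hG hK hrz).trans (by norm_num))
  refine ⟨a, ha, cov_insert hc hr hz hz (by simpa using hN) fun x y => ?_⟩
  rw [exists_col_addArc]
  tauto

/-- Adding to `S` a vertex with two neighbors in `S`. -/
lemma extend_two {K : V → V → Fin 8 → Prop} {S : Finset V}
    (hK : Ok G K) (hc : Cov G K S) {r z z' : V} (hr : r ∉ S) (hz : z ∈ S) (hz' : z' ∈ S)
    (hne : z ≠ z') (hN : ∀ x ∈ S, G.Adj r x ↔ x = z ∨ x = z')
    (h1 : (near G K r z).card + (inAt K z').card ≤ 7)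
    (h2 : (near G K r z').card + (inAt K z).card ≤ 6) :
    ∃ a b, Ok G (addArc (addArc K r z a) r z' b) ∧
      Cov G (addArc (addArc K r z a) r z' b) (insert r S) := by
  have hrz : G.Adj r z := (hN z hz).2 (Or.inl rfl)
  have hrz' : G.Adj r z' := (hN z' hz').2 (Or.inr rfl)
  have hzr : z ≠ r := fun h => hr (h ▸ hz)
  have hz'r : z' ≠ r := fun h => hr (h ▸ hz')
  have hb : back G K r z ⊆ inAt K z' := back_subset hc fun x hx => (hN x hx).1
  have hb' : back G K r z' ⊆ inAt K z := back_subset hc fun x hx h => ((hN x hx).1 h).symm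
  -- No edge at `r` is colored yet, so only the colors near `z` and those designated at `z'` are
  -- forbidden.
  obtain ⟨a, -, -, -, -, ha⟩ := hK.exists_extend hrz (hc.not_col hr) ∅ (by
    rw [hc.colAt_eq_empty hr]
    have := Finset.card_union_le (near G K r z) (back G K r z)
    have := Finset.card_le_card hb
    simp only [Finset.union_empty]
    omega)
  have hback : back G (addArc K r z a) r z' ⊆ insert a (inAt K z) := by
    intro b hb
    obtain ⟨w, hw, hrw, x, hx⟩ := mem_back.1 hb
    rcases hx with hx | ⟨-, -, rfl⟩
    · exact Finset.mem_insert_of_mem (hb' (mem_back.2 ⟨w, hw, hrw, x, hx⟩))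
    · exact Finset.mem_insert_self _ _
  have hcol : colAt (addArc K r z a) r = {a} := by
    rw [colAt_addArc_left, hc.colAt_eq_empty hr]; rfl
  obtain ⟨b, -, -, -, -, hb⟩ := ha.exists_extend hrz' (fun b => by
      rw [col_addArc]
      rintro (h | ⟨-, ⟨-, h⟩ | ⟨h, -⟩⟩)
      exacts [hc.not_col hr _ h, hne h.symm, hzr h.symm]) ∅ (by
    -- The color `a` may enter all three sets but counts once; hence the bound 6 in `h2` against 7
    -- in `h1`.
    have hsub : near G (addArc K r z a) r z' ∪ colAt (addArc K r z a) r ∪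
        back G (addArc K r z a) r z' ∪ ∅ ⊆ insert a (near G K r z' ∪ inAt K z) := by
      have hn := near_addArc_subset (G := G) (K := K) (u := r) (v := z) (r := r) (z := z') (a := a)
      rw [hcol]
      intro b hb
      simp only [Finset.mem_union, Finset.mem_singleton, Finset.notMem_empty, or_false,
        Finset.mem_insert] at hb ⊢
      rcases hb with (hb | hb) | hb
      · have := hn hb
        rw [Finset.mem_insert] at this
        tauto
      · exact Or.inl hb
      · have := hback hb
        rw [Finset.mem_insert] at this
        tauto
    have c1 := Finset.card_le_card hsub
    have c2 := Finset.card_insert_le a (near G K r z' ∪ inAt K z)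
    have c3 := Finset.card_union_le (near G K r z') (inAt K z)
    omega)
  refine ⟨a, b, hb, cov_insert hc hr hz hz' hN fun x y => ?_⟩
  rw [exists_col_addArc, exists_col_addArc]
  tauto

/-- This serves the situation in which the rest is one cycle or two cycles and no root can be kept
free: the two colors saved here pay for the one designation. -/
lemma near_card_le_four {K : V → V → Fin 8 → Prop} {S : Finset V} (hG : ∀ v, G.degree v ≤ 3)
    (hK : Ok G K) (hc : Cov G K S) (h2 : ∀ w ∈ S, degOn G S w ≤ 2) {u v : V} (huv : G.Adj u v) :
    (near G K u v).card ≤ 4 := by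
  refine (Finset.card_biUnion_le_card_mul _ _ 2 fun w _ => ?_).trans ?_
  · by_cases hw : w ∈ S
    · exact (hc.colAt_card_le hK w).trans (h2 w hw)
    · simp [hc.colAt_eq_empty hw]
  have : ((G.neighborFinset v).erase u).card ≤ 2 := by
    rw [Finset.card_erase_of_mem (by simpa using huv.symm), G.card_neighborFinset_eq_degree]
    have := hG v
    omega
  omega

/-- Adding a vertex to a colored set: the designations at the new neighbors. -/
lemma Good.insert_two (hG : ∀ v, G.degree v ≤ 3) {K : V → V → Fin 8 → Prop} {S : Finset V}
    (hK : Good G S K) {r z z' : V} (hr : r ∉ S) (hz : z ∈ S) (hz' : z' ∈ S)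
    (hne : z ≠ z') (hN : ∀ x ∈ S, G.Adj r x ↔ x = z ∨ x = z')
    (hIz : inAt K z = ∅ ∨ ((inAt K z).card ≤ 1 ∧ degOn G S z = 2 ∧ ∀ w ∈ S, degOn G S w ≤ 2))
    (hIz' : (inAt K z').card ≤ 1) (hz2 : degOn G S z' = 1 → inAt K z' = ∅) :
    ∃ K', Good G (insert r S) K' ∧ inAt K' r = ∅ := by
  have hrz : G.Adj r z := (hN z hz).2 (Or.inl rfl)
  have hrz' : G.Adj r z' := (hN z' hz').2 (Or.inr rfl)
  have hzr : z ≠ r := fun h => hr (h ▸ hz)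
  have hz'r : z' ≠ r := fun h => hr (h ▸ hz')
  -- The edge to `z` faces 6 + 1 forbidden colors. The edge to `z'` must also avoid `a`, so it can
  -- afford 6 + 0, or 4 + 1 when all degrees are at most two.
  obtain ⟨a, b, hok, hcov⟩ := extend_two hK.ok hK.cov hr hz hz' hne hN
    (by have := near_card_le hG hK.ok hrz; omega) (by
      rcases hIz with hI | ⟨hI, -, hI'⟩
      · have := near_card_le hG hK.ok hrz'
        simp only [hI, Finset.card_empty]
        omega
      · have := near_card_le_four hG hK.ok hK.cov hI' hrz'
        omega)
  have hins : S = (insert r S).erase r := (Finset.erase_insert hr).symm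
  have hri : r ∈ insert r S := Finset.mem_insert_self _ _
  have hInr : inAt (addArc (addArc K r z a) r z' b) r = ∅ := by
    rw [inAt_addArc_of_ne hz'r.symm, inAt_addArc_of_ne hzr.symm, hK.cov.inAt_eq_empty hr]
  refine ⟨_, ⟨hok, hcov, ?_⟩, hInr⟩
  intro w hw hdeg
  by_cases hwr : w = r
  · subst hwr; simp [hInr]
  have hwS : w ∈ S := by simpa [hwr] using hw
  by_cases hwz' : w = z'
  · subst hwz'
    rw [inAt_addArc_head, inAt_addArc_of_ne hne.symm]
    -- Degree two after the insertion means degree one before, and then nothing was designated here.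
    have := degOn_erase_of_adj hri hrz'.symm
    rw [← hins] at this
    rw [hz2 (by omega)]
    simp
  rw [inAt_addArc_of_ne hwz']
  by_cases hwz : w = z
  · subst hwz
    rw [inAt_addArc_head]
    have := degOn_erase_of_adj hri hrz.symm
    rw [← hins] at this
    rcases hIz with hI | ⟨-, hI, -⟩
    · simp [hI]
    · omega
  rw [inAt_addArc_of_ne hwz]
  have hnadj : ¬ G.Adj w r := fun h => by
    rcases (hN w hwS).1 h.symm with h | h <;> contradiction
  have := degOn_erase_of_not_adj (S := insert r S) hnadj
  rw [← hins] at this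
  exact hK.in_le w hwS (by omega)

/-- Removing a vertex of degree one keeps a set connected. -/
lemma ConnOn.erase_of_degOn_eq_one {S : Finset V} (hS : ConnOn G S) {t y : V} (ht : t ∈ S)
    (hy : y ∈ S) (hN : ∀ x ∈ S, G.Adj t x ↔ x = y) : ConnOn G (S.erase t) := by
  have hty : G.Adj t y := (hN y hy).2 rfl
  refine ⟨⟨y, by simp [hy, hty.ne']⟩, fun T hT hne hcl => ?_⟩
  have htT : t ∉ T := fun h => by simpa using hT h
  by_cases hyT : y ∈ T
  · have := hS.2 (insert t T) (by
      intro x hx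
      rcases Finset.mem_insert.1 hx with rfl | hx
      exacts [ht, Finset.mem_of_mem_erase (hT hx)]) ⟨t, by simp⟩ (by
      intro a ha b hb hab
      rw [Finset.mem_insert] at ha ⊢
      rcases ha with rfl | ha
      · exact Or.inr (((hN b hb).1 hab) ▸ hyT)
      · by_cases hbt : b = t
        · exact Or.inl hbt
        · exact Or.inr (hcl a ha b (by simp [hbt, hb]) hab))
    rw [← this, Finset.erase_insert htT]
  · have := hS.2 T (hT.trans (Finset.erase_subset _ _)) hne (by
      intro a ha b hb hab
      by_cases hbt : b = t
      · subst hbt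
        have := (hN a (Finset.mem_of_mem_erase (hT ha))).1 hab.symm
        exact (hyT (this ▸ ha)).elim
      · exact hcl a ha b (by simp [hbt, hb]) hab)
    rw [this] at htT
    exact (htT ht).elim

/-- If removing a vertex of degree two disconnects a connected set, then it splits it into two
connected parts, one for each neighbor. -/
lemma ConnOn.split {S : Finset V} (hS : ConnOn G S) {r z z' : V} (hr : r ∈ S)
    (hz : z ∈ S) (hN : ∀ x ∈ S, G.Adj r x ↔ x = z ∨ x = z') (hd : ¬ ConnOn G (S.erase r)) :
    ∃ A B, A ∪ B = S.erase r ∧ Disjoint A B ∧ z ∈ A ∧ z' ∈ B ∧ ConnOn G A ∧ ConnOn G B ∧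
      ClosedIn G (S.erase r) A ∧ ClosedIn G (S.erase r) B := by
  have hzr : z ∈ S.erase r := by simp [hz, ((hN z hz).2 (Or.inl rfl)).ne']
  -- A part closed in `S.erase r` that misses both neighbors of `r` would be closed in `S`.
  have hmeet : ∀ U ⊆ S.erase r, U.Nonempty → ClosedIn G (S.erase r) U → z ∈ U ∨ z' ∈ U := by
    intro U hU hne hcl
    by_contra! hcon
    have := hS.2 U (hU.trans (Finset.erase_subset _ _)) hne (by
      intro a ha b hb hab
      by_cases hbr : b = r
      · subst hbr
        rcases (hN a (Finset.mem_of_mem_erase (hU ha))).1 hab.symm with rfl | rfl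
        exacts [(hcon.1 ha).elim, (hcon.2 ha).elim]
      · exact hcl a ha b (by simp [hbr, hb]) hab)
    have h2 := hU (this ▸ hr)
    simp at h2
  obtain ⟨A, hAS, hzA, hAcl, hAconn⟩ := exists_component (G := G) _ hzr
  have hAne : A ≠ S.erase r := fun h => hd (h ▸ hAconn)
  have hBne : (S.erase r \ A).Nonempty := by
    rw [Finset.sdiff_nonempty]
    exact fun h => hAne (hAS.antisymm h)
  have hBsub : S.erase r \ A ⊆ S.erase r := Finset.sdiff_subset
  have hmeetB : ∀ U ⊆ S.erase r \ A, U.Nonempty → ClosedIn G (S.erase r) U → z' ∈ U := by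
    intro U hU hne hcl
    rcases hmeet U (hU.trans hBsub) hne hcl with h | h
    · have := hU h
      simp [hzA] at this
    · exact h
  refine ⟨A, S.erase r \ A, ?_, ?_, hzA, hmeetB _ subset_rfl hBne hAcl.sdiff, hAconn,
    ⟨hBne, ?_⟩, hAcl, hAcl.sdiff⟩
  · rw [Finset.union_sdiff_of_subset hAS]
  · exact Finset.disjoint_sdiff
  -- If `U` were a proper part, then both `U` and its complement would be closed, and both would
  -- contain `z'`.
  · intro U hU hne hcl
    by_contra hUne
    have hne' : ((S.erase r \ A) \ U).Nonempty := by
      rw [Finset.sdiff_nonempty]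
      exact fun h => hUne (hU.antisymm h)
    have h1 := hmeetB U hU hne (hAcl.sdiff.trans hcl hU)
    have h2 := hmeetB _ Finset.sdiff_subset hne' (hAcl.sdiff.trans hcl.sdiff Finset.sdiff_subset)
    simp [h1] at h2

/-- Colorings of two closed parts combine. -/
lemma Good.union {S A B : Finset V} {K L : V → V → Fin 8 → Prop} (hAB : A ∪ B = S)
    (hd : Disjoint A B) (hA : ClosedIn G S A) (hB : ClosedIn G S B) (hK : Good G A K)
    (hL : Good G B L) :
    ∃ M, Good G S M ∧ (∀ w ∈ A, inAt M w = inAt K w) ∧ (∀ w ∈ B, inAt M w = inAt L w) := by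
  have hAS : A ⊆ S := hAB ▸ Finset.subset_union_left
  have hBS : B ⊆ S := hAB ▸ Finset.subset_union_right
  have hdis : ∀ w, w ∈ A → w ∈ B → False := fun w h1 h2 => Finset.disjoint_left.1 hd h1 h2
  have hKA : ∀ {u v a}, Col K u v a → u ∈ A ∧ v ∈ A := fun {u v a} h =>
    ((hK.cov u v).1 ⟨a, h⟩).2
  have hLB : ∀ {u v a}, Col L u v a → u ∈ B ∧ v ∈ B := fun {u v a} h =>
    ((hL.cov u v).1 ⟨a, h⟩).2
  -- No edge joins `A` and `B`, so colors can be reused freely on the two sides.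
  let M : V → V → Fin 8 → Prop := fun u v a => K u v a ∨ L u v a
  have hcol : ∀ {u v a}, Col M u v a ↔ Col K u v a ∨ Col L u v a := by
    intro u v a
    simp only [Col, M]
    tauto
  have hMA : ∀ w ∈ A, inAt M w = inAt K w := by
    intro w hw
    ext a
    simp only [mem_inAt, M]
    refine exists_congr fun x => or_iff_left fun h => hdis w hw (hLB (Or.inl h)).2
  have hMB : ∀ w ∈ B, inAt M w = inAt L w := by
    intro w hw
    ext a
    simp only [mem_inAt, M]
    refine exists_congr fun x => or_iff_right fun h => hdis w (hKA (Or.inl h)).2 hw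
  refine ⟨M, ⟨⟨?_, ?_, ?_, ?_⟩, ?_, ?_⟩, hMA, hMB⟩
  · rintro u v a (h | h)
    exacts [hK.ok.adj h, hL.ok.adj h]
  · intro u v a b h1 h2
    rw [hcol] at h1 h2
    rcases h1 with h1 | h1 <;> rcases h2 with h2 | h2
    · exact hK.ok.uniq h1 h2
    · exact (hdis u (hKA h1).1 (hLB h2).1).elim
    · exact (hdis u (hKA h2).1 (hLB h1).1).elim
    · exact hL.ok.uniq h1 h2
  · intro u v w a h1 h2
    rw [hcol] at h1 h2
    rcases h1 with h1 | h1 <;> rcases h2 with h2 | h2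
    · exact hK.ok.proper h1 h2
    · exact (hdis u (hKA h1).1 (hLB h2).1).elim
    · exact (hdis u (hKA h2).1 (hLB h1).1).elim
    · exact hL.ok.proper h1 h2
  · intro u v w x a h1 hvw hwu hc
    rw [hcol] at hc
    rcases h1 with h1 | h1 <;> rcases hc with hc | hc
    · exact hK.ok.des h1 hvw hwu hc
    · exact hdis w (hA v (hKA (Or.inl h1)).2 w (hBS (hLB hc).1) hvw) (hLB hc).1
    · exact hdis w (hKA hc).1 (hB v (hLB (Or.inl h1)).2 w (hAS (hKA hc).1) hvw)
    · exact hL.ok.des h1 hvw hwu hc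
  · intro u v
    simp only [hcol, exists_or, hK.cov u v, hL.cov u v]
    constructor
    · rintro (⟨h1, h2, h3⟩ | ⟨h1, h2, h3⟩)
      exacts [⟨h1, hAS h2, hAS h3⟩, ⟨h1, hBS h2, hBS h3⟩]
    · rintro ⟨h1, h2, h3⟩
      rw [← hAB, Finset.mem_union] at h2
      rcases h2 with h2 | h2
      exacts [Or.inl ⟨h1, h2, hA u h2 v h3 h1⟩, Or.inr ⟨h1, h2, hB u h2 v h3 h1⟩]
  · intro w hw hdeg
    rw [← hAB, Finset.mem_union] at hw
    rcases hw with hw | hw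
    · rw [hMA w hw]
      exact hK.in_le w hw (by rw [degOn_congr_of_closed hAS hA hw, hdeg])
    · rw [hMB w hw]
      exact hL.in_le w hw (by rw [degOn_congr_of_closed hBS hB hw, hdeg])

end Claim

end SemistrongColoring

namespace SemistrongColoring

/-! ### Rooted colorings of connected sets -/

section Claim

set_option linter.unusedSectionVars false

variable {V : Type*} [Fintype V] [DecidableEq V] {G : SimpleGraph V} [DecidableRel G.Adj]

/-- The new edge is designated at `z`. As `r` has no other neighbor in `S`, only the six colors near
`z` are forbidden. The extra designation at `z` matters only if `z` ends up with degree two. -/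
lemma Good.insert_one (hG : ∀ v, G.degree v ≤ 3) {K : V → V → Fin 8 → Prop} {S : Finset V}
    (hK : Good G S K) {r z : V} (hr : r ∉ S) (hz : z ∈ S) (hN : ∀ x ∈ S, G.Adj r x ↔ x = z)
    (hIz : degOn G S z = 1 → inAt K z = ∅) :
    ∃ a, Good G (insert r S) (addArc K r z a) := by
  have hrz : G.Adj r z := (hN z hz).2 rfl
  obtain ⟨a, hok, hcov⟩ := extend_one hG hK.ok hK.cov hr hz hN
  have hri : r ∈ insert r S := Finset.mem_insert_self _ _
  have hins : S = (insert r S).erase r := (Finset.erase_insert hr).symm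
  refine ⟨a, hok, hcov, ?_⟩
  intro w hw hdeg
  by_cases hwr : w = r
  · subst hwr
    rw [inAt_addArc_of_ne hrz.ne, hK.cov.inAt_eq_empty hr]
    simp
  have hwS : w ∈ S := by simpa [hwr] using hw
  by_cases hwz : w = z
  · subst hwz
    have := degOn_erase_of_adj hri hrz.symm
    rw [← hins] at this
    rw [inAt_addArc_head, hIz (by omega)]
    simp
  rw [inAt_addArc_of_ne hwz]
  have hnadj : ¬ G.Adj w r := fun h => hwz ((hN w hwS).1 h.symm)
  have := degOn_erase_of_not_adj (S := insert r S) hnadj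
  rw [← hins] at this
  exact hK.in_le w hwS (by omega)

lemma good_singleton (r : V) : Good G {r} (fun _ _ _ => False) := by
  refine ⟨⟨by simp, by simp [Col], by simp [Col], by simp⟩, ?_, ?_⟩
  · intro u v
    simp only [Col, or_self, exists_false, Finset.mem_singleton, false_iff]
    rintro ⟨h, rfl, rfl⟩
    exact G.loopless.irrefl _ h
  · intro w _ _
    rw [inAt_eq_empty (by simp)]
    simp

/-- A cycle has a coloring in which every vertex is the designated end of one edge. -/
lemma good_of_two_regular (hG : ∀ v, G.degree v ≤ 3) {S : Finset V} {r z z' : V} (hr : r ∉ S)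
    (hz : z ∈ S) (hz' : z' ∈ S) (hne : z ≠ z') (hN : ∀ x ∈ S, G.Adj r x ↔ x = z ∨ x = z')
    (hdz : degOn G S z = 1) (hdz' : degOn G S z' = 1)
    {K : V → V → Fin 8 → Prop} (hK : Good G S K) (hI : inAt K z = ∅) :
    ∃ K', Good G (insert r S) K' := by
  have hrz : G.Adj r z := (hN z hz).2 (Or.inl rfl)
  have hrz' : G.Adj r z' := (hN z' hz').2 (Or.inr rfl)
  have hzr : z ≠ r := fun h => hr (h ▸ hz)
  have hz'r : z' ≠ r := fun h => hr (h ▸ hz')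
  have hb : back G K r z ⊆ inAt K z' := back_subset hK.cov fun x hx => (hN x hx).1
  obtain ⟨a, -, -, -, -, ha⟩ := hK.ok.exists_extend hrz (hK.cov.not_col hr) ∅ (by
    rw [hK.cov.colAt_eq_empty hr]
    have := Finset.card_union_le (near G K r z) (back G K r z)
    have := Finset.card_le_card hb
    have := hK.cov.inAt_card_le hK.ok z'
    have := near_card_le hG hK.ok hrz
    simp only [Finset.union_empty]
    omega)
  obtain ⟨y, hy, hyN⟩ := degOn_eq_one hdz'
  have h1 : near G (addArc K r z a) z' r ⊆ insert a (colAt K z) := by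
    intro b hb
    obtain ⟨w, hw, hrw, x, hx⟩ := mem_near.1 hb
    rw [col_addArc] at hx
    rcases hx with hx | ⟨rfl, -⟩
    · have hwS : w ∈ S := ((hK.cov w x).1 ⟨b, hx⟩).2.1
      rcases (hN w hwS).1 hrw with rfl | rfl
      · exact Finset.mem_insert_of_mem (mem_colAt.2 ⟨x, hx⟩)
      · exact (hw rfl).elim
    · exact Finset.mem_insert_self _ _
  have h2 : colAt (addArc K r z a) z' = colAt K z' := colAt_addArc_of_ne hz'r hne.symm
  have h3 : back G (addArc K r z a) z' r ⊆ insert a (colAt K y) := by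
    intro b hb
    obtain ⟨w, hw, hrw, x, hx⟩ := mem_back.1 hb
    rcases hx with hx | ⟨-, -, rfl⟩
    · have hwS : w ∈ S := ((hK.cov x w).1 ⟨b, Or.inl hx⟩).2.2
      have := (hyN w hwS).1 hrw
      subst this
      exact Finset.mem_insert_of_mem (mem_colAt.2 ⟨x, Or.inr hx⟩)
    · exact Finset.mem_insert_self _ _
  -- This edge is designated at `r`, since `z'` may already carry a designation. Forbidden are at
  -- most two colors near `r`, one at `z'`, and four designated around `z'`: `a` and three colors at
  -- `y`.
  obtain ⟨b, -, -, -, -, hb⟩ := ha.exists_extend hrz'.symm (fun b => by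
      rw [col_addArc]
      rintro (h | ⟨-, ⟨h, -⟩ | ⟨h, -⟩⟩)
      exacts [hK.cov.not_col hr _ h.symm, hz'r h, hne h.symm]) ∅ (by
    have c1 := Finset.card_le_card h1
    have c2 := Finset.card_le_card h3
    have c3 := Finset.card_insert_le a (colAt K z)
    have c4 := Finset.card_insert_le a (colAt K y)
    have c5 := hK.cov.colAt_card_le hK.ok z
    have c6 := (colAt_card_le_degree hK.ok y).trans (hG y)
    have c7 := hK.cov.colAt_card_le hK.ok z'
    have c8 := Finset.card_union_le (near G (addArc K r z a) z' r ∪ colAt (addArc K r z a) z')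
      (back G (addArc K r z a) z' r)
    have c9 := Finset.card_union_le (near G (addArc K r z a) z' r) (colAt (addArc K r z a) z')
    rw [h2] at c8 c9
    rw [Finset.union_empty, h2]
    omega)
  refine ⟨_, hb, cov_insert hK.cov hr hz hz' hN fun x y => ?_, ?_⟩
  · rw [exists_col_addArc, exists_col_addArc]
    tauto
  have hins : S = (insert r S).erase r := (Finset.erase_insert hr).symm
  intro w hw hdeg
  by_cases hwr : w = r
  · subst hwr
    rw [inAt_addArc_head, inAt_addArc_of_ne hzr.symm, hK.cov.inAt_eq_empty hr]
    simp
  rw [inAt_addArc_of_ne hwr]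
  have hwS : w ∈ S := by simpa [hwr] using hw
  by_cases hwz : w = z
  · subst hwz
    rw [inAt_addArc_head, hI]
    simp
  rw [inAt_addArc_of_ne hwz]
  by_cases hwz' : w = z'
  · subst hwz'
    exact (hK.cov.inAt_card_le hK.ok w).trans hdz'.le
  have hnadj : ¬ G.Adj w r := fun h => by
    rcases (hN w hwS).1 h.symm with h | h <;> contradiction
  have := degOn_erase_of_not_adj (S := insert r S) hnadj
  rw [← hins] at this
  exact hK.in_le w hwS (by omega)

variable (G) in
/-- For every root of degree at most two, the set `S` has a good coloring with no edge designated
at the root, unless all vertices have degree two. -/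
def Rooted (S : Finset V) : Prop :=
  ∀ r ∈ S, ConnOn G S → degOn G S r ≤ 2 →
    ∃ K, Good G S K ∧ (inAt K r = ∅ ∨ ∀ w ∈ S, degOn G S w = 2)

variable (G) in
/-- For every two vertices of degree one, the set `S` has a good coloring with no edge designated
at one of them, unless all other vertices have degree two. -/
def TwoRooted (S : Finset V) : Prop :=
  ∀ r ∈ S, ∀ t ∈ S, r ≠ t → ConnOn G S → degOn G S r = 1 → degOn G S t = 1 →
    (∃ v ∈ S, v ≠ r ∧ v ≠ t ∧ degOn G S v ≠ 2) →
    ∃ K, Good G S K ∧ inAt K r = ∅ ∧ inAt K t = ∅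

/-- Remove the leaf `t` and restore its edge designated at the neighbor `y`. Paths are excluded for
a good reason: a path has one more edge than inner vertices, so if each inner vertex takes one edge,
an end must take the remaining one. -/
lemma twoRooted_of_ih (hG : ∀ v, G.degree v ≤ 3) {S : Finset V}
    (ih : ∀ T ⊂ S, Rooted G T ∧ TwoRooted G T) : TwoRooted G S := by
  intro r hr t ht hrt hS hdr hdt ⟨v, hv, hvr, hvt, hdv⟩
  obtain ⟨y, hy, hN⟩ := degOn_eq_one hdt
  have hty : G.Adj t y := (hN y hy).2 rfl
  have hyt : y ≠ t := hty.ne'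
  -- Otherwise `{r, t}` would be closed and hence all of `S`, leaving no room for `v`.
  have hyr : y ≠ r := by
    rintro rfl
    obtain ⟨z, hz, hzN⟩ := degOn_eq_one hdr
    have hzt : t = z := (hzN t ht).1 hty.symm
    have := hS.2 {y, t} (by
      intro x hx
      rcases Finset.mem_insert.1 hx with rfl | hx
      exacts [hr, Finset.mem_singleton.1 hx ▸ ht]) ⟨y, by simp⟩ (by
      intro a ha b hb hab
      rcases Finset.mem_insert.1 ha with rfl | ha
      · rw [(hzN b hb).1 hab, ← hzt]
        simp
      · rw [Finset.mem_singleton.1 ha] at hab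
        simp [(hN b hb).1 hab])
    rw [← this] at hv
    simp [hvr, hvt] at hv
  have hssub : S.erase t ⊂ S := Finset.erase_ssubset ht
  have hconn := hS.erase_of_degOn_eq_one ht hy hN
  have hins : insert t (S.erase t) = S := Finset.insert_erase ht
  have htn : t ∉ S.erase t := by simp
  have hye : y ∈ S.erase t := by simp [hy, hyt]
  have hre : r ∈ S.erase t := by simp [hr, hrt]
  have hNe : ∀ x ∈ S.erase t, G.Adj t x ↔ x = y := fun x hx => hN x (Finset.mem_of_mem_erase hx)
  have hnadj : ∀ x ∈ S, x ≠ y → ¬ G.Adj x t := fun x hx hxy h => hxy ((hN x hx).1 h.symm)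
  have hdr' : degOn G (S.erase t) r = 1 := by
    rw [degOn_erase_of_not_adj (hnadj r hr hyr.symm), hdr]
  have hdy' := degOn_erase_of_adj ht hty.symm
  have hfin : ∀ K, Good G (S.erase t) K → inAt K r = ∅ →
      (degOn G (S.erase t) y = 1 → inAt K y = ∅) →
      ∃ K, Good G S K ∧ inAt K r = ∅ ∧ inAt K t = ∅ := by
    intro K hK hIr hIy
    obtain ⟨a, ha⟩ := hK.insert_one hG htn hye hNe hIy
    rw [hins] at ha
    exact ⟨_, ha, by rw [inAt_addArc_of_ne hyr.symm, hIr],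
      by rw [inAt_addArc_of_ne hyt.symm, hK.cov.inAt_eq_empty htn]⟩
  -- If `y` becomes a leaf, then it has degree two in `S`, so it is not `v`, and the hypothesis on
  -- `v` passes on. Otherwise a free `r` is enough, and the leaf `r` shows that `S.erase t` is not a
  -- cycle.
  by_cases hd1 : degOn G (S.erase t) y = 1
  · obtain ⟨K, hK, h1, h2⟩ := (ih _ hssub).2 r hre y hye hyr.symm hconn hdr' hd1
      ⟨v, by simp [hv, hvt], hvr, by rintro rfl; omega, by
        rw [degOn_erase_of_not_adj (hnadj v hv (by rintro rfl; omega))]; exact hdv⟩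
    exact hfin K hK h1 fun _ => h2
  · obtain ⟨K, hK, h1⟩ := (ih _ hssub).1 r hre hconn (by omega)
    rcases h1 with h1 | h1
    · exact hfin K hK h1 fun h => (hd1 h).elim
    · have := h1 r hre
      omega

/-- Restored edges are designated away from `r`, so `r` stays free. What must be secured in `S.erase
r` is that a neighbor of degree one is free and that, of two neighbors, one is free and the other
carries at most one designation. -/
lemma rooted_of_ih (hG : ∀ v, G.degree v ≤ 3) {S : Finset V}
    (ih : ∀ T ⊂ S, Rooted G T ∧ TwoRooted G T) : Rooted G S := by
  intro r hr hS hdr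
  have hssub : S.erase r ⊂ S := Finset.erase_ssubset hr
  have hins : insert r (S.erase r) = S := Finset.insert_erase hr
  have hrn : r ∉ S.erase r := by simp
  have h012 : degOn G S r = 0 ∨ degOn G S r = 1 ∨ degOn G S r = 2 := by omega
  rcases h012 with hd | hd | hd
  · have hSr : {r} = S := hS.2 {r} (by simpa using hr) ⟨r, by simp⟩ (by
      intro a ha b hb hab
      rw [Finset.mem_singleton.1 ha] at hab
      exact (degOn_eq_zero hd hb hab).elim)
    refine ⟨_, hSr ▸ good_singleton r, Or.inl (inAt_eq_empty (by simp))⟩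
  · obtain ⟨z, hz, hN⟩ := degOn_eq_one hd
    have hrz : G.Adj r z := (hN z hz).2 rfl
    have hze : z ∈ S.erase r := by simp [hz, hrz.ne']
    have hconn := hS.erase_of_degOn_eq_one hr hz hN
    have hdz := degOn_erase_of_adj hr hrz.symm
    have hdz3 := (degOn_le_degree S z).trans (hG z)
    obtain ⟨K, hK, hI⟩ := (ih _ hssub).1 z hze hconn (by omega)
    obtain ⟨a, ha⟩ := hK.insert_one hG hrn hze (fun x hx => hN x (Finset.mem_of_mem_erase hx))
      (fun h => by
        rcases hI with hI | hI
        · exact hI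
        · have := hI z hze
          omega)
    rw [hins] at ha
    exact ⟨_, ha, Or.inl (by rw [inAt_addArc_of_ne hrz.ne, hK.cov.inAt_eq_empty hrn])⟩
  obtain ⟨z, hz, z', hz', hne, hN⟩ := degOn_eq_two hd
  have hrz : G.Adj r z := (hN z hz).2 (Or.inl rfl)
  have hrz' : G.Adj r z' := (hN z' hz').2 (Or.inr rfl)
  have hze : z ∈ S.erase r := by simp [hz, hrz.ne']
  have hze' : z' ∈ S.erase r := by simp [hz', hrz'.ne']
  have hNe : ∀ x ∈ S.erase r, G.Adj r x ↔ x = z ∨ x = z' :=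
    fun x hx => hN x (Finset.mem_of_mem_erase hx)
  have hdz := degOn_erase_of_adj hr hrz.symm
  have hdz' := degOn_erase_of_adj hr hrz'.symm
  have hdz3 := (degOn_le_degree S z).trans (hG z)
  have hdz3' := (degOn_le_degree S z').trans (hG z')
  by_cases hconn : ConnOn G (S.erase r)
  · -- the case in which one of the neighbors has degree three
    have main : ∀ z z', z ∈ S.erase r → z' ∈ S.erase r → z ≠ z' →
        (∀ x ∈ S.erase r, G.Adj r x ↔ x = z ∨ x = z') → degOn G (S.erase r) z ≤ 2 →
        degOn G (S.erase r) z' = 2 →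
        ∃ K, Good G S K ∧ (inAt K r = ∅ ∨ ∀ w ∈ S, degOn G S w = 2) := by
      intro z z' hz hz' hne hN h1 h2
      obtain ⟨K, hK, hI⟩ := (ih _ hssub).1 z hz hconn h1
      obtain ⟨K', hK', hI'⟩ := hK.insert_two hG hrn hz hz' hne hN (by
        rcases hI with hI | hI
        · exact Or.inl hI
        · exact Or.inr ⟨hK.in_le z hz (hI z hz), hI z hz, fun w hw => (hI w hw).le⟩)
        (hK.in_le z' hz' h2) (by omega)
      rw [hins] at hK'
      exact ⟨K', hK', Or.inl hI'⟩
    by_cases h3' : degOn G S z' = 3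
    · exact main z z' hze hze' hne hNe (by omega) (by omega)
    by_cases h3 : degOn G S z = 3
    · exact main z' z hze' hze hne.symm (fun x hx => (hNe x hx).trans or_comm) (by omega) (by omega)
    -- From here on both neighbors are leaves of `S.erase r`; connectedness rules out degree zero.
    have hpos : ∀ u v, u ∈ S.erase r → v ∈ S.erase r → u ≠ v → degOn G (S.erase r) u ≠ 0 := by
      intro u v hu hv huv h0
      have := hconn.2 {u} (by simpa using hu) ⟨u, by simp⟩ (by
        intro a ha b hb hab
        rw [Finset.mem_singleton.1 ha] at hab
        exact (degOn_eq_zero h0 hb hab).elim)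
      rw [← this, Finset.mem_singleton] at hv
      exact huv hv.symm
    have hp := hpos z z' hze hze' hne
    have hp' := hpos z' z hze' hze hne.symm
    have h1 : degOn G (S.erase r) z = 1 := by omega
    have h1' : degOn G (S.erase r) z' = 1 := by omega
    -- If `S` is a cycle, `S.erase r` is a path, the case left out of `TwoRooted`; then a
    -- designation at `r` is accepted.
    by_cases hall : ∀ w ∈ S, degOn G S w = 2
    · obtain ⟨K, hK, hI⟩ := (ih _ hssub).1 z hze hconn (by omega)
      have hI : inAt K z = ∅ := by
        rcases hI with hI | hI
        · exact hI
        · have := hI z hze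
          omega
      obtain ⟨K', hK'⟩ := good_of_two_regular hG hrn hze hze' hne hNe h1 h1' hK hI
      rw [hins] at hK'
      exact ⟨K', hK', Or.inr hall⟩
    · push Not at hall
      obtain ⟨v, hv, hdv⟩ := hall
      have hvr : v ≠ r := by rintro rfl; omega
      have hvz : v ≠ z := by rintro rfl; omega
      have hvz' : v ≠ z' := by rintro rfl; omega
      obtain ⟨K, hK, hI, hI'⟩ := (ih _ hssub).2 z hze z' hze' hne hconn h1 h1'
        ⟨v, by simp [hv, hvr], hvz, hvz', by
          rw [degOn_erase_of_not_adj]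
          · exact hdv
          · intro h
            rcases (hN v hv).1 h.symm with h | h <;> contradiction⟩
      obtain ⟨K', hK', hI''⟩ := hK.insert_two hG hrn hze hze' hne hNe (Or.inl hI)
        (by simp [hI']) (fun _ => hI')
      rw [hins] at hK'
      exact ⟨K', hK', Or.inl hI''⟩
  -- Each side is colored with its own root. A root that cannot be kept free lies on a cycle and
  -- carries at most one designation. If this happens on both sides, all degrees are two, and the
  -- second alternative of `Good.insert_two` applies.
  · obtain ⟨A, B, hAB, hdis, hzA, hzB, hA, hB, hAc, hBc⟩ := hS.split hr hz hN hconn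
    have hAS : A ⊆ S.erase r := hAB ▸ Finset.subset_union_left
    have hBS : B ⊆ S.erase r := hAB ▸ Finset.subset_union_right
    have hdA := fun {w} (hw : w ∈ A) => degOn_congr_of_closed hAS hAc hw
    have hdB := fun {w} (hw : w ∈ B) => degOn_congr_of_closed hBS hBc hw
    have e1 := hdA hzA
    have e2 := hdB hzB
    obtain ⟨K, hK, hI⟩ := (ih A (hAS.trans_ssubset hssub)).1 z hzA hA (by omega)
    obtain ⟨L, hL, hJ⟩ := (ih B (hBS.trans_ssubset hssub)).1 z' hzB hB (by omega)
    obtain ⟨M, hM, hMA, hMB⟩ := Good.union hAB hdis hAc hBc hK hL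
    have e3 := hMA z hzA
    have e4 := hMB z' hzB
    rw [← e3] at hI
    rw [← e4] at hJ
    have hfin : ∀ K, Good G (insert r (S.erase r)) K ∧ inAt K r = ∅ →
        ∃ K, Good G S K ∧ (inAt K r = ∅ ∨ ∀ w ∈ S, degOn G S w = 2) := by
      rintro K ⟨h1, h2⟩
      rw [hins] at h1
      exact ⟨K, h1, Or.inl h2⟩
    have hMz : (∀ w ∈ A, degOn G A w = 2) → degOn G (S.erase r) z = 2 ∧ (inAt M z).card ≤ 1 :=
      fun h => by
        have := h z hzA
        exact ⟨by omega, hM.in_le z hze (by omega)⟩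
    have hMz' : (∀ w ∈ B, degOn G B w = 2) → degOn G (S.erase r) z' = 2 ∧ (inAt M z').card ≤ 1 :=
      fun h => by
        have := h z' hzB
        exact ⟨by omega, hM.in_le z' hze' (by omega)⟩
    rcases hI with hI | hI
    · obtain ⟨K', hK'⟩ := hM.insert_two hG hrn hze hze' hne hNe (Or.inl hI) (by
        rcases hJ with hJ | hJ
        · simp [hJ]
        · exact (hMz' hJ).2) (fun h => by
        rcases hJ with hJ | hJ
        · exact hJ
        · have := (hMz' hJ).1
          omega)
      exact hfin K' hK'
    · obtain ⟨f1, f2⟩ := hMz hI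
      rcases hJ with hJ | hJ
      · obtain ⟨K', hK'⟩ := hM.insert_two hG hrn hze' hze hne.symm
          (fun x hx => (hNe x hx).trans or_comm) (Or.inl hJ) f2 (by omega)
        exact hfin K' hK'
      · obtain ⟨g1, g2⟩ := hMz' hJ
        obtain ⟨L, hL⟩ := hM.insert_two hG hrn hze hze' hne hNe (Or.inr ⟨f2, f1, by
          intro w hw
          rw [← hAB, Finset.mem_union] at hw
          rcases hw with hw | hw
          · exact ((hdA hw).symm.trans (hI w hw)).le
          · exact ((hdB hw).symm.trans (hJ w hw)).le⟩) g2 (by omega)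
        exact hfin L hL

/-- A connected set with a root of degree at most two has a good coloring, with no edge designated
at the root unless the set induces a cycle. -/
theorem exists_good (hG : ∀ v, G.degree v ≤ 3) (S : Finset V) : Rooted G S := by
  have : Rooted G S ∧ TwoRooted G S := by
    induction S using Finset.strongInduction with
    | H S ih => exact ⟨rooted_of_ih hG ih, twoRooted_of_ih hG ih⟩
  exact this.1

end Claim

end SemistrongColoring

namespace SemistrongColoring

/-! ### Sets with several components, and complements in a connected graph -/

section Components

set_option linter.unusedSectionVars false

variable {V : Type*} [Fintype V] [DecidableEq V] {G : SimpleGraph V} [DecidableRel G.Adj]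

variable (G) in
/-- Every component of the subgraph induced by `S` has a vertex of degree at most two. -/
def Light (S : Finset V) : Prop :=
  ∀ T ⊆ S, T.Nonempty → ClosedIn G S T → ∃ w ∈ T, degOn G S w ≤ 2

variable (G) in
/-- `T` is a component of `S` and induces a cycle. -/
structure CycleComponent (S T : Finset V) : Prop where
  sub : T ⊆ S
  closed : ClosedIn G S T
  conn : ConnOn G T
  deg : ∀ w ∈ T, degOn G S w = 2

lemma Light.sdiff {S T : Finset V} (h : Light G S) (hT : ClosedIn G S T) : Light G (S \ T) := by
  intro U hU hne hcl
  obtain ⟨w, hw, hd⟩ := h U (hU.trans Finset.sdiff_subset) hne (hT.sdiff.trans hcl hU)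
  exact ⟨w, hw, by rwa [degOn_congr_of_closed Finset.sdiff_subset hT.sdiff (hU hw)]⟩

/-- Each component has a vertex of degree at most two to serve as root, and colorings of different
components do not interact. -/
lemma Light.exists_good (hG : ∀ v, G.degree v ≤ 3) {S : Finset V} (h : Light G S) :
    ∃ K, Good G S K := by
  induction S using Finset.strongInduction with
  | H S ih =>
    rcases S.eq_empty_or_nonempty with rfl | ⟨r, hr⟩
    · refine ⟨fun _ _ _ => False, ⟨by simp, by simp [Col], by simp [Col], by simp⟩, ?_, by simp⟩
      intro u v
      simp [Col]
    · obtain ⟨T, hTS, hrT, hcl, hconn⟩ := exists_component (G := G) S hr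
      obtain ⟨w, hw, hd⟩ := h T hTS ⟨r, hrT⟩ hcl
      obtain ⟨K, hK, -⟩ := SemistrongColoring.exists_good hG T w hw hconn
        (by rwa [degOn_congr_of_closed hTS hcl hw])
      obtain ⟨L, hL⟩ := ih (S \ T) (Finset.sdiff_ssubset hTS ⟨r, hrT⟩) (h.sdiff hcl)
      obtain ⟨M, hM, -⟩ := Good.union (Finset.union_sdiff_of_subset hTS) Finset.disjoint_sdiff hcl
        hcl.sdiff hK hL
      exact ⟨M, hM⟩

lemma Light.exists_good_root (hG : ∀ v, G.degree v ≤ 3) {S : Finset V} (h : Light G S) {r : V}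
    (hr : r ∈ S) (hd : degOn G S r ≤ 2) :
    ∃ K, Good G S K ∧ (inAt K r = ∅ ∨ ∃ T, r ∈ T ∧ CycleComponent G S T) := by
  obtain ⟨T, hTS, hrT, hcl, hconn⟩ := exists_component (G := G) S hr
  have hdeg := fun {w} (hw : w ∈ T) => degOn_congr_of_closed hTS hcl hw
  obtain ⟨K, hK, hI⟩ := SemistrongColoring.exists_good hG T r hrT hconn (by rwa [hdeg hrT])
  obtain ⟨L, hL⟩ := (h.sdiff hcl).exists_good hG
  obtain ⟨M, hM, hMT, -⟩ := Good.union (Finset.union_sdiff_of_subset hTS) Finset.disjoint_sdiff hcl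
    hcl.sdiff hK hL
  refine ⟨M, hM, ?_⟩
  rcases hI with hI | hI
  · exact Or.inl ((hMT r hrT).trans hI)
  · exact Or.inr ⟨T, hrT, hTS, hcl, hconn, fun w hw => (hdeg hw).symm.trans (hI w hw)⟩

lemma Cov.insert_two_arcs {K : V → V → Fin 8 → Prop} {S : Finset V} (hc : Cov G K S) {s u u' : V}
    (hs : s ∉ S) (hu : u ∈ S) (hu' : u' ∈ S) (hN : ∀ x ∈ S, G.Adj s x ↔ x = u ∨ x = u')
    {a b : Fin 8} : Cov G (addArc (addArc K u s a) u' s b) (insert s S) := by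
  refine cov_insert hc hs hu hu' hN fun x y => ?_
  rw [exists_col_addArc, exists_col_addArc]
  tauto

/-- Nothing is designated at `r`, and at most one edge at every other vertex of degree two, with
the possible exception of a given vertex `s` that lies on the cycle through `r`. -/
lemma Light.exists_root_exempt (hG : ∀ v, G.degree v ≤ 3) {S : Finset V} (h : Light G S) {r s : V}
    (hr : r ∈ S) (hd : degOn G S r ≤ 2) (hrs : r ≠ s)
    (hT : ∀ T, r ∈ T → CycleComponent G S T → s ∈ T) :
    ∃ K, Ok G K ∧ Cov G K S ∧ inAt K r = ∅ ∧
      ∀ w ∈ S, w ≠ s → degOn G S w = 2 → (inAt K w).card ≤ 1 := by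
  obtain ⟨K, hK, hI | ⟨T, hrT, hTc⟩⟩ := h.exists_good_root hG hr hd
  · exact ⟨K, hK.ok, hK.cov, hI, fun w hw _ hd => hK.in_le w hw hd⟩
  -- Now `r` and `s` lie on the cycle `T`. Deleting `s` opens it into a path, on which `r` can be
  -- kept free; both edges at `s` are then designated at `s`.
  clear K hK
  have hsT := hT T hrT hTc
  have hsS := hTc.sub hsT
  obtain ⟨u, hu, u', hu', huu, hN⟩ := degOn_eq_two (hTc.deg s hsT)
  have hsu : G.Adj s u := (hN u hu).2 (Or.inl rfl)
  have hsu' : G.Adj s u' := (hN u' hu').2 (Or.inr rfl)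
  have hdT : ∀ x ∈ S, G.Adj s x → degOn G (S.erase s) x = 1 := by
    intro x hx hsx
    have h1 := degOn_erase_of_adj hsS hsx.symm
    have h2 := hTc.deg x (hTc.closed s hsT x hx hsx)
    omega
  have hclosed : ∀ U ⊆ S.erase s, (∀ x ∈ U, ¬ G.Adj s x) → ClosedIn G (S.erase s) U →
      ClosedIn G S U := by
    intro U hU hn hcl a ha b hb hab
    by_cases hbs : b = s
    · exact (hn a ha (hbs ▸ hab.symm)).elim
    · exact hcl a ha b (by simp [hb, hbs]) hab
  have hL : Light G (S.erase s) := by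
    intro U hU hne hcl
    by_cases hn : ∃ x ∈ U, G.Adj s x
    · obtain ⟨x, hx, hsx⟩ := hn
      exact ⟨x, hx, by rw [hdT x (Finset.mem_of_mem_erase (hU hx)) hsx]; norm_num⟩
    · push Not at hn
      obtain ⟨w, hw, hd⟩ := h U (hU.trans (Finset.erase_subset _ _)) hne (hclosed U hU hn hcl)
      exact ⟨w, hw, degOn_erase_le.trans hd⟩
  have hre : r ∈ S.erase s := by simp [hr, hrs]
  have hsn : s ∉ S.erase s := by simp
  have hins : insert s (S.erase s) = S := Finset.insert_erase hsS
  obtain ⟨K, hK, hI⟩ := hL.exists_good_root hG hre (degOn_erase_le.trans hd)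
  have hI : inAt K r = ∅ := by
    rcases hI with hI | ⟨T', hrT', hT'⟩
    · exact hI
    -- A cycle component through `r` would avoid the neighbors of `s`, which are now leaves. It
    -- would be closed in `S` and so contain all of `T`, including `s`.
    exfalso
    have hn : ∀ x ∈ T', ¬ G.Adj s x := fun x hx hsx => by
      have h1 := hdT x (Finset.mem_of_mem_erase (hT'.sub hx)) hsx
      have h2 := hT'.deg x hx
      omega
    have hcl := hclosed T' hT'.sub hn hT'.closed
    have := hTc.conn.2 (T' ∩ T) Finset.inter_subset_right ⟨r, by simp [hrT, hrT']⟩ (by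
      intro a ha b hb hab
      rw [Finset.mem_inter] at ha ⊢
      exact ⟨hcl a ha.1 b (hTc.sub hb) hab, hb⟩)
    have hs' : s ∈ T' ∩ T := by rw [this]; exact hsT
    exact hsn (hT'.sub (Finset.mem_inter.1 hs').1)
  have hue : u ∈ S.erase s := by simp [hu, hsu.ne']
  have hue' : u' ∈ S.erase s := by simp [hu', hsu'.ne']
  have hc1 : ∀ x ∈ S, G.Adj s x → (colAt K x).card ≤ 1 := fun x hx hsx =>
    (hK.cov.colAt_card_le hK.ok x).trans (hdT x hx hsx).le
  have hback : ∀ x ∈ S, G.Adj s x → (back G K x s).card ≤ 3 := by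
    intro x hx hsx
    obtain ⟨y, hy, hyN⟩ := degOn_eq_one (hdT x hx hsx)
    refine (Finset.card_le_card (t := colAt K y) ?_).trans
      ((colAt_card_le_degree hK.ok y).trans (hG y))
    intro b hb
    obtain ⟨w, hw, hxw, t, ht⟩ := mem_back.1 hb
    have hwS : w ∈ S.erase s := ((hK.cov t w).1 ⟨b, Or.inl ht⟩).2.2
    obtain rfl := (hyN w hwS).1 hxw
    exact mem_colAt.2 ⟨t, Or.inr ht⟩
  have hnear : ∀ x y, (∀ w ∈ S, G.Adj s w ↔ w = x ∨ w = y) → near G K x s ⊆ colAt K y := by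
    intro x y hxy b hb
    obtain ⟨w, hw, hsw, t, ht⟩ := mem_near.1 hb
    have hwS : w ∈ S.erase s := ((hK.cov w t).1 ⟨b, ht⟩).2.1
    rcases (hxy w (Finset.mem_of_mem_erase hwS)).1 hsw with rfl | rfl
    · exact (hw rfl).elim
    · exact mem_colAt.2 ⟨t, ht⟩
  -- Forbidden are at most one color at `u'`, one at `u`, and three at the remaining neighbor of
  -- `u`. The second edge has the same count plus `a`.
  obtain ⟨a, -, -, -, -, ha⟩ := hK.ok.exists_extend hsu.symm
    (fun b hb => hK.cov.not_col hsn b hb.symm) ∅ (by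
      have c1 := Finset.card_le_card (hnear u u' hN)
      have c2 := hc1 u' hu' hsu'
      have c3 := hc1 u hu hsu
      have c4 := hback u hu hsu
      have c5 := Finset.card_union_le (near G K u s ∪ colAt K u) (back G K u s)
      have c6 := Finset.card_union_le (near G K u s) (colAt K u)
      rw [Finset.union_empty]
      omega)
  obtain ⟨b, -, -, -, -, hb⟩ := ha.exists_extend hsu'.symm (fun b => by
      rw [col_addArc]
      rintro (h | ⟨-, ⟨h, -⟩ | ⟨h, -⟩⟩)
      exacts [hK.cov.not_col hsn _ h.symm, huu h.symm, hsu'.ne' h]) ∅ (by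
      have c0 : near G (addArc K u s a) u' s ⊆ insert a (near G K u' s) := near_addArc_subset
      have c1 := Finset.card_le_card (hnear u' u fun w hw => (hN w hw).trans or_comm)
      have c2 := hc1 u' hu' hsu'
      have c3 := hc1 u hu hsu
      have c4 := hback u' hu' hsu'
      have c7 : back G (addArc K u s a) u' s ⊆ back G K u' s := by
        intro b hb
        obtain ⟨w, hw, h1, x, hx | ⟨-, h2, -⟩⟩ := mem_back.1 hb
        · exact mem_back.2 ⟨w, hw, h1, x, hx⟩
        · exact (hw h2).elim
      have c8 := Finset.card_le_card c7
      have c9 := Finset.card_le_card c0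
      have c10 := Finset.card_insert_le a (near G K u' s)
      rw [Finset.union_empty, colAt_addArc_of_ne huu.symm hsu'.ne']
      have c5 := Finset.card_union_le (near G (addArc K u s a) u' s ∪ colAt K u')
        (back G (addArc K u s a) u' s)
      have c6 := Finset.card_union_le (near G (addArc K u s a) u' s) (colAt K u')
      omega)
  refine ⟨_, hb, ?_, ?_, ?_⟩
  · rw [← hins]
    exact hK.cov.insert_two_arcs hsn hue hue' fun x hx => hN x (Finset.mem_of_mem_erase hx)
  · rw [inAt_addArc_of_ne hrs, inAt_addArc_of_ne hrs, hI]
  · intro w hw hws hdw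
    rw [inAt_addArc_of_ne hws, inAt_addArc_of_ne hws]
    by_cases hadj : G.Adj s w
    · exact (Finset.card_le_card (inAt_subset_colAt K w)).trans (hc1 w hw hadj)
    · exact hK.in_le w (by simp [hw, hws])
        (by rw [degOn_erase_of_not_adj fun h => hadj h.symm, hdw])

lemma connOn_univ (h : G.Connected) : ConnOn G Finset.univ := by
  obtain ⟨v⟩ := h.nonempty
  refine ⟨⟨v, Finset.mem_univ v⟩, ?_⟩
  intro T _ ⟨x, hx⟩ hcl
  refine Finset.eq_univ_of_forall fun y => ?_
  obtain ⟨p⟩ := h.preconnected x y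
  induction p with
  | nil => exact hx
  | cons hadj p ih => exact ih (hcl _ hx _ (Finset.mem_univ _) hadj)

/-- Removing a nonempty set of vertices from a connected subcubic graph. -/
lemma light_sdiff (hG : ∀ v, G.degree v ≤ 3) (hc : ConnOn G Finset.univ) {X : Finset V}
    (hX : X.Nonempty) : Light G (Finset.univ \ X) := by
  intro T hT hne hcl
  -- If all these degrees were three, no edge would leave `T`. Then `T` would be the whole vertex
  -- set, although it misses `X`.
  by_contra! hcon
  have := hc.2 T (Finset.subset_univ _) hne (by
    intro a ha b _ hab
    have h1 := hcon a ha
    have h2 := hG a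
    have h3 : G.neighborFinset a ∩ (Finset.univ \ X) = G.neighborFinset a := by
      apply Finset.eq_of_subset_of_card_le Finset.inter_subset_left
      rw [G.card_neighborFinset_eq_degree]
      unfold degOn at h1
      omega
    have h4 : b ∈ G.neighborFinset a ∩ (Finset.univ \ X) := by rw [h3]; simpa using hab
    exact hcl a ha b (Finset.mem_inter.1 h4).2 hab)
  obtain ⟨x, hx⟩ := hX
  have hxT : x ∈ T := this ▸ Finset.mem_univ x
  simpa [hx] using hT hxT

end Components

end SemistrongColoring

namespace SemistrongColoring

/-! ### Diamonds, complete graphs on four vertices, and triangles -/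

section Small

set_option linter.unusedSectionVars false

variable {V : Type*} [Fintype V] [DecidableEq V] {G : SimpleGraph V} [DecidableRel G.Adj]

lemma colAt_addArc {K : V → V → Fin 8 → Prop} {u v w : V} {a : Fin 8} :
    colAt (addArc K u v a) w = if w = u ∨ w = v then insert a (colAt K w) else colAt K w := by
  split_ifs with h
  · rcases h with rfl | rfl
    exacts [colAt_addArc_left, colAt_addArc_right]
  · push Not at h
    exact colAt_addArc_of_ne h.1 h.2

lemma inAt_addArc {K : V → V → Fin 8 → Prop} {u v w : V} {a : Fin 8} :
    inAt (addArc K u v a) w = if w = v then insert a (inAt K w) else inAt K w := by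
  split_ifs with h
  · subst h
    exact inAt_addArc_head
  · exact inAt_addArc_of_ne h

lemma near_subset {K : V → V → Fin 8 → Prop} {u v b c : V}
    (h : ∀ x, G.Adj v x → x = u ∨ x = b ∨ x = c) : near G K u v ⊆ colAt K b ∪ colAt K c := by
  intro a ha
  obtain ⟨w, hw, hvw, hx⟩ := mem_near.1 ha
  rw [Finset.mem_union, mem_colAt, mem_colAt]
  rcases h w hvw with rfl | rfl | rfl
  exacts [(hw rfl).elim, Or.inl hx, Or.inr hx]

lemma back_subset_union {K : V → V → Fin 8 → Prop} {u v b c : V}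
    (h : ∀ x, G.Adj u x → x = v ∨ x = b ∨ x = c) : back G K u v ⊆ inAt K b ∪ inAt K c := by
  intro a ha
  obtain ⟨w, hw, hvw, hx⟩ := mem_back.1 ha
  rw [Finset.mem_union, mem_inAt, mem_inAt]
  rcases h w hvw with rfl | rfl | rfl
  exacts [(hw rfl).elim, Or.inl hx, Or.inr hx]

variable (G) in
/-- The coloring `K'` arises from `K` by coloring the edges in `E` with colors in `U`. -/
structure Ext (K K' : V → V → Fin 8 → Prop) (U : Finset (Fin 8)) (E : Finset (Sym2 V)) :
    Prop where
  ok : Ok G K'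
  col : ∀ w, colAt K' w ⊆ colAt K w ∪ U
  inn : ∀ w, inAt K' w ⊆ inAt K w ∪ U
  edge : ∀ x y, (∃ a, Col K' x y a) ↔ (∃ a, Col K x y a) ∨ s(x, y) ∈ E

lemma Ext.refl {K : V → V → Fin 8 → Prop} (h : Ok G K) : Ext G K K ∅ ∅ :=
  ⟨h, by simp, by simp, by simp⟩

/-- The point is bookkeeping: forbidden colors are computed in the initial coloring `K` only, and
all effects of later edges are absorbed by making the new color differ from those in `U`. -/
lemma Ext.step {K K' : V → V → Fin 8 → Prop} {U : Finset (Fin 8)} {E : Finset (Sym2 V)}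
    (h : Ext G K K' U E) {u v : V} (huv : G.Adj u v) (hK : ∀ b, ¬ Col K u v b)
    (hE : s(u, v) ∉ E) {Z : Finset (Fin 8)}
    (hZ : near G K u v ∪ colAt K u ∪ back G K u v ⊆ Z) {a : Fin 8} (ha : a ∉ Z ∪ U) :
    Ext G K (addArc K' u v a) (insert a U) (insert s(u, v) E) := by
  rw [Finset.mem_union, not_or] at ha
  have hnew : ∀ b, ¬ Col K' u v b := fun b hb => by
    rcases (h.edge u v).1 ⟨b, hb⟩ with ⟨b, hb⟩ | hb
    exacts [hK b hb, hE hb]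
  have key : ∀ {X : Finset (Fin 8)}, X ⊆ near G K u v ∪ colAt K u ∪ back G K u v → a ∉ X ∪ U :=
    fun hX h' => (Finset.mem_union.1 h').elim (fun h'' => ha.1 (hZ (hX h''))) ha.2
  refine ⟨h.ok.extend huv hnew (fun h' => ?_) (fun h' => ?_) (fun h' => ?_), fun w => ?_,
    fun w => ?_, fun x y => ?_⟩
  · refine key (X := near G K u v)
      (Finset.subset_union_left.trans Finset.subset_union_left) ?_
    obtain ⟨w, h1, h2, h3⟩ := mem_near.1 h'
    rcases Finset.mem_union.1 (h.col w (mem_colAt.2 h3)) with h4 | h4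
    · exact Finset.mem_union_left _ (mem_near.2 ⟨w, h1, h2, mem_colAt.1 h4⟩)
    · exact Finset.mem_union_right _ h4
  · exact key (X := colAt K u) (Finset.subset_union_right.trans Finset.subset_union_left)
      (h.col u h')
  · refine key (X := back G K u v) Finset.subset_union_right ?_
    obtain ⟨w, h1, h2, h3⟩ := mem_back.1 h'
    rcases Finset.mem_union.1 (h.inn w (mem_inAt.2 h3)) with h4 | h4
    · exact Finset.mem_union_left _ (mem_back.2 ⟨w, h1, h2, mem_inAt.1 h4⟩)
    · exact Finset.mem_union_right _ h4
  · have := h.col w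
    rw [colAt_addArc, Finset.union_insert]
    split_ifs
    · exact Finset.insert_subset_insert _ this
    · exact this.trans (Finset.subset_insert _ _)
  · have := h.inn w
    rw [inAt_addArc, Finset.union_insert]
    split_ifs
    · exact Finset.insert_subset_insert _ this
    · exact this.trans (Finset.subset_insert _ _)
  · rw [exists_col_addArc, h.edge, Finset.mem_insert, Sym2.eq_iff]
    tauto

lemma Ext.greedy {K K' : V → V → Fin 8 → Prop} {U : Finset (Fin 8)} {E : Finset (Sym2 V)}
    (h : Ext G K K' U E) {u v : V} (huv : G.Adj u v) (hK : ∀ b, ¬ Col K u v b)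
    (hE : s(u, v) ∉ E) (Z : Finset (Fin 8))
    (hZ : near G K u v ∪ colAt K u ∪ back G K u v ⊆ Z) (hc : (Z ∪ U).card ≤ 7) :
    ∃ K'' a, Ext G K K'' (insert a U) (insert s(u, v) E) := by
  obtain ⟨a, ha⟩ := exists_notMem_of_card_le hc
  exact ⟨_, a, h.step huv hK hE hZ ha⟩

lemma forbidden_subset {K : V → V → Fin 8 → Prop} {u v u₁ u₂ v₁ v₂ : V} {Z : Finset (Fin 8)}
    (hu : ∀ x, G.Adj u x → x = v ∨ x = u₁ ∨ x = u₂)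
    (hv : ∀ x, G.Adj v x → x = u ∨ x = v₁ ∨ x = v₂)
    (h1 : colAt K v₁ ⊆ Z) (h2 : colAt K v₂ ⊆ Z) (h3 : colAt K u ⊆ Z) (h4 : inAt K u₁ ⊆ Z)
    (h5 : inAt K u₂ ⊆ Z) : near G K u v ∪ colAt K u ∪ back G K u v ⊆ Z :=
  Finset.union_subset (Finset.union_subset ((near_subset hv).trans (Finset.union_subset h1 h2)) h3)
    ((back_subset_union hu).trans (Finset.union_subset h4 h5))

/-- A pendant edge at a vertex all of whose other neighbors are still uncolored. -/
lemma Ok.exists_pendant (hG : ∀ v, G.degree v ≤ 3) {K : V → V → Fin 8 → Prop} (h : Ok G K)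
    {u v u₁ u₂ : V} (huv : G.Adj u v) (hu : ∀ x, G.Adj u x → x = v ∨ x = u₁ ∨ x = u₂)
    (h0 : colAt K u = ∅) (h1 : inAt K u₁ = ∅) (h2 : inAt K u₂ = ∅) (b : Fin 8) :
    ∃ a, a ≠ b ∧ a ∉ colAt K v ∧ Ok G (addArc K u v a) := by
  have hb : back G K u v = ∅ := by
    have := back_subset_union (K := K) hu
    rw [h1, h2] at this
    simpa using this
  have hnew : ∀ b, ¬ Col K u v b := fun b hb => by
    have : b ∈ colAt K u := mem_colAt.2 ⟨v, hb⟩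
    simp [h0] at this
  obtain ⟨a, h1, -, -, h4, h5⟩ := h.exists_extend huv hnew {b} (by
      have := near_card_le hG h huv
      have := Finset.card_union_le (near G K u v) {b}
      rw [hb, h0, Finset.union_empty, Finset.union_empty]
      rw [Finset.card_singleton] at this
      omega)
  refine ⟨a, by simpa using h4, fun ha => ?_, h5⟩
  obtain ⟨x, hx⟩ := mem_colAt.1 ha
  refine h1 (mem_near.2 ⟨x, ?_, h.col_adj hx, v, hx.symm⟩)
  rintro rfl
  exact hnew a hx.symm

lemma exists_third {v a b : V} (hd : G.degree v = 3) (ha : G.Adj v a) (hb : G.Adj v b)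
    (hab : a ≠ b) : ∃ c, c ≠ a ∧ c ≠ b ∧ ∀ x, G.Adj v x ↔ x = a ∨ x = b ∨ x = c := by
  have h1 : ((G.neighborFinset v).erase a).erase b = G.neighborFinset v \ {a, b} := by
    ext x
    simp
    tauto
  have h2 : (((G.neighborFinset v).erase a).erase b).card = 1 := by
    rw [Finset.card_erase_of_mem, Finset.card_erase_of_mem, G.card_neighborFinset_eq_degree, hd]
    · simpa using ha
    · simp [hb, hab.symm]
  obtain ⟨c, hc⟩ := Finset.card_eq_one.1 h2
  have h3 : ∀ x, x ≠ b ∧ x ≠ a ∧ G.Adj v x ↔ x = c := by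
    intro x
    rw [← Finset.mem_singleton, ← hc]
    simp
  obtain ⟨hcb, hca, hvc⟩ := (h3 c).2 rfl
  refine ⟨c, hca, hcb, fun x => ⟨fun hx => ?_, ?_⟩⟩
  · by_cases hxa : x = a
    · exact Or.inl hxa
    by_cases hxb : x = b
    · exact Or.inr (Or.inl hxb)
    exact Or.inr (Or.inr ((h3 x).1 ⟨hxb, hxa, hx⟩))
  · rintro (rfl | rfl | rfl) <;> assumption

variable (G) in
/-- Every edge is colored. -/
def Full (K : V → V → Fin 8 → Prop) : Prop := ∀ u v, G.Adj u v → ∃ a, Col K u v a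

lemma full_of_cov {K K' : V → V → Fin 8 → Prop} {X : Finset V}
    (hK : Cov G K (Finset.univ \ X)) (hKK : ∀ u v, (∃ a, Col K u v a) → ∃ a, Col K' u v a)
    (hX : ∀ u ∈ X, ∀ v, G.Adj u v → ∃ a, Col K' u v a) : Full G K' := by
  intro u v huv
  by_cases hu : u ∈ X
  · exact hX u hu v huv
  by_cases hv : v ∈ X
  · obtain ⟨a, ha⟩ := hX v hv u huv.symm
    exact ⟨a, ha.symm⟩
  · exact hKK u v ((hK u v).2 ⟨huv, by simp [hu], by simp [hv]⟩)

lemma card_union_le_of {A B : Finset (Fin 8)} {m n k : ℕ} (hA : A.card ≤ m) (hB : B.card ≤ n)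
    (h : m + n ≤ k) : (A ∪ B).card ≤ k :=
  (Finset.card_union_le A B).trans (by omega)

lemma card_insert_le_of {A : Finset (Fin 8)} {a : Fin 8} {n : ℕ} (hA : A.card ≤ n) :
    (insert a A).card ≤ n + 1 :=
  (Finset.card_insert_le a A).trans (by omega)

lemma not_col_of_colAt {K : V → V → Fin 8 → Prop} {u : V} (h : colAt K u = ∅) (v : V)
    (b : Fin 8) : ¬ Col K v u b := fun hb =>
  Finset.notMem_empty b (h ▸ mem_colAt.2 ⟨v, hb.symm⟩)

lemma inAt_of_colAt {K : V → V → Fin 8 → Prop} {u : V} (h : colAt K u = ∅) : inAt K u = ∅ := by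
  have := inAt_subset_colAt K u
  rwa [h, Finset.subset_empty] at this

/-- The five edges get distinct colors, designated at `u` or `v`. For an edge at `c₁`, the given
coloring forbids `a₂` and the at most three colors at `p₁`, which include `a₁`; similarly at `c₂`.
The edges at `c₁` and `c₂` thus face 4 + 0, 4 + 1, 4 + 2, 4 + 3 forbidden colors, and `uv` faces 2 +
4. -/
lemma diamond_finish (hG : ∀ v, G.degree v ≤ 3)
    {u v c₁ c₂ p₁ p₂ : V} (hc₁₂ : c₁ ≠ c₂)
    (hu : ∀ x, G.Adj u x ↔ x = v ∨ x = c₁ ∨ x = c₂)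
    (hv : ∀ x, G.Adj v x ↔ x = u ∨ x = c₁ ∨ x = c₂)
    (hc₁ : ∀ x, G.Adj c₁ x ↔ x = u ∨ x = v ∨ x = p₁)
    (hc₂ : ∀ x, G.Adj c₂ x ↔ x = u ∨ x = v ∨ x = p₂)
    {K : V → V → Fin 8 → Prop} (hK : Ok G K) {a₁ a₂ : Fin 8} (ru : colAt K u = ∅)
    (rv : colAt K v = ∅) (r₁ : colAt K c₁ = {a₁}) (r₂ : colAt K c₂ = {a₂})
    (j₁ : a₁ ∈ colAt K p₁) (j₂ : a₂ ∈ colAt K p₂) (s₁ : inAt K c₁ = ∅) (s₂ : inAt K c₂ = ∅) :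
    ∃ K' U, Ext G K K' U {s(u, v), s(c₂, v), s(c₂, u), s(c₁, v), s(c₁, u)} := by
  have q₁ : (colAt K p₁).card ≤ 3 := (colAt_card_le_degree hK p₁).trans (hG p₁)
  have q₂ : (colAt K p₂).card ≤ 3 := (colAt_card_le_degree hK p₂).trans (hG p₂)
  have i₁ := inAt_subset_colAt K p₁
  have i₂ := inAt_subset_colAt K p₂
  have su := inAt_of_colAt ru
  have sv := inAt_of_colAt rv
  have ncu := not_col_of_colAt ru
  have ncv := not_col_of_colAt rv
  have auv : G.Adj u v := (hu v).2 (by simp)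
  have au1 : G.Adj c₁ u := (hc₁ u).2 (by simp)
  have au2 : G.Adj c₂ u := (hc₂ u).2 (by simp)
  have av1 : G.Adj c₁ v := (hc₁ v).2 (by simp)
  have av2 : G.Adj c₂ v := (hc₂ v).2 (by simp)
  have e1 := au1.ne
  have e2 := au2.ne
  have e3 := av1.ne
  have e4 := av2.ne
  have e5 := auv.ne
  obtain ⟨K₁, b₁, h₁⟩ := (Ext.refl hK).greedy au1 (ncu _) (by simp) ({a₂} ∪ colAt K p₁)
    (forbidden_subset (u₁ := v) (u₂ := p₁) (v₁ := v) (v₂ := c₂) (fun x => (hc₁ x).1)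
      (fun x h => by have := (hu x).1 h; tauto) (by simp [rv])
      (by simp [r₂]) (by simp [r₁, j₁]) (by simp [sv]) (i₁.trans Finset.subset_union_right))
    (card_union_le_of (card_union_le_of (Finset.card_singleton _).le q₁ le_rfl)
      (Finset.card_empty).le (by norm_num))
  obtain ⟨K₂, b₂, h₂⟩ := h₁.greedy av1 (ncv _) (by simp [e5.symm, e3.symm])
    ({a₂} ∪ colAt K p₁)
    (forbidden_subset (u₁ := u) (u₂ := p₁) (v₁ := u) (v₂ := c₂)
      (fun x h => by have := (hc₁ x).1 h; tauto)
      (fun x h => by have := (hv x).1 h; tauto) (by simp [ru])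
      (by simp [r₂]) (by simp [r₁, j₁]) (by simp [su]) (i₁.trans Finset.subset_union_right))
    (card_union_le_of (card_union_le_of (Finset.card_singleton _).le q₁ le_rfl)
      (card_insert_le_of Finset.card_empty.le) (by norm_num))
  obtain ⟨K₃, b₃, h₃⟩ := h₂.greedy au2 (ncu _)
    (by simp [hc₁₂.symm, e1.symm, e5, e4, e2]) ({a₁} ∪ colAt K p₂)
    (forbidden_subset (u₁ := v) (u₂ := p₂) (v₁ := v) (v₂ := c₁)
      (fun x h => by have := (hc₂ x).1 h; tauto)
      (fun x h => by have := (hu x).1 h; tauto) (by simp [rv])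
      (by simp [r₁]) (by simp [r₂, j₂]) (by simp [sv]) (i₂.trans Finset.subset_union_right))
    (card_union_le_of (card_union_le_of (Finset.card_singleton _).le q₂ le_rfl)
      (card_insert_le_of (card_insert_le_of Finset.card_empty.le)) (by norm_num))
  obtain ⟨K₄, b₄, h₄⟩ := h₃.greedy av2 (ncv _)
    (by simp [hc₁₂.symm, e5.symm, e3.symm, e4, e2]) ({a₁} ∪ colAt K p₂)
    (forbidden_subset (u₁ := u) (u₂ := p₂) (v₁ := u) (v₂ := c₁)
      (fun x h => by have := (hc₂ x).1 h; tauto)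
      (fun x h => by have := (hv x).1 h; tauto) (by simp [ru])
      (by simp [r₁]) (by simp [r₂, j₂]) (by simp [su]) (i₂.trans Finset.subset_union_right))
    (card_union_le_of (card_union_le_of (Finset.card_singleton _).le q₂ le_rfl)
      (card_insert_le_of (card_insert_le_of (card_insert_le_of Finset.card_empty.le)))
      (by norm_num))
  obtain ⟨K₅, b₅, h₅⟩ := h₄.greedy auv (ncv _)
    (by simp [e1.symm, e2.symm, e3.symm, e4.symm]) ({a₁} ∪ {a₂})
    (forbidden_subset (u₁ := c₁) (u₂ := c₂) (v₁ := c₁) (v₂ := c₂)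
      (fun x h => (hu x).1 h) (fun x h => (hv x).1 h) (by simp [r₁])
      (by simp [r₂]) (by simp [ru]) (by simp [s₁]) (by simp [s₂]))
    (card_union_le_of (card_union_le_of (Finset.card_singleton _).le (Finset.card_singleton _).le
      le_rfl) (card_insert_le_of (card_insert_le_of (card_insert_le_of (card_insert_le_of
        Finset.card_empty.le)))) (by norm_num))
  exact ⟨K₅, _, by simpa using h₅⟩

lemma Cov.of_mem {K : V → V → Fin 8 → Prop} {X : Finset V} (h : Cov G K (Finset.univ \ X)) {w : V}
    (hw : w ∈ X) : colAt K w = ∅ :=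
  h.colAt_eq_empty (by simp only [Finset.mem_sdiff, not_and, not_not]; exact fun _ => hw)

/-- The case of a diamond `u, v, c₁, c₂` with `c₁` and `c₂` not adjacent. -/
lemma exists_full_of_diamond (hG : ∀ v, G.degree v ≤ 3) (hc : ConnOn G Finset.univ)
    {u v c₁ c₂ p₁ p₂ : V} (hc₁₂ : c₁ ≠ c₂)
    (hu : ∀ x, G.Adj u x ↔ x = v ∨ x = c₁ ∨ x = c₂)
    (hv : ∀ x, G.Adj v x ↔ x = u ∨ x = c₁ ∨ x = c₂)
    (hc₁ : ∀ x, G.Adj c₁ x ↔ x = u ∨ x = v ∨ x = p₁)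
    (hc₂ : ∀ x, G.Adj c₂ x ↔ x = u ∨ x = v ∨ x = p₂)
    (hp₁ : p₁ ∉ ({u, v, c₁, c₂} : Finset V)) (hp₂ : p₂ ∉ ({u, v, c₁, c₂} : Finset V)) :
    ∃ K, Ok G K ∧ Full G K := by
  obtain ⟨K₀, hK₀⟩ := (light_sdiff hG hc (X := {u, v, c₁, c₂}) ⟨u, by simp⟩).exists_good hG
  have hzu := hK₀.cov.of_mem (w := u) (by simp)
  have hzv := hK₀.cov.of_mem (w := v) (by simp)
  have hz₁ := hK₀.cov.of_mem (w := c₁) (by simp)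
  have hz₂ := hK₀.cov.of_mem (w := c₂) (by simp)
  have iu := inAt_of_colAt hzu
  have iv := inAt_of_colAt hzv
  have i₁ := inAt_of_colAt hz₁
  have i₂ := inAt_of_colAt hz₂
  have e1 : c₁ ≠ u := ((hc₁ u).2 (by simp)).ne
  have e2 : c₂ ≠ u := ((hc₂ u).2 (by simp)).ne
  have e3 : c₁ ≠ v := ((hc₁ v).2 (by simp)).ne
  have e4 : c₂ ≠ v := ((hc₂ v).2 (by simp)).ne
  simp only [Finset.mem_insert, Finset.mem_singleton, not_or] at hp₁ hp₂
  obtain ⟨n1, n2, n3, n4⟩ := hp₁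
  obtain ⟨n5, n6, n7, n8⟩ := hp₂
  have f1 := Ne.symm n1
  have f2 := Ne.symm n2
  have f3 := Ne.symm n3
  have f4 := Ne.symm n4
  have f5 := Ne.symm n5
  have f6 := Ne.symm n6
  have f7 := Ne.symm n7
  have f8 := Ne.symm n8
  -- The extra color to avoid, here `0`, is immaterial.
  obtain ⟨a₁, -, -, h₁⟩ := hK₀.ok.exists_pendant hG ((hc₁ p₁).2 (by simp))
    (fun x hx => by have := (hc₁ x).1 hx; tauto) hz₁ iu iv 0
  obtain ⟨a₂, -, -, h₂⟩ := h₁.exists_pendant hG (u₁ := u) (u₂ := v) ((hc₂ p₂).2 (by simp))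
    (fun x hx => by have := (hc₂ x).1 hx; tauto)
    (by rw [colAt_addArc_of_ne hc₁₂.symm f4, hz₂]) (by rw [inAt_addArc_of_ne f1, iu])
    (by rw [inAt_addArc_of_ne f2, iv]) 0
  obtain ⟨K', U, hE⟩ := diamond_finish hG (a₁ := a₁) (a₂ := a₂) hc₁₂ hu hv hc₁ hc₂ h₂
    (by rw [colAt_addArc_of_ne e2.symm f5, colAt_addArc_of_ne e1.symm f1, hzu])
    (by rw [colAt_addArc_of_ne e4.symm f6, colAt_addArc_of_ne e3.symm f2, hzv])
    (by rw [colAt_addArc_of_ne hc₁₂ f7, colAt_addArc_left, hz₁]; rfl)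
    (by rw [colAt_addArc_left, colAt_addArc_of_ne hc₁₂.symm f4, hz₂]; rfl)
    (mem_colAt.2 ⟨c₁, by simp [col_addArc]⟩) (mem_colAt.2 ⟨c₂, by simp [col_addArc]⟩)
    (by rw [inAt_addArc_of_ne f7, inAt_addArc_of_ne f3, i₁])
    (by rw [inAt_addArc_of_ne f8, inAt_addArc_of_ne f4, i₂])
  refine ⟨K', hE.ok, full_of_cov hK₀.cov (fun x y h => ?_) fun w hw x hwx => ?_⟩
  · rw [hE.edge, exists_col_addArc, exists_col_addArc]
    exact Or.inl (Or.inl (Or.inl h))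
  · rw [hE.edge, exists_col_addArc, exists_col_addArc]
    simp only [Finset.mem_insert, Finset.mem_singleton] at hw
    rcases hw with rfl | rfl | rfl | rfl
    · rcases (hu x).1 hwx with rfl | rfl | rfl <;> simp
    · rcases (hv x).1 hwx with rfl | rfl | rfl <;> simp
    · rcases (hc₁ x).1 hwx with rfl | rfl | rfl <;> simp
    · rcases (hc₂ x).1 hwx with rfl | rfl | rfl <;> simp

/-- The case of a complete graph on four vertices. -/
lemma exists_full_of_complete (hG : ∀ v, G.degree v ≤ 3) (hc : ConnOn G Finset.univ)
    {u v c₁ c₂ : V}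
    (hu : ∀ x, G.Adj u x ↔ x = v ∨ x = c₁ ∨ x = c₂)
    (hv : ∀ x, G.Adj v x ↔ x = u ∨ x = c₁ ∨ x = c₂)
    (hc₁ : ∀ x, G.Adj c₁ x ↔ x = u ∨ x = v ∨ x = c₂)
    (hc₂ : ∀ x, G.Adj c₂ x ↔ x = u ∨ x = v ∨ x = c₁) :
    ∃ K, Ok G K ∧ Full G K := by
  obtain ⟨K₀, hK₀⟩ := (light_sdiff hG hc (X := {u, v, c₁, c₂}) ⟨u, by simp⟩).exists_good hG
  have hzu := hK₀.cov.of_mem (w := u) (by simp)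
  have hzv := hK₀.cov.of_mem (w := v) (by simp)
  have hz₁ := hK₀.cov.of_mem (w := c₁) (by simp)
  have hz₂ := hK₀.cov.of_mem (w := c₂) (by simp)
  have iu := inAt_of_colAt hzu
  have iv := inAt_of_colAt hzv
  have i₁ := inAt_of_colAt hz₁
  have i₂ := inAt_of_colAt hz₂
  have a1 : G.Adj u v := (hu v).2 (by simp)
  have a2 : G.Adj u c₁ := (hu c₁).2 (by simp)
  have a3 : G.Adj u c₂ := (hu c₂).2 (by simp)
  have a4 : G.Adj v c₁ := (hv c₁).2 (by simp)
  have a5 : G.Adj v c₂ := (hv c₂).2 (by simp)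
  have a6 : G.Adj c₁ c₂ := (hc₁ c₂).2 (by simp)
  have e1 := a1.ne
  have e2 := a2.ne
  have e3 := a3.ne
  have e4 := a4.ne
  have e5 := a5.ne
  have e6 := a6.ne
  -- No vertex of the piece meets a colored edge, so six distinct colors do.
  obtain ⟨K₁, b₁, h₁⟩ := (Ext.refl hK₀.ok).greedy a1 (not_col_of_colAt hzv u) (by simp) ∅
    (forbidden_subset (fun x => (hu x).1) (fun x => (hv x).1) (by simp [hz₁]) (by simp [hz₂])
      (by simp [hzu]) (by simp [i₁]) (by simp [i₂])) (by simp)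
  obtain ⟨K₂, b₂, h₂⟩ := h₁.greedy a2 (not_col_of_colAt hz₁ u) (by simp [e1, e4.symm]) ∅
    (forbidden_subset (u₁ := v) (u₂ := c₂) (fun x h => by have := (hu x).1 h; tauto)
      (fun x => (hc₁ x).1)
      (by simp [hzv]) (by simp [hz₂])
      (by simp [hzu]) (by simp [iv]) (by simp [i₂])) (by
        rw [Finset.empty_union]
        exact (card_insert_le_of Finset.card_empty.le).trans (by norm_num))
  obtain ⟨K₃, b₃, h₃⟩ := h₂.greedy a3 (not_col_of_colAt hz₂ u)
    (by simp [e1, e5.symm, e6.symm, e2]) ∅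
    (forbidden_subset (u₁ := v) (u₂ := c₁)
      (fun x h => by have := (hu x).1 h; tauto) (fun x => (hc₂ x).1)
      (by simp [hzv]) (by simp [hz₁])
      (by simp [hzu]) (by simp [iv]) (by simp [i₁])) (by
        rw [Finset.empty_union]
        exact (card_insert_le_of (card_insert_le_of Finset.card_empty.le)).trans (by norm_num))
  obtain ⟨K₄, b₄, h₄⟩ := h₃.greedy a4 (not_col_of_colAt hz₁ v)
    (by simp [e1.symm, e2.symm, e4, e5]) ∅
    (forbidden_subset (u₁ := u) (u₂ := c₂) (v₁ := u) (v₂ := c₂)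
      (fun x h => by have := (hv x).1 h; tauto) (fun x h => by have := (hc₁ x).1 h; tauto)
      (by simp [hzu]) (by simp [hz₂])
      (by simp [hzv]) (by simp [iu]) (by simp [i₂])) (by
        rw [Finset.empty_union]
        exact (card_insert_le_of (card_insert_le_of (card_insert_le_of
          Finset.card_empty.le))).trans (by norm_num))
  obtain ⟨K₅, b₅, h₅⟩ := h₄.greedy a5 (not_col_of_colAt hz₂ v)
    (by simp [e1.symm, e3.symm, e4, e5, e6.symm]) ∅
    (forbidden_subset (u₁ := u) (u₂ := c₁) (v₁ := u) (v₂ := c₁)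
      (fun x h => by have := (hv x).1 h; tauto) (fun x h => by have := (hc₂ x).1 h; tauto)
      (by simp [hzu]) (by simp [hz₁])
      (by simp [hzv]) (by simp [iu]) (by simp [i₁])) (by
        rw [Finset.empty_union]
        exact (card_insert_le_of (card_insert_le_of (card_insert_le_of (card_insert_le_of
          Finset.card_empty.le)))).trans (by norm_num))
  obtain ⟨K₆, b₆, h₆⟩ := h₅.greedy a6 (not_col_of_colAt hz₂ c₁)
    (by simp [e2.symm, e3.symm, e4.symm, e5.symm, e6]) ∅
    (forbidden_subset (u₁ := u) (u₂ := v) (v₁ := u) (v₂ := v)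
      (fun x h => by have := (hc₁ x).1 h; tauto) (fun x h => by have := (hc₂ x).1 h; tauto)
      (by simp [hzu]) (by simp [hzv])
      (by simp [hz₁]) (by simp [iu]) (by simp [iv])) (by
        rw [Finset.empty_union]
        exact (card_insert_le_of (card_insert_le_of (card_insert_le_of (card_insert_le_of
          (card_insert_le_of Finset.card_empty.le))))).trans (by norm_num))
  refine ⟨K₆, h₆.ok, full_of_cov hK₀.cov (fun x y h => ?_) fun w hw x hwx => ?_⟩
  · rw [h₆.edge]
    exact Or.inl h
  · rw [h₆.edge]
    simp only [Finset.mem_insert, Finset.mem_singleton] at hw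
    rcases hw with rfl | rfl | rfl | rfl
    · rcases (hu x).1 hwx with rfl | rfl | rfl <;> simp
    · rcases (hv x).1 hwx with rfl | rfl | rfl <;> simp
    · rcases (hc₁ x).1 hwx with rfl | rfl | rfl <;> simp
    · rcases (hc₂ x).1 hwx with rfl | rfl | rfl <;> simp

lemma CycleComponent.two_lt_card {S T : Finset V} (h : CycleComponent G S T) : 2 < T.card := by
  obtain ⟨w, hw⟩ := h.conn.1
  have h1 := h.deg w hw
  have h2 : insert w (G.neighborFinset w ∩ S) ⊆ T := by
    intro x hx
    rcases Finset.mem_insert.1 hx with rfl | hx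
    · exact hw
    · rw [Finset.mem_inter, G.mem_neighborFinset] at hx
      exact h.closed w hw x hx.2 hx.1
  have h3 := Finset.card_le_card h2
  rw [Finset.card_insert_of_notMem (by simp)] at h3
  unfold degOn at h1
  omega

lemma CycleComponent.exists_adj {X T : Finset V} (hd : ∀ v, G.degree v = 3)
    (h : CycleComponent G (Finset.univ \ X) T) {w : V} (hw : w ∈ T) : ∃ x ∈ X, G.Adj w x := by
  by_contra! hcon
  have h1 := h.deg w hw
  have h2 : G.neighborFinset w ∩ (Finset.univ \ X) = G.neighborFinset w := by
    rw [Finset.inter_eq_left]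
    intro x hx
    rw [G.mem_neighborFinset] at hx
    simp only [Finset.mem_sdiff, Finset.mem_univ, true_and]
    exact fun h' => hcon x h' hx
  unfold degOn at h1
  rw [h2, G.card_neighborFinset_eq_degree, hd] at h1
  omega

/-- The case of a triangle that is not part of a diamond. -/
lemma exists_full_of_triangle (hd : ∀ v, G.degree v = 3) (hc : ConnOn G Finset.univ)
    {r y₁ y₂ d₀ d₁ d₂ : V} (hr : ∀ x, G.Adj r x ↔ x = y₁ ∨ x = y₂ ∨ x = d₀)
    (hy₁ : ∀ x, G.Adj y₁ x ↔ x = r ∨ x = y₂ ∨ x = d₁)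
    (hy₂ : ∀ x, G.Adj y₂ x ↔ x = r ∨ x = y₁ ∨ x = d₂) (h01 : d₀ ≠ d₁) (h02 : d₀ ≠ d₂)
    (h12 : d₁ ≠ d₂) (hd₀ : d₀ ∉ ({r, y₁, y₂} : Finset V)) (hd₁ : d₁ ∉ ({r, y₁, y₂} : Finset V))
    (hd₂ : d₂ ∉ ({r, y₁, y₂} : Finset V)) : ∃ K, Ok G K ∧ Full G K := by
  have hG : ∀ v, G.degree v ≤ 3 := fun v => (hd v).le
  have a0 : G.Adj r d₀ := (hr d₀).2 (by simp)
  have a1 : G.Adj r y₁ := (hr y₁).2 (by simp)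
  have a2 : G.Adj r y₂ := (hr y₂).2 (by simp)
  have a3 : G.Adj y₁ y₂ := (hy₁ y₂).2 (by simp)
  have a4 : G.Adj y₁ d₁ := (hy₁ d₁).2 (by simp)
  have a5 : G.Adj y₂ d₂ := (hy₂ d₂).2 (by simp)
  have hdS : d₀ ∈ Finset.univ \ ({r, y₁, y₂} : Finset V) := by
    rw [Finset.mem_sdiff]; exact ⟨Finset.mem_univ _, hd₀⟩
  -- The vertex `d₀` must be free because designations there restrict the edges from `r` to `y₁` and
  -- `y₂`. The vertex `d₂` may be exempt because all colors at it are counted below anyway.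
  obtain ⟨K₀, hok₀, hcov₀, hI, -⟩ := (light_sdiff hG hc (X := {r, y₁, y₂})
    ⟨r, by simp⟩).exists_root_exempt hG (r := d₀) (s := d₂) hdS (by
      have h1 : G.neighborFinset d₀ ∩ (Finset.univ \ {r, y₁, y₂}) ⊆ (G.neighborFinset d₀).erase r := by
        intro x hx
        simp only [Finset.mem_inter, Finset.mem_sdiff, Finset.mem_insert, not_or] at hx
        rw [Finset.mem_erase]
        exact ⟨hx.2.2.1, hx.1⟩
      have h2 := Finset.card_le_card h1
      rw [Finset.card_erase_of_mem (by simpa using a0.symm), G.card_neighborFinset_eq_degree, hd]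
        at h2
      exact h2) h02 (by
      intro T _ hT
      -- A vertex of a cycle component has a neighbor in the triangle, so it is some `dᵢ`; as a
      -- cycle has at least three vertices, `d₂` is among them.
      have h1 : T ⊆ {d₀, d₁, d₂} := by
        intro w hw
        obtain ⟨x, hx, hwx⟩ := hT.exists_adj hd hw
        have hwS := hT.sub hw
        simp only [Finset.mem_sdiff, Finset.mem_univ, true_and, Finset.mem_insert,
          Finset.mem_singleton, not_or] at hwS hx ⊢
        rcases hx with rfl | rfl | rfl
        · have := (hr w).1 hwx.symm; tauto
        · have := (hy₁ w).1 hwx.symm; tauto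
        · have := (hy₂ w).1 hwx.symm; tauto
      have h2 := hT.two_lt_card
      have h3 : ({d₀, d₁, d₂} : Finset V).card ≤ 3 := Finset.card_le_three
      rw [Finset.eq_of_subset_of_card_le h1 (by omega)]
      simp)
  have zr := hcov₀.of_mem (w := r) (by simp)
  have z1 := hcov₀.of_mem (w := y₁) (by simp)
  have z2 := hcov₀.of_mem (w := y₂) (by simp)
  have ir := inAt_of_colAt zr
  have i1 := inAt_of_colAt z1
  have i2 := inAt_of_colAt z2
  simp only [Finset.mem_insert, Finset.mem_singleton, not_or, ← Ne.eq_def] at hd₀ hd₁ hd₂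
  have e1 := a1.ne
  have e2 := a2.ne
  have e3 := a3.ne
  obtain ⟨p₁, -, -, h₁⟩ := hok₀.exists_pendant hG (u₁ := r) (u₂ := y₂) a4
    (fun x hx => by have := (hy₁ x).1 hx; tauto) z1 ir i2 0
  obtain ⟨p₂, -, -, h₂⟩ := h₁.exists_pendant hG (u₁ := r) (u₂ := y₁) a5
    (fun x hx => by have := (hy₂ x).1 hx; tauto)
    (by rw [colAt_addArc_of_ne e3.symm hd₁.2.2.symm, z2])
    (by rw [inAt_addArc_of_ne hd₁.1.symm, ir])
    (by rw [inAt_addArc_of_ne hd₁.2.1.symm, i1]) 0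
  have kr : colAt (addArc (addArc K₀ y₁ d₁ p₁) y₂ d₂ p₂) r = ∅ := by
    rw [colAt_addArc_of_ne e2 hd₂.1.symm, colAt_addArc_of_ne e1 hd₁.1.symm, zr]
  have k1 : colAt (addArc (addArc K₀ y₁ d₁ p₁) y₂ d₂ p₂) y₁ = {p₁} := by
    rw [colAt_addArc_of_ne e3 hd₂.2.1.symm, colAt_addArc_left, z1]; rfl
  have k2 : colAt (addArc (addArc K₀ y₁ d₁ p₁) y₂ d₂ p₂) y₂ = {p₂} := by
    rw [colAt_addArc_left, colAt_addArc_of_ne e3.symm hd₁.2.2.symm, z2]; rfl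
  have l1 : inAt (addArc (addArc K₀ y₁ d₁ p₁) y₂ d₂ p₂) y₁ = ∅ := by
    rw [inAt_addArc_of_ne hd₂.2.1.symm, inAt_addArc_of_ne hd₁.2.1.symm, i1]
  have l2 : inAt (addArc (addArc K₀ y₁ d₁ p₁) y₂ d₂ p₂) y₂ = ∅ := by
    rw [inAt_addArc_of_ne hd₂.2.2.symm, inAt_addArc_of_ne hd₁.2.2.symm, i2]
  have l0 : inAt (addArc (addArc K₀ y₁ d₁ p₁) y₂ d₂ p₂) d₀ = ∅ := by
    rw [inAt_addArc_of_ne h02, inAt_addArc_of_ne h01, hI]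
  have j1 : p₁ ∈ colAt (addArc (addArc K₀ y₁ d₁ p₁) y₂ d₂ p₂) d₁ :=
    mem_colAt.2 ⟨y₁, by simp [col_addArc]⟩
  have j2 : p₂ ∈ colAt (addArc (addArc K₀ y₁ d₁ p₁) y₂ d₂ p₂) d₂ :=
    mem_colAt.2 ⟨y₂, by simp [col_addArc]⟩
  have hedge : ∀ x y, (∃ a, Col (addArc (addArc K₀ y₁ d₁ p₁) y₂ d₂ p₂) x y a) ↔
      ((∃ b, Col K₀ x y b) ∨ (x = y₁ ∧ y = d₁) ∨ (x = d₁ ∧ y = y₁)) ∨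
      (x = y₂ ∧ y = d₂) ∨ (x = d₂ ∧ y = y₂) := fun x y => by
    rw [exists_col_addArc, exists_col_addArc]
  have n12 : ∀ b, ¬ Col (addArc (addArc K₀ y₁ d₁ p₁) y₂ d₂ p₂) y₁ y₂ b := fun b hb => by
    have := (hedge y₁ y₂).1 ⟨b, hb⟩
    simp only [not_col_of_colAt z2, hd₁.2.2.symm, hd₂.2.1.symm, e3, and_false, false_and,
      or_false, exists_false] at this
    simp [hd₁.2.1.symm] at this
  generalize addArc (addArc K₀ y₁ d₁ p₁) y₂ d₂ p₂ = K at *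
  have q1 : (colAt K d₁).card ≤ 3 := (colAt_card_le_degree h₂ d₁).trans (hG d₁)
  have q2 : (colAt K d₂).card ≤ 3 := (colAt_card_le_degree h₂ d₂).trans (hG d₂)
  have lr := inAt_of_colAt kr
  -- The four remaining edges face 6, 6 + 1, 4 + 2 and 4 + 3 forbidden colors.
  obtain ⟨K₁, b₁, g₁⟩ := (Ext.refl h₂).greedy a3 n12 (by simp) (colAt K d₁ ∪ colAt K d₂)
    (forbidden_subset (u₁ := r) (u₂ := d₁) (v₁ := r) (v₂ := d₂)
      (fun x h => by have := (hy₁ x).1 h; tauto) (fun x h => by have := (hy₂ x).1 h; tauto)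
      (by simp [kr]) Finset.subset_union_right (by simp [k1, j1]) (by simp [lr])
      ((inAt_subset_colAt _ _).trans Finset.subset_union_left))
    (card_union_le_of (card_union_le_of q1 q2 le_rfl) Finset.card_empty.le (by norm_num))
  obtain ⟨K₂, b₂, g₂⟩ := g₁.greedy a0 (fun b hb => not_col_of_colAt kr d₀ b hb.symm)
    (by simp [e1, e2]) (near G K r d₀) (by
      have : back G K r d₀ = ∅ := by
        have := back_subset_union (K := K) (u := r) (v := d₀) (b := y₁) (c := y₂)
          (fun x h => by have := (hr x).1 h; tauto)
        simpa [l1, l2] using this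
      simp [kr, this])
    (card_union_le_of (near_card_le hG h₂ a0) (card_insert_le_of Finset.card_empty.le) le_rfl)
  obtain ⟨K₃, b₃, g₃⟩ := g₂.greedy a1 (fun b hb => not_col_of_colAt kr y₁ b hb.symm)
    (by simp [e1, e2, e1.symm, hd₀.2.1.symm]) ({p₂} ∪ colAt K d₁)
    (forbidden_subset (u₁ := y₂) (u₂ := d₀) (v₁ := y₂) (v₂ := d₁)
      (fun x h => by have := (hr x).1 h; tauto) (fun x h => by have := (hy₁ x).1 h; tauto)
      (by simp [k2]) Finset.subset_union_right (by simp [kr]) (by simp [l2])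
      (by simp [l0]))
    (card_union_le_of (card_union_le_of (Finset.card_singleton _).le q1 le_rfl)
      (card_insert_le_of (card_insert_le_of Finset.card_empty.le)) (by norm_num))
  obtain ⟨K₄, b₄, g₄⟩ := g₃.greedy a2 (fun b hb => not_col_of_colAt kr y₂ b hb.symm)
    (by simp [e1, e2, e2.symm, e3.symm, hd₀.2.2.symm]) ({p₁} ∪ colAt K d₂)
    (forbidden_subset (u₁ := y₁) (u₂ := d₀) (v₁ := y₁) (v₂ := d₂)
      (fun x h => by have := (hr x).1 h; tauto) (fun x h => by have := (hy₂ x).1 h; tauto)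
      (by simp [k1]) Finset.subset_union_right (by simp [kr]) (by simp [l1])
      (by simp [l0]))
    (card_union_le_of (card_union_le_of (Finset.card_singleton _).le q2 le_rfl)
      (card_insert_le_of (card_insert_le_of (card_insert_le_of Finset.card_empty.le)))
      (by norm_num))
  refine ⟨K₄, g₄.ok, full_of_cov hcov₀ (fun x y h => ?_) fun w hw x hwx => ?_⟩
  · rw [g₄.edge, hedge]
    exact Or.inl (Or.inl (Or.inl h))
  · rw [g₄.edge, hedge]
    simp only [Finset.mem_insert, Finset.mem_singleton] at hw
    rcases hw with rfl | rfl | rfl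
    · rcases (hr x).1 hwx with rfl | rfl | rfl <;> simp
    · rcases (hy₁ x).1 hwx with rfl | rfl | rfl <;> simp
    · rcases (hy₂ x).1 hwx with rfl | rfl | rfl <;> simp

end Small

end SemistrongColoring

namespace SemistrongColoring

/-! ### Two vertices with three common neighbors -/

section CompleteBipartite

set_option linter.unusedSectionVars false

variable {V : Type*} [Fintype V] [DecidableEq V] {G : SimpleGraph V} [DecidableRel G.Adj]

/-- Each edge is designated at its end `cᵢ`, and the given coloring forbids only the at most three
colors at `pᵢ`. With six distinct colors the last edge would face 3 + 5. Giving `x c₃` a color `g`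
already present at `p₁` saves one for the edges at `c₁`, which come last and face 3 + 3 and 3 + 4.
-/
lemma bipartite_finish (hG : ∀ v, G.degree v ≤ 3) {x x' c₁ c₂ c₃ p₁ p₂ p₃ : V} (h12 : c₁ ≠ c₂)
    (h13 : c₁ ≠ c₃) (h23 : c₂ ≠ c₃) (hxx : x ≠ x')
    (hx : ∀ w, G.Adj x w ↔ w = c₁ ∨ w = c₂ ∨ w = c₃)
    (hx' : ∀ w, G.Adj x' w ↔ w = c₁ ∨ w = c₂ ∨ w = c₃)
    (hc₁ : ∀ w, G.Adj c₁ w ↔ w = x ∨ w = x' ∨ w = p₁)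
    (hc₂ : ∀ w, G.Adj c₂ w ↔ w = x ∨ w = x' ∨ w = p₂)
    (hc₃ : ∀ w, G.Adj c₃ w ↔ w = x ∨ w = x' ∨ w = p₃)
    {K : V → V → Fin 8 → Prop} (hK : Ok G K) (r : colAt K x = ∅) (r' : colAt K x' = ∅)
    (s₁ : inAt K c₁ = ∅) (s₂ : inAt K c₂ = ∅) (s₃ : inAt K c₃ = ∅) {g : Fin 8}
    (hg : g ∈ colAt K p₁) (hg' : g ∉ colAt K p₃) :
    ∃ K' U, Ext G K K' U {s(x', c₁), s(x, c₁), s(x', c₂), s(x, c₂), s(x', c₃), s(x, c₃)} := by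
  have q₁ : (colAt K p₁).card ≤ 3 := (colAt_card_le_degree hK p₁).trans (hG p₁)
  have q₂ : (colAt K p₂).card ≤ 3 := (colAt_card_le_degree hK p₂).trans (hG p₂)
  have q₃ : (colAt K p₃).card ≤ 3 := (colAt_card_le_degree hK p₃).trans (hG p₃)
  have a1 : G.Adj x c₁ := (hx c₁).2 (by simp)
  have a2 : G.Adj x c₂ := (hx c₂).2 (by simp)
  have a3 : G.Adj x c₃ := (hx c₃).2 (by simp)
  have b1 : G.Adj x' c₁ := (hx' c₁).2 (by simp)
  have b2 : G.Adj x' c₂ := (hx' c₂).2 (by simp)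
  have b3 : G.Adj x' c₃ := (hx' c₃).2 (by simp)
  have n := fun c b (hb : Col K x c b) => not_col_of_colAt r c b hb.symm
  have n' := fun c b (hb : Col K x' c b) => not_col_of_colAt r' c b hb.symm
  have F₁ : near G K x c₁ ∪ colAt K x ∪ back G K x c₁ ⊆ colAt K p₁ :=
    forbidden_subset (fun w => (hx w).1) (fun w => (hc₁ w).1) (by simp [r']) subset_rfl
      (by simp [r]) (by simp [s₂]) (by simp [s₃])
  have F₂ : near G K x c₂ ∪ colAt K x ∪ back G K x c₂ ⊆ colAt K p₂ :=
    forbidden_subset (u₁ := c₁) (u₂ := c₃) (fun w h => by have := (hx w).1 h; tauto)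
      (fun w => (hc₂ w).1) (by simp [r']) subset_rfl
      (by simp [r]) (by simp [s₁]) (by simp [s₃])
  have F₃ : near G K x c₃ ∪ colAt K x ∪ back G K x c₃ ⊆ colAt K p₃ :=
    forbidden_subset (u₁ := c₁) (u₂ := c₂) (fun w h => by have := (hx w).1 h; tauto)
      (fun w => (hc₃ w).1) (by simp [r']) subset_rfl
      (by simp [r]) (by simp [s₁]) (by simp [s₂])
  have F₁' : near G K x' c₁ ∪ colAt K x' ∪ back G K x' c₁ ⊆ colAt K p₁ :=
    forbidden_subset (v₁ := x) (v₂ := p₁) (fun w => (hx' w).1)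
      (fun w h => by have := (hc₁ w).1 h; tauto) (by simp [r]) subset_rfl
      (by simp [r']) (by simp [s₂]) (by simp [s₃])
  have F₂' : near G K x' c₂ ∪ colAt K x' ∪ back G K x' c₂ ⊆ colAt K p₂ :=
    forbidden_subset (u₁ := c₁) (u₂ := c₃) (v₁ := x) (v₂ := p₂)
      (fun w h => by have := (hx' w).1 h; tauto)
      (fun w h => by have := (hc₂ w).1 h; tauto) (by simp [r]) subset_rfl
      (by simp [r']) (by simp [s₁]) (by simp [s₃])
  have F₃' : near G K x' c₃ ∪ colAt K x' ∪ back G K x' c₃ ⊆ colAt K p₃ :=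
    forbidden_subset (u₁ := c₁) (u₂ := c₂) (v₁ := x) (v₂ := p₃)
      (fun w h => by have := (hx' w).1 h; tauto)
      (fun w h => by have := (hc₃ w).1 h; tauto) (by simp [r]) subset_rfl
      (by simp [r']) (by simp [s₁]) (by simp [s₂])
  have f1 : x ≠ c₁ := a1.ne
  have f2 : x ≠ c₂ := a2.ne
  have f3 : x ≠ c₃ := a3.ne
  have f1' : x' ≠ c₁ := b1.ne
  have f2' : x' ≠ c₂ := b2.ne
  have f3' : x' ≠ c₃ := b3.ne
  have h₁ := (Ext.refl hK).step a3 (n _) (by simp) F₃ (a := g) (by simp [hg'])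
  obtain ⟨K₂, b₂, h₂⟩ := h₁.greedy b3 (n' _) (by simp [hxx.symm, f3']) _ F₃'
    (card_union_le_of q₃ (card_insert_le_of Finset.card_empty.le) (by norm_num))
  obtain ⟨K₃, b₃, h₃⟩ := h₂.greedy a2 (n _) (by simp [hxx, h23, f3]) _ F₂
    (card_union_le_of q₂ (card_insert_le_of (card_insert_le_of Finset.card_empty.le))
      (by norm_num))
  obtain ⟨K₄, b₄, h₄⟩ := h₃.greedy b2 (n' _) (by simp [hxx.symm, h23, f3', f2']) _ F₂'
    (card_union_le_of q₂ (card_insert_le_of (card_insert_le_of (card_insert_le_of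
      Finset.card_empty.le))) (by norm_num))
  have hm : ∀ U : Finset (Fin 8), colAt K p₁ ∪ insert g U = colAt K p₁ ∪ U := by
    intro U
    rw [Finset.union_insert, Finset.insert_eq_of_mem (Finset.mem_union_left _ hg)]
  obtain ⟨K₅, b₅, h₅⟩ := h₄.greedy a1 (n _) (by simp [hxx, h12, h13, f2, f3]) _ F₁ (by
    have : colAt K p₁ ∪ insert b₄ (insert b₃ (insert b₂ (insert g ∅))) =
        colAt K p₁ ∪ {b₄, b₃, b₂} := by
      rw [← hm {b₄, b₃, b₂}]
      congr 1
      ext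
      simp
      tauto
    rw [this]
    exact card_union_le_of q₁ Finset.card_le_three (by norm_num))
  obtain ⟨K₆, b₆, h₆⟩ := h₅.greedy b1 (n' _) (by simp [hxx.symm, h12, h13, f2', f3', f1']) _ F₁' (by
    have : colAt K p₁ ∪ insert b₅ (insert b₄ (insert b₃ (insert b₂ (insert g ∅)))) =
        colAt K p₁ ∪ {b₅, b₄, b₃, b₂} := by
      rw [← hm {b₅, b₄, b₃, b₂}]
      congr 1
      ext
      simp
      tauto
    rw [this]
    exact card_union_le_of q₁ Finset.card_le_four (by norm_num))
  exact ⟨K₆, _, by simpa using h₆⟩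

/-- The case of a subgraph `K_{2,3}` with hubs `x, x'` whose attachment vertex `p₃` differs from
the other two. -/
lemma exists_full_of_bipartite (hG : ∀ v, G.degree v ≤ 3) (hc : ConnOn G Finset.univ)
    {x x' c₁ c₂ c₃ p₁ p₂ p₃ : V} (h12 : c₁ ≠ c₂)
    (h13 : c₁ ≠ c₃) (h23 : c₂ ≠ c₃) (hxx : x ≠ x')
    (hx : ∀ w, G.Adj x w ↔ w = c₁ ∨ w = c₂ ∨ w = c₃)
    (hx' : ∀ w, G.Adj x' w ↔ w = c₁ ∨ w = c₂ ∨ w = c₃)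
    (hc₁ : ∀ w, G.Adj c₁ w ↔ w = x ∨ w = x' ∨ w = p₁)
    (hc₂ : ∀ w, G.Adj c₂ w ↔ w = x ∨ w = x' ∨ w = p₂)
    (hc₃ : ∀ w, G.Adj c₃ w ↔ w = x ∨ w = x' ∨ w = p₃)
    (hp₁ : p₁ ∉ ({x, x', c₁, c₂, c₃} : Finset V)) (hp₂ : p₂ ∉ ({x, x', c₁, c₂, c₃} : Finset V))
    (hp₃ : p₃ ∉ ({x, x', c₁, c₂, c₃} : Finset V)) (h31 : p₁ ≠ p₃) :
    ∃ K, Ok G K ∧ Full G K := by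
  obtain ⟨K₀, hK₀⟩ := (light_sdiff hG hc (X := {x, x', c₁, c₂, c₃}) ⟨x, by simp⟩).exists_good hG
  have z := hK₀.cov.of_mem (w := x) (by simp)
  have z' := hK₀.cov.of_mem (w := x') (by simp)
  have z1 := hK₀.cov.of_mem (w := c₁) (by simp)
  have z2 := hK₀.cov.of_mem (w := c₂) (by simp)
  have z3 := hK₀.cov.of_mem (w := c₃) (by simp)
  have i := inAt_of_colAt z
  have i' := inAt_of_colAt z'
  have f1 : x ≠ c₁ := ((hx c₁).2 (by simp)).ne
  have f2 : x ≠ c₂ := ((hx c₂).2 (by simp)).ne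
  have f3 : x ≠ c₃ := ((hx c₃).2 (by simp)).ne
  have f1' : x' ≠ c₁ := ((hx' c₁).2 (by simp)).ne
  have f2' : x' ≠ c₂ := ((hx' c₂).2 (by simp)).ne
  have f3' : x' ≠ c₃ := ((hx' c₃).2 (by simp)).ne
  simp only [Finset.mem_insert, Finset.mem_singleton, not_or, ← Ne.eq_def] at hp₁ hp₂ hp₃
  obtain ⟨m1, m2, m3, m4, m5⟩ := hp₁
  obtain ⟨n1, n2, n3, n4, n5⟩ := hp₂
  obtain ⟨o1, o2, o3, o4, o5⟩ := hp₃
  obtain ⟨a₁, -, -, h₁⟩ := hK₀.ok.exists_pendant hG (u₁ := x) (u₂ := x') ((hc₁ p₁).2 (by simp))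
    (fun w h => by have := (hc₁ w).1 h; tauto) z1 i i' 0
  obtain ⟨a₂, -, -, h₂⟩ := h₁.exists_pendant hG (u₁ := x) (u₂ := x') ((hc₂ p₂).2 (by simp))
    (fun w h => by have := (hc₂ w).1 h; tauto)
    (by rw [colAt_addArc_of_ne h12.symm m4.symm, z2])
    (by rw [inAt_addArc_of_ne m1.symm, i]) (by rw [inAt_addArc_of_ne m2.symm, i']) 0
  have hpend := fun b => h₂.exists_pendant hG (u₁ := x) (u₂ := x') ((hc₃ p₃).2 (by simp))
    (fun w h => by have := (hc₃ w).1 h; tauto)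
    (by rw [colAt_addArc_of_ne h23.symm n5.symm, colAt_addArc_of_ne h13.symm m5.symm, z3])
    (by rw [inAt_addArc_of_ne n1.symm, inAt_addArc_of_ne m1.symm, i])
    (by rw [inAt_addArc_of_ne n2.symm, inAt_addArc_of_ne m2.symm, i']) b
  -- As `p₁ ≠ p₃`, the colors at `p₁` are already fixed. At most one color new at `p₃` would make
  -- the two sets equal, and the pendant edge can avoid it.
  obtain ⟨a₃, h₃, hne⟩ : ∃ a, Ok G (addArc (addArc (addArc K₀ c₁ p₁ a₁) c₂ p₂ a₂) c₃ p₃ a) ∧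
      colAt (addArc (addArc (addArc K₀ c₁ p₁ a₁) c₂ p₂ a₂) c₃ p₃ a) p₁ ≠
      colAt (addArc (addArc (addArc K₀ c₁ p₁ a₁) c₂ p₂ a₂) c₃ p₃ a) p₃ := by
    simp only [colAt_addArc_right, colAt_addArc_of_ne m5 h31]
    by_cases hb : ∃ b, colAt (addArc (addArc K₀ c₁ p₁ a₁) c₂ p₂ a₂) p₁ =
        insert b (colAt (addArc (addArc K₀ c₁ p₁ a₁) c₂ p₂ a₂) p₃)
    · obtain ⟨b, hb⟩ := hb
      obtain ⟨a, hab, han, ha⟩ := hpend b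
      refine ⟨a, ha, fun h => ?_⟩
      have h' : a ∈ insert b (colAt (addArc (addArc K₀ c₁ p₁ a₁) c₂ p₂ a₂) p₃) := by
        rw [← hb, h]
        exact Finset.mem_insert_self _ _
      rcases Finset.mem_insert.1 h' with h' | h'
      exacts [hab h', han h']
    · push Not at hb
      obtain ⟨a, -, -, ha⟩ := hpend 0
      exact ⟨a, ha, hb a⟩
  have hedge : ∀ u v, (∃ a, Col (addArc (addArc (addArc K₀ c₁ p₁ a₁) c₂ p₂ a₂) c₃ p₃ a₃) u v a) ↔
      (((∃ b, Col K₀ u v b) ∨ (u = c₁ ∧ v = p₁) ∨ (u = p₁ ∧ v = c₁)) ∨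
      (u = c₂ ∧ v = p₂) ∨ (u = p₂ ∧ v = c₂)) ∨ (u = c₃ ∧ v = p₃) ∨ (u = p₃ ∧ v = c₃) :=
    fun u v => by
      rw [exists_col_addArc, exists_col_addArc, exists_col_addArc]
  have k : colAt (addArc (addArc (addArc K₀ c₁ p₁ a₁) c₂ p₂ a₂) c₃ p₃ a₃) x = ∅ := by
    rw [colAt_addArc_of_ne f3 o1.symm, colAt_addArc_of_ne f2 n1.symm,
      colAt_addArc_of_ne f1 m1.symm, z]
  have k' : colAt (addArc (addArc (addArc K₀ c₁ p₁ a₁) c₂ p₂ a₂) c₃ p₃ a₃) x' = ∅ := by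
    rw [colAt_addArc_of_ne f3' o2.symm, colAt_addArc_of_ne f2' n2.symm,
      colAt_addArc_of_ne f1' m2.symm, z']
  have l1 : inAt (addArc (addArc (addArc K₀ c₁ p₁ a₁) c₂ p₂ a₂) c₃ p₃ a₃) c₁ = ∅ := by
    rw [inAt_addArc_of_ne o3.symm, inAt_addArc_of_ne n3.symm, inAt_addArc_of_ne m3.symm,
      inAt_of_colAt z1]
  have l2 : inAt (addArc (addArc (addArc K₀ c₁ p₁ a₁) c₂ p₂ a₂) c₃ p₃ a₃) c₂ = ∅ := by
    rw [inAt_addArc_of_ne o4.symm, inAt_addArc_of_ne n4.symm, inAt_addArc_of_ne m4.symm,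
      inAt_of_colAt z2]
  have l3 : inAt (addArc (addArc (addArc K₀ c₁ p₁ a₁) c₂ p₂ a₂) c₃ p₃ a₃) c₃ = ∅ := by
    rw [inAt_addArc_of_ne o5.symm, inAt_addArc_of_ne n5.symm, inAt_addArc_of_ne m5.symm,
      inAt_of_colAt z3]
  generalize addArc (addArc (addArc K₀ c₁ p₁ a₁) c₂ p₂ a₂) c₃ p₃ a₃ = K at *
  have hfin : ∀ K' U E, Ext G K K' U E →
      ({s(x', c₁), s(x, c₁), s(x', c₂), s(x, c₂), s(x', c₃), s(x, c₃)} : Finset (Sym2 V)) ⊆ E →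
      ∃ K, Ok G K ∧ Full G K := by
    intro K' U E hE hsub
    simp only [Finset.insert_subset_iff, Finset.singleton_subset_iff] at hsub
    obtain ⟨g1, g2, g3, g4, g5, g6⟩ := hsub
    refine ⟨K', hE.ok, full_of_cov hK₀.cov (fun x y h => ?_) fun w hw y hwy => ?_⟩
    · rw [hE.edge, hedge]
      exact Or.inl (Or.inl (Or.inl (Or.inl h)))
    · rw [hE.edge, hedge]
      simp only [Finset.mem_insert, Finset.mem_singleton] at hw
      rcases hw with rfl | rfl | rfl | rfl | rfl
      · rcases (hx y).1 hwy with rfl | rfl | rfl <;> right <;> assumption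
      · rcases (hx' y).1 hwy with rfl | rfl | rfl <;> right <;> assumption
      · rcases (hc₁ y).1 hwy with rfl | rfl | rfl
        · right; rwa [Sym2.eq_swap]
        · right; rwa [Sym2.eq_swap]
        · simp
      · rcases (hc₂ y).1 hwy with rfl | rfl | rfl
        · right; rwa [Sym2.eq_swap]
        · right; rwa [Sym2.eq_swap]
        · simp
      · rcases (hc₃ y).1 hwy with rfl | rfl | rfl
        · right; rwa [Sym2.eq_swap]
        · right; rwa [Sym2.eq_swap]
        · simp
  -- A color present at exactly one of `p₁`, `p₃` serves as `g`; the roles of `c₁` and `c₃` are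
  -- exchanged if necessary.
  by_cases hsub : colAt K p₁ ⊆ colAt K p₃
  · have : ∃ g ∈ colAt K p₃, g ∉ colAt K p₁ := by
      by_contra! hcon
      exact hne (hsub.antisymm hcon)
    obtain ⟨g, hg, hg'⟩ := this
    obtain ⟨K', U, hE⟩ := bipartite_finish hG (c₁ := c₃) (c₂ := c₂) (c₃ := c₁) h23.symm h13.symm
      h12.symm hxx (fun w => (hx w).trans (by tauto)) (fun w => (hx' w).trans (by tauto)) hc₃ hc₂
      hc₁ h₃ k k' l3 l2 l1 hg hg'
    refine hfin K' U _ hE ?_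
    intro e
    simp only [Finset.mem_insert, Finset.mem_singleton]
    tauto
  · rw [Finset.not_subset] at hsub
    obtain ⟨g, hg, hg'⟩ := hsub
    obtain ⟨K', U, hE⟩ := bipartite_finish hG h12 h13 h23 hxx hx hx' hc₁ hc₂ hc₃ h₃ k k' l1 l2 l3
      hg hg'
    exact hfin K' U _ hE subset_rfl

end CompleteBipartite

end SemistrongColoring

namespace SemistrongColoring

/-! ### Coloring along an induced cycle -/

section Cycle

set_option linter.unusedSectionVars false

variable {V : Type*} [Fintype V] [DecidableEq V] {G : SimpleGraph V} [DecidableRel G.Adj]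

variable (G) in
/-- An induced cycle `c 0, …, c (k - 1)` in a cubic graph; `d i` is the neighbor of `c i` off the
cycle. These neighbors are distinct, and `d 0` can be adjacent only to the first of them. -/
structure RootedCycle (k : ℕ) (c d : ℕ → V) : Prop where
  four_le : 4 ≤ k
  inj : ∀ i j, i < k → j < k → c i = c j → i = j
  per : c k = c 0
  nbr : ∀ i, i + 1 < k → ∀ x, G.Adj (c (i + 1)) x ↔ x = c i ∨ x = c (i + 2) ∨ x = d (i + 1)
  nbr_zero : ∀ x, G.Adj (c 0) x ↔ x = c 1 ∨ x = c (k - 1) ∨ x = d 0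
  off : ∀ i j, i < k → j < k → d i ≠ c j
  dinj : ∀ i j, i < k → j < k → d i = d j → i = j
  far : ∀ j, j < k → G.Adj (d 0) (d j) → j ≤ 3

/-- The vertices off the cycle together with `c 1, …, c i`. -/
def upTo (k : ℕ) (c : ℕ → V) (i : ℕ) : Finset V :=
  Finset.univ \ ((Finset.range k).filter fun j => ¬ (1 ≤ j ∧ j ≤ i)).image c

lemma mem_upTo {k : ℕ} {c : ℕ → V} {i : ℕ} {x : V} :
    x ∈ upTo k c i ↔ ∀ j < k, c j = x → 1 ≤ j ∧ j ≤ i := by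
  simp only [upTo, Finset.mem_sdiff, Finset.mem_univ, true_and, Finset.mem_image,
    Finset.mem_filter, Finset.mem_range, not_exists, not_and, and_imp]
  constructor
  · intro h j hj hx
    by_contra hcon
    exact h j hj (fun h1 h2 => hcon ⟨h1, h2⟩) hx
  · intro h j hj hn hx
    exact hn (h j hj hx).1 (h j hj hx).2

lemma RootedCycle.c_mem {k : ℕ} {c d : ℕ → V} (h : RootedCycle G k c d) {i j : ℕ} (hj : j < k) :
    c j ∈ upTo k c i ↔ 1 ≤ j ∧ j ≤ i := by
  rw [mem_upTo]
  refine ⟨fun H => H j hj rfl, fun H l hl hlj => ?_⟩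
  rw [h.inj l j hl hj hlj]
  exact H

lemma RootedCycle.d_mem {k : ℕ} {c d : ℕ → V} (h : RootedCycle G k c d) {i j : ℕ} (hj : j < k) :
    d j ∈ upTo k c i := by
  rw [mem_upTo]
  exact fun l hl hlj => (h.off j l hj hl hlj.symm).elim

lemma RootedCycle.insert_upTo {k : ℕ} {c d : ℕ → V} (h : RootedCycle G k c d) {i : ℕ}
    (hi : i + 1 < k) : insert (c (i + 1)) (upTo k c i) = upTo k c (i + 1) := by
  ext x
  rw [Finset.mem_insert, mem_upTo, mem_upTo]
  constructor
  · rintro (rfl | H) j hj hx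
    · have := h.inj j (i + 1) hj hi hx
      omega
    · have := H j hj hx
      omega
  · intro H
    by_cases hx : x = c (i + 1)
    · exact Or.inl hx
    · refine Or.inr fun j hj hjx => ?_
      have := H j hj hjx
      have hne : j ≠ i + 1 := by
        rintro rfl
        exact hx hjx.symm
      omega

lemma RootedCycle.c_ne {k : ℕ} {c d : ℕ → V} (h : RootedCycle G k c d) {i j : ℕ} (hi : i < k)
    (hj : j < k) (hij : i ≠ j) : c i ≠ c j := fun he => hij (h.inj i j hi hj he)

lemma RootedCycle.d_ne {k : ℕ} {c d : ℕ → V} (h : RootedCycle G k c d) {i j : ℕ} (hi : i < k)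
    (hj : j < k) (hij : i ≠ j) : d i ≠ d j := fun he => hij (h.dinj i j hi hj he)

lemma RootedCycle.d_adj_c {k : ℕ} {c d : ℕ → V} (h : RootedCycle G k c d) {i j : ℕ} (hi : i < k)
    (hj : j < k) (hadj : G.Adj (d i) (c j)) : i = j := by
  have hk := h.four_le
  rcases j with _ | j
  · rcases (h.nbr_zero _).1 hadj.symm with H | H | H
    · exact (h.off i 1 hi (by omega) H).elim
    · exact (h.off i (k - 1) hi (by omega) H).elim
    · exact h.dinj i 0 hi hj H
  · rcases (h.nbr j hj _).1 hadj.symm with H | H | H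
    · exact (h.off i j hi (by omega) H).elim
    · by_cases hj2 : j + 2 = k
      · rw [hj2, h.per] at H
        exact (h.off i 0 hi (by omega) H).elim
      · exact (h.off i (j + 2) hi (by omega) H).elim
    · exact h.dinj i (j + 1) hi hj H

/-- Three lists of at least two colors, the complements of `X`, `Y`, `Z`, have distinct
representatives unless all three are the same pair. -/
lemma exists_distinct_of_card_le {X Y Z : Finset (Fin 8)} (hX : X.card ≤ 6) (hY : Y.card ≤ 6)
    (hZ : Z.card ≤ 6) (h : X ≠ Z ∨ X.card ≤ 5) :
    ∃ x y z, x ∉ X ∧ y ∉ Y ∧ z ∉ Z ∧ x ≠ y ∧ x ≠ z ∧ y ≠ z := by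
  obtain ⟨y, hy⟩ := exists_notMem_of_card_le (F := Y) (by omega)
  by_contra! hcon
  obtain ⟨x, hx⟩ := exists_notMem_of_card_le (F := insert y X) (card_insert_le_of hX)
  obtain ⟨z, hz⟩ := exists_notMem_of_card_le (F := insert y Z) (card_insert_le_of hZ)
  rw [Finset.mem_insert, not_or] at hx hz
  have key : ∀ x' z', x' ≠ y → x' ∉ X → z' ≠ y → z' ∉ Z → x' = z' := by
    intro x' z' h1 h2 h3 h4
    by_contra h5
    exact h3 (hcon x' y z' h2 hy h4 h1 h5).symm
  have hxz := key x z hx.1 hx.2 hz.1 hz.2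
  subst hxz
  -- Once `y` is chosen, failure leaves both other lists with the single further color `x`.
  have hX' : Xᶜ ⊆ {x, y} := by
    intro t ht
    rw [Finset.mem_compl] at ht
    simp only [Finset.mem_insert, Finset.mem_singleton]
    by_contra! h'
    exact h'.1 (key t x h'.2 ht hz.1 hz.2)
  have hZ' : Zᶜ ⊆ {x, y} := by
    intro t ht
    rw [Finset.mem_compl] at ht
    simp only [Finset.mem_insert, Finset.mem_singleton]
    by_contra! h'
    exact h'.1 (key x t hx.1 hx.2 h'.2 ht).symm
  have c2 : ({x, y} : Finset (Fin 8)).card ≤ 2 := Finset.card_le_two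
  have cX := Finset.card_add_card_compl X
  have cZ := Finset.card_add_card_compl Z
  rw [Fintype.card_fin] at cX cZ
  have e1 := Finset.card_le_card hX'
  have e2 := Finset.card_le_card hZ'
  rcases h with h | h
  · apply h
    rw [← compl_inj_iff, Finset.eq_of_subset_of_card_le hX' (by omega),
      Finset.eq_of_subset_of_card_le hZ' (by omega)]
  · omega

variable (G) in
/-- The invariant kept while the cycle is colored up to `c i`. -/
structure Stage (k : ℕ) (c d : ℕ → V) (i : ℕ) (K : V → V → Fin 8 → Prop) : Prop where
  ok : Ok G K
  cov : Cov G K (upTo k c i)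
  in_last : inAt K (c i) = ∅
  in_first : inAt K (c 1) = ∅
  in_root : inAt K (d 0) = ∅
  in_le : ∀ j, i < j → j < k → (inAt K (d j)).card ≤ 1
  key : near G K (c 0) (c 1) ≠ near G K (c 0) (d 0) ∨ (near G K (c 0) (c 1)).card ≤ 5

lemma near_congr {K K' : V → V → Fin 8 → Prop} {u v : V}
    (h : ∀ w, w ≠ u → G.Adj v w → colAt K' w = colAt K w) : near G K' u v = near G K u v := by
  ext a
  rw [mem_near, mem_near]
  refine exists_congr fun w => and_congr_right fun h1 => and_congr_right fun h2 => ?_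
  rw [← mem_colAt, ← mem_colAt, h w h1 h2]

/-- Both edges are designated away from `c (i + 1)`: the first faces 6 + 1 forbidden colors because
of `d (i + 1)`, the second 6 and the first color, as `c i` is free. For `i ≥ 3` they change neither
set in `key`: they miss `c 2` and `d 1`, and by `far` the vertex `d (i + 1)` is not adjacent to `d
0`. -/
lemma Stage.succ (hG : ∀ v, G.degree v ≤ 3) {k : ℕ} {c d : ℕ → V} (h : RootedCycle G k c d) {i : ℕ}
    (hi : 3 ≤ i) (hik : i + 1 < k) {K : V → V → Fin 8 → Prop} (hK : Stage G k c d i K) :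
    ∃ K', Stage G k c d (i + 1) K' := by
  have hN : ∀ x ∈ upTo k c i, G.Adj (c (i + 1)) x ↔ x = c i ∨ x = d (i + 1) := by
    intro x hx
    rw [h.nbr i hik]
    refine ⟨?_, by tauto⟩
    rintro (rfl | rfl | rfl)
    · exact Or.inl rfl
    · exfalso
      by_cases hj2 : i + 2 = k
      · rw [hj2, h.per, h.c_mem (by omega)] at hx
        omega
      · rw [h.c_mem (by omega)] at hx
        omega
    · exact Or.inr rfl
  have hr : c (i + 1) ∉ upTo k c i := by
    rw [h.c_mem hik]; omega
  have hz : c i ∈ upTo k c i := by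
    rw [h.c_mem (by omega)]; omega
  have hz' : d (i + 1) ∈ upTo k c i := h.d_mem hik
  have hne : c i ≠ d (i + 1) := (h.off _ _ hik (by omega)).symm
  have hrz : G.Adj (c (i + 1)) (c i) := (hN _ hz).2 (Or.inl rfl)
  have hrz' : G.Adj (c (i + 1)) (d (i + 1)) := (hN _ hz').2 (Or.inr rfl)
  obtain ⟨a, b, hok, hcov⟩ := extend_two hK.ok hK.cov hr hz hz' hne hN
    (by have := near_card_le hG hK.ok hrz
        have := hK.in_le (i + 1) (by omega) hik
        omega)
    (by have := near_card_le hG hK.ok hrz'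
        rw [hK.in_last, Finset.card_empty]
        omega)
  rw [h.insert_upTo hik] at hcov
  have hcol : ∀ w, w ≠ c (i + 1) → w ≠ c i → w ≠ d (i + 1) →
      colAt (addArc (addArc K (c (i + 1)) (c i) a) (c (i + 1)) (d (i + 1)) b) w = colAt K w :=
    fun w h1 h2 h3 => by rw [colAt_addArc_of_ne h1 h3, colAt_addArc_of_ne h1 h2]
  have hin : ∀ w, w ≠ c i → w ≠ d (i + 1) →
      inAt (addArc (addArc K (c (i + 1)) (c i) a) (c (i + 1)) (d (i + 1)) b) w = inAt K w :=
    fun w h1 h2 => by rw [inAt_addArc_of_ne h2, inAt_addArc_of_ne h1]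
  refine ⟨_, hok, hcov, ?_, ?_, ?_, ?_, ?_⟩
  · rw [hin _ (h.c_ne hik (by omega) (by omega)) (h.off _ _ hik hik).symm,
      hK.cov.inAt_eq_empty hr]
  · rw [hin _ (h.c_ne (by omega) (by omega) (by omega)) (h.off _ _ hik (by omega)).symm,
      hK.in_first]
  · rw [hin _ (h.off _ _ (by omega) (by omega)) (h.d_ne (by omega) (by omega) (by omega)),
      hK.in_root]
  · intro j hj hjk
    rw [hin _ (h.off _ _ (by omega) (by omega)) (h.d_ne (by omega) (by omega) (by omega))]
    exact hK.in_le j (by omega) hjk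
  · have e1 : near G (addArc (addArc K (c (i + 1)) (c i) a) (c (i + 1)) (d (i + 1)) b) (c 0) (c 1)
        = near G K (c 0) (c 1) := by
      refine near_congr fun w hw hadj => ?_
      rcases (h.nbr 0 (by omega) w).1 hadj with rfl | rfl | rfl
      · exact (hw rfl).elim
      · exact hcol _ (h.c_ne (by omega) (by omega) (by omega))
          (h.c_ne (by omega) (by omega) (by omega)) (h.off _ _ (by omega) (by omega)).symm
      · exact hcol _ (h.off _ _ (by omega) (by omega)) (h.off _ _ (by omega) (by omega))
          (h.d_ne (by omega) (by omega) (by omega))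
    have e2 : near G (addArc (addArc K (c (i + 1)) (c i) a) (c (i + 1)) (d (i + 1)) b) (c 0) (d 0)
        = near G K (c 0) (d 0) := by
      refine near_congr fun w hw hadj => hcol w ?_ ?_ ?_
      · rintro rfl
        have := h.d_adj_c (by omega) hik hadj
        omega
      · rintro rfl
        have := h.d_adj_c (by omega) (by omega) hadj
        omega
      · rintro rfl
        have := h.far _ hik hadj
        omega
    rw [e1, e2]
    exact hK.key

/-- The three neighbors of `c 0` are free, so an edge from `c 0` designated at its other end is
forbidden only the six colors near that end. The three edges need distinct colors besides, and `key`
is what makes such a choice possible. -/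
lemma Stage.exists_full (hG : ∀ v, G.degree v ≤ 3) {k : ℕ} {c d : ℕ → V}
    (h : RootedCycle G k c d) {K : V → V → Fin 8 → Prop} (hK : Stage G k c d (k - 1) K) :
    ∃ K, Ok G K ∧ Full G K := by
  have hk := h.four_le
  have hr : c 0 ∉ upTo k c (k - 1) := by
    rw [h.c_mem (by omega)]; omega
  have hr0 : colAt K (c 0) = ∅ := hK.cov.colAt_eq_empty hr
  have hnew : ∀ x b, ¬ Col K (c 0) x b := fun x b => hK.cov.not_col hr b
  have a1 : G.Adj (c 0) (c 1) := (h.nbr_zero _).2 (by simp)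
  have a2 : G.Adj (c 0) (c (k - 1)) := (h.nbr_zero _).2 (by simp)
  have a3 : G.Adj (c 0) (d 0) := (h.nbr_zero _).2 (by simp)
  obtain ⟨x, y, z, hx, hy, hz, hxy, hxz, hyz⟩ := exists_distinct_of_card_le
    (near_card_le hG hK.ok a1) (near_card_le hG hK.ok a2) (near_card_le hG hK.ok a3) hK.key
  have hb : ∀ v, G.Adj (c 0) v → near G K (c 0) v ∪ colAt K (c 0) ∪ back G K (c 0) v ⊆
      near G K (c 0) v := by
    intro v hv
    have : back G K (c 0) v = ∅ := by
      rw [Finset.eq_empty_iff_forall_notMem]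
      intro t ht
      obtain ⟨w, -, hw, hs⟩ := mem_back.1 ht
      have hs' := mem_inAt.2 hs
      rcases (h.nbr_zero w).1 hw with rfl | rfl | rfl
      · simp [hK.in_first] at hs'
      · simp [hK.in_last] at hs'
      · simp [hK.in_root] at hs'
    simp [hr0, this]
  have n1 : c 1 ≠ c 0 := a1.ne'
  have n2 : c (k - 1) ≠ c 0 := a2.ne'
  have n3 : d 0 ≠ c 0 := a3.ne'
  have n4 : c (k - 1) ≠ c 1 := h.c_ne (by omega) (by omega) (by omega)
  have n5 : d 0 ≠ c 1 := h.off _ _ (by omega) (by omega)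
  have n6 : d 0 ≠ c (k - 1) := h.off _ _ (by omega) (by omega)
  have h₁ := (Ext.refl hK.ok).step a1 (hnew _) (by simp) (hb _ a1) (a := x) (by simp [hx])
  have h₂ := h₁.step a2 (hnew _) (by simp [n4, n2]) (hb _ a2) (a := y)
    (by simp [hy, hxy.symm])
  have h₃ := h₂.step a3 (hnew _) (by simp [n5, n6, n3]) (hb _ a3) (a := z)
    (by simp [hz, hxz.symm, hyz.symm])
  refine ⟨_, h₃.ok, ?_⟩
  have hstar : ∀ v, G.Adj (c 0) v → ∃ a, Col (addArc (addArc (addArc K (c 0) (c 1) x) (c 0)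
      (c (k - 1)) y) (c 0) (d 0) z) (c 0) v a := by
    intro v hv
    rw [h₃.edge]
    rcases (h.nbr_zero v).1 hv with rfl | rfl | rfl <;> simp
  intro u v huv
  by_cases hu : u = c 0
  · subst hu
    exact hstar v huv
  by_cases hv : v = c 0
  · subst hv
    obtain ⟨a, ha⟩ := hstar u huv.symm
    exact ⟨a, ha.symm⟩
  have hmem : ∀ w, w ≠ c 0 → w ∈ upTo k c (k - 1) := by
    intro w hw
    rw [mem_upTo]
    rintro j hj rfl
    have : j ≠ 0 := by rintro rfl; exact hw rfl
    omega
  rw [h₃.edge]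
  exact Or.inl ((hK.cov u v).2 ⟨huv, hmem u hu, hmem v hv⟩)

lemma exists_full_of_stage (hG : ∀ v, G.degree v ≤ 3) {k : ℕ} {c d : ℕ → V}
    (h : RootedCycle G k c d) {K : V → V → Fin 8 → Prop} (hK : Stage G k c d 3 K) :
    ∃ K, Ok G K ∧ Full G K := by
  have hk := h.four_le
  have : ∀ i, 3 ≤ i → i < k → ∃ K, Stage G k c d i K := by
    intro i hi
    induction i, hi using Nat.le_induction with
    | base => exact fun _ => ⟨K, hK⟩
    | succ i hi ih =>
      intro hik
      obtain ⟨K', hK'⟩ := ih (by omega)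
      exact hK'.succ hG h hi hik
  obtain ⟨K', hK'⟩ := this (k - 1) (by omega) (by omega)
  exact hK'.exists_full hG h

end Cycle

end SemistrongColoring

namespace SemistrongColoring

/-! ### The first edges at the cycle -/

section Cycle

set_option linter.unusedSectionVars false

variable {V : Type*} [Fintype V] [DecidableEq V] {G : SimpleGraph V} [DecidableRel G.Adj]

/-- The two pendant edges at `c 1` and `c 2`. -/
lemma RootedCycle.exists_pendants (hG : ∀ v, G.degree v ≤ 3) {k : ℕ} {c d : ℕ → V}
    (h : RootedCycle G k c d) {K₀ : V → V → Fin 8 → Prop} (hok : Ok G K₀)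
    (hcov : Cov G K₀ (upTo k c 0)) (h0 : inAt K₀ (d 0) = ∅)
    (hle : ∀ j, j < k → j ≠ 2 → (inAt K₀ (d j)).card ≤ 1) :
    ∃ K p₁ p₂, Ok G K ∧ colAt K (c 0) = ∅ ∧ colAt K (c 1) = {p₁} ∧ colAt K (c 2) = {p₂} ∧
      colAt K (c 3) = ∅ ∧ inAt K (c 1) = ∅ ∧ inAt K (c 2) = ∅ ∧ inAt K (d 0) = ∅ ∧
      p₁ ∈ inAt K (d 1) ∧ p₂ ∈ colAt K (d 2) ∧ (inAt K (d 1)).card ≤ 2 ∧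
      (∀ j, 3 ≤ j → j < k → (inAt K (d j)).card ≤ 1) ∧
      ∀ x y, (∃ a, Col K x y a) ↔ (∃ a, Col K₀ x y a) ∨
        s(x, y) = s(c 1, d 1) ∨ s(x, y) = s(c 2, d 2) := by
  have hk := h.four_le
  have z : ∀ j, j < k → colAt K₀ (c j) = ∅ := fun j hj =>
    hcov.colAt_eq_empty (by rw [h.c_mem hj]; omega)
  have i : ∀ j, j < k → inAt K₀ (c j) = ∅ := fun j hj => inAt_of_colAt (z j hj)
  have ccn : ∀ {i j}, i < k → j < k → i ≠ j → c i ≠ c j := fun hi hj hij => h.c_ne hi hj hij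
  have cdn : ∀ {i j}, i < k → j < k → c i ≠ d j := fun hi hj => (h.off _ _ hj hi).symm
  have ddn : ∀ {i j}, i < k → j < k → i ≠ j → d i ≠ d j := fun hi hj hij => h.d_ne hi hj hij
  have l0 : 0 < k := by omega
  have l1 : 1 < k := by omega
  have l2 : 2 < k := by omega
  have l3 : 3 < k := by omega
  have nb1 := h.nbr 0 (by omega)
  have nb2 := h.nbr 1 (by omega)
  obtain ⟨p₁, -, -, h₁⟩ := hok.exists_pendant hG (u := c 1) (v := d 1) (u₁ := c 0) (u₂ := c 2)
    ((nb1 _).2 (by simp)) (fun x hx => by have := (nb1 x).1 hx; tauto) (z 1 l1) (i 0 l0) (i 2 l2) 0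
  obtain ⟨p₂, -, -, h₂⟩ := h₁.exists_pendant hG (u := c 2) (v := d 2) (u₁ := c 1) (u₂ := c 3)
    ((nb2 _).2 (by simp)) (fun x hx => by have := (nb2 x).1 hx; tauto)
    (by rw [colAt_addArc_of_ne (ccn l2 l1 (by norm_num)) (cdn l2 l1), z 2 l2])
    (by rw [inAt_addArc_of_ne (cdn l1 l1), i 1 l1]) (by rw [inAt_addArc_of_ne (cdn l3 l1), i 3 l3]) 0
  refine ⟨_, p₁, p₂, h₂, ?_, ?_, ?_, ?_, ?_, ?_, ?_, ?_, ?_, ?_, ?_, ?_⟩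
  · rw [colAt_addArc_of_ne (ccn l0 l2 (by norm_num)) (cdn l0 l2),
      colAt_addArc_of_ne (ccn l0 l1 (by norm_num)) (cdn l0 l1), z 0 l0]
  · rw [colAt_addArc_of_ne (ccn l1 l2 (by norm_num)) (cdn l1 l2), colAt_addArc_left, z 1 l1]
    rfl
  · rw [colAt_addArc_left, colAt_addArc_of_ne (ccn l2 l1 (by norm_num)) (cdn l2 l1), z 2 l2]
    rfl
  · rw [colAt_addArc_of_ne (ccn l3 l2 (by norm_num)) (cdn l3 l2),
      colAt_addArc_of_ne (ccn l3 l1 (by norm_num)) (cdn l3 l1), z 3 l3]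
  · rw [inAt_addArc_of_ne (cdn l1 l2), inAt_addArc_of_ne (cdn l1 l1), i 1 l1]
  · rw [inAt_addArc_of_ne (cdn l2 l2), inAt_addArc_of_ne (cdn l2 l1), i 2 l2]
  · rw [inAt_addArc_of_ne (ddn l0 l2 (by norm_num)), inAt_addArc_of_ne (ddn l0 l1 (by norm_num)),
      h0]
  · rw [inAt_addArc_of_ne (ddn l1 l2 (by norm_num)), inAt_addArc_head]
    exact Finset.mem_insert_self _ _
  · rw [colAt_addArc_right]
    exact Finset.mem_insert_self _ _
  · rw [inAt_addArc_of_ne (ddn l1 l2 (by norm_num)), inAt_addArc_head]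
    exact card_insert_le_of (hle 1 l1 (by norm_num))
  · intro j hj hjk
    rw [inAt_addArc_of_ne (ddn hjk l2 (by omega)), inAt_addArc_of_ne (ddn hjk l1 (by omega))]
    exact hle j hjk (by omega)
  · intro x y
    rw [exists_col_addArc, exists_col_addArc, Sym2.eq_iff, Sym2.eq_iff, or_assoc]

lemma RootedCycle.cov_upTo_three {k : ℕ} {c d : ℕ → V} (h : RootedCycle G k c d)
    {K₀ K' : V → V → Fin 8 → Prop} (hcov : Cov G K₀ (upTo k c 0)) (hK' : Ok G K')
    (hedge' : ∀ x y, (∃ a, Col K' x y a) ↔ (∃ a, Col K₀ x y a) ∨ s(x, y) = s(c 1, d 1) ∨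
      s(x, y) = s(c 2, d 2) ∨ s(x, y) = s(c 1, c 2) ∨ s(x, y) = s(c 3, d 3) ∨
      s(x, y) = s(c 3, c 2)) : Cov G K' (upTo k c 3) := by
  have hk := h.four_le
  have l0 : 0 < k := by omega
  have l1 : 1 < k := by omega
  have l2 : 2 < k := by omega
  have l3 : 3 < k := by omega
  have nb1 := h.nbr 0 (by omega)
  have nb2 := h.nbr 1 (by omega)
  have nb3 := h.nbr 2 (by omega)
  have ms : ∀ x y, s(x, y) = s(c 1, d 1) ∨ s(x, y) = s(c 2, d 2) ∨ s(x, y) = s(c 1, c 2) ∨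
      s(x, y) = s(c 3, d 3) ∨ s(x, y) = s(c 3, c 2) → x ∈ upTo k c 3 ∧ y ∈ upTo k c 3 := by
    have c1 : c 1 ∈ upTo k c 3 := by rw [h.c_mem l1]; omega
    have c2 : c 2 ∈ upTo k c 3 := by rw [h.c_mem l2]; omega
    have c3 : c 3 ∈ upTo k c 3 := by rw [h.c_mem l3]; omega
    have d1 : d 1 ∈ upTo k c 3 := h.d_mem l1
    have d2 : d 2 ∈ upTo k c 3 := h.d_mem l2
    have d3 : d 3 ∈ upTo k c 3 := h.d_mem l3
    intro x y hxy
    simp only [Sym2.eq_iff] at hxy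
    rcases hxy with (⟨rfl, rfl⟩ | ⟨rfl, rfl⟩) | (⟨rfl, rfl⟩ | ⟨rfl, rfl⟩) |
      (⟨rfl, rfl⟩ | ⟨rfl, rfl⟩) | (⟨rfl, rfl⟩ | ⟨rfl, rfl⟩) | (⟨rfl, rfl⟩ | ⟨rfl, rfl⟩) <;>
      constructor <;> assumption
  have hmono : ∀ x, x ∈ upTo k c 0 → x ∈ upTo k c 3 := fun x hx => by
    rw [mem_upTo] at hx ⊢
    intro j hj hjx
    have := hx j hj hjx
    omega
  have hcase : ∀ x, x ∈ upTo k c 3 → x ∈ upTo k c 0 ∨ x = c 1 ∨ x = c 2 ∨ x = c 3 := by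
    intro x hx
    by_contra! hcon
    apply hcon.1
    rw [mem_upTo] at hx ⊢
    intro j hj hjx
    exfalso
    have := hx j hj hjx
    obtain ⟨-, n1, n2, n3⟩ := hcon
    have : j = 1 ∨ j = 2 ∨ j = 3 := by omega
    rcases this with rfl | rfl | rfl
    exacts [n1 hjx.symm, n2 hjx.symm, n3 hjx.symm]
  have hstar : ∀ x y, x = c 1 ∨ x = c 2 ∨ x = c 3 → G.Adj x y → y ∈ upTo k c 3 →
      s(x, y) = s(c 1, d 1) ∨ s(x, y) = s(c 2, d 2) ∨ s(x, y) = s(c 1, c 2) ∨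
      s(x, y) = s(c 3, d 3) ∨ s(x, y) = s(c 3, c 2) := by
    rintro x y (rfl | rfl | rfl) hxy hy
    · rcases (nb1 y).1 hxy with rfl | rfl | rfl
      · rw [h.c_mem l0] at hy
        omega
      · simp
      · simp
    · rcases (nb2 y).1 hxy with rfl | rfl | rfl <;> simp
    · rcases (nb3 y).1 hxy with rfl | rfl | rfl
      · simp
      -- For `k = 4` the vertex `c 4` is `c 0`; in either case it is outside.
      · by_cases hk4 : k = 4
        · have := h.per
          rw [hk4] at this
          rw [this, h.c_mem l0] at hy
          omega
        · rw [h.c_mem (by omega)] at hy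
          omega
      · simp
  intro x y
  constructor
  · intro hxy
    obtain ⟨a, ha⟩ := hxy
    refine ⟨hK'.col_adj ha, ?_⟩
    rcases (hedge' x y).1 ⟨a, ha⟩ with hb | hb
    · have := (hcov x y).1 hb
      exact ⟨hmono x this.2.1, hmono y this.2.2⟩
    · exact ms x y hb
  · rintro ⟨hxy, hx, hy⟩
    rw [hedge']
    rcases hcase x hx with hx0 | hx0
    · rcases hcase y hy with hy0 | hy0
      · exact Or.inl ((hcov x y).2 ⟨hxy, hx0, hy0⟩)
      · have := hstar y x hy0 hxy.symm hx
        rw [Sym2.eq_swap] at this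
        exact Or.inr this
    · exact Or.inr (hstar x y hx0 hxy hy)

set_option maxHeartbeats 800000 in
-- After the pendant edges at `c 1` and `c 2`, the edges `c 1 c 2`, `c 3 d 3`, `c 3 c 2` are
-- colored, the first and last designated at `c 2`. The first has two colors to spare, and these are
-- spent on securing `key`. The vertex `d 2` may be exempt in `hle` because all its colors are
-- counted anyway.
lemma RootedCycle.exists_stage (hG : ∀ v, G.degree v ≤ 3) {k : ℕ} {c d : ℕ → V}
    (h : RootedCycle G k c d) {K₀ : V → V → Fin 8 → Prop} (hok : Ok G K₀)
    (hcov : Cov G K₀ (upTo k c 0)) (h0 : inAt K₀ (d 0) = ∅)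
    (hle : ∀ j, j < k → j ≠ 2 → (inAt K₀ (d j)).card ≤ 1) : ∃ K, Stage G k c d 3 K := by
  have hk := h.four_le
  obtain ⟨K, p₁, p₂, hK, k0, k1, k2, k3, i1, i2, id0, jp1, jp2, hd1, hle', hedge⟩ :=
    h.exists_pendants hG hok hcov h0 hle
  have ccn : ∀ {i j}, i < k → j < k → i ≠ j → c i ≠ c j := fun hi hj hij => h.c_ne hi hj hij
  have cdn : ∀ {i j}, i < k → j < k → c i ≠ d j := fun hi hj => (h.off _ _ hj hi).symm
  have dcn : ∀ {i j}, i < k → j < k → d i ≠ c j := fun hi hj => h.off _ _ hi hj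
  have ddn : ∀ {i j}, i < k → j < k → i ≠ j → d i ≠ d j := fun hi hj hij => h.d_ne hi hj hij
  have l0 : 0 < k := by omega
  have l1 : 1 < k := by omega
  have l2 : 2 < k := by omega
  have l3 : 3 < k := by omega
  have nb1 := h.nbr 0 (by omega)
  have nb2 := h.nbr 1 (by omega)
  have nb3 := h.nbr 2 (by omega)
  have i0 := inAt_of_colAt k0
  have i3 := inAt_of_colAt k3
  have n12 : ∀ b, ¬ Col K (c 1) (c 2) b := by
    intro b hb
    rcases (hedge _ _).1 ⟨b, hb⟩ with ⟨b, hb⟩ | hb | hb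
    · have := hcov.not_col (u := c 1) (v := c 2) (by rw [h.c_mem l1]; omega) b
      exact this hb
    · simp [cdn l2 l1, ccn l2 l1, cdn l1 l1] at hb
    · simp [cdn l1 l2, cdn l2 l2, ccn l1 l2] at hb
  have i4 : inAt K (c 4) = ∅ := by
    by_cases hk4 : k = 4
    · have := h.per
      rw [hk4] at this
      rw [this, i0]
    · have l4 : 4 < k := by omega
      refine inAt_eq_empty fun x a ha => ?_
      rcases (hedge _ _).1 ⟨a, Or.inl ha⟩ with ⟨b, hb⟩ | hb | hb
      · exact hcov.not_col (u := c 4) (by rw [h.c_mem l4]; omega) b hb.symm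
      · simp [ccn l4 l1, cdn l4 l1] at hb
      · simp [ccn l4 l2, cdn l4 l2] at hb
  have q1 : (colAt K (d 1)).card ≤ 3 := (colAt_card_le_degree hK _).trans (hG _)
  have q2 : (colAt K (d 2)).card ≤ 3 := (colAt_card_le_degree hK _).trans (hG _)
  have a12 : G.Adj (c 1) (c 2) := (nb1 _).2 (by simp)
  have a32 : G.Adj (c 3) (c 2) := (nb3 _).2 (by simp)
  have a3 : G.Adj (c 3) (d 3) := (nb3 _).2 (by simp)
  -- the colors that the edge `c 1, c 2` avoids besides the forbidden ones
  obtain ⟨F, hF, hFD⟩ : ∃ F : Finset (Fin 8), F.card ≤ 2 ∧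
      ((near G K (c 0) (d 0) \ insert p₂ (colAt K (d 1))).card ≤ 2 →
        F = near G K (c 0) (d 0) \ insert p₂ (colAt K (d 1))) := by
    by_cases hc : (near G K (c 0) (d 0) \ insert p₂ (colAt K (d 1))).card ≤ 2
    · exact ⟨_, hc, fun _ => rfl⟩
    · exact ⟨∅, by simp, fun h => (hc h).elim⟩
  -- Forbidden are three colors at `d 2`, two designated at `d 1`, among them the color at `c 1`,
  -- and two in `F`.
  obtain ⟨e₁, -, -, -, he₁F, h₁⟩ := hK.exists_extend a12 n12 F (by
    have hsub : near G K (c 1) (c 2) ∪ colAt K (c 1) ∪ back G K (c 1) (c 2) ⊆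
        colAt K (d 2) ∪ inAt K (d 1) :=
      forbidden_subset (u₁ := c 0) (u₂ := d 1) (v₁ := c 3) (v₂ := d 2)
        (fun x hx => by have := (nb1 x).1 hx; tauto) (fun x hx => (nb2 x).1 hx)
        (by simp [k3]) Finset.subset_union_left (by simp [k1, jp1]) (by simp [i0])
        Finset.subset_union_right
    refine (Finset.card_le_card (Finset.union_subset_union_left hsub)).trans ?_
    exact card_union_le_of (card_union_le_of q2 hd1 le_rfl) hF (by norm_num))
  have hn3 : ∀ x b, ¬ Col (addArc K (c 1) (c 2) e₁) (c 3) x b := fun x b hb => by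
    have : colAt (addArc K (c 1) (c 2) e₁) (c 3) = ∅ := by
      rw [colAt_addArc_of_ne (ccn l3 l1 (by norm_num)) (ccn l3 l2 (by norm_num)), k3]
    exact not_col_of_colAt this x b hb.symm
  -- Forbidden are six colors near `d 3` and `e₁`; that `p₃ ≠ e₁` is needed for `key`.
  obtain ⟨p₃, -, -, -, hp₃, h₂⟩ := h₁.exists_extend a3 (hn3 _) {e₁} (by
    have hb : back G (addArc K (c 1) (c 2) e₁) (c 3) (d 3) ⊆ {e₁} := by
      refine (back_subset_union (b := c 2) (c := c 4)
        (fun x hx => by have := (nb3 x).1 hx; tauto)).trans ?_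
      have : inAt (addArc K (c 1) (c 2) e₁) (c 4) ⊆ {e₁} := by
        rw [inAt_addArc]
        split_ifs <;> simp [i4]
      rw [inAt_addArc_head, i2]
      exact Finset.union_subset (by simp) this
    rw [colAt_addArc_of_ne (ccn l3 l1 (by norm_num)) (ccn l3 l2 (by norm_num)), k3,
      Finset.union_empty, Finset.union_assoc]
    exact card_union_le_of (near_card_le hG h₁ a3) (n := 1)
      ((Finset.card_le_card (Finset.union_subset hb subset_rfl)).trans (by simp)) le_rfl)
  have hp₃e : p₃ ≠ e₁ := by simpa using hp₃
  -- Forbidden are `e₁`, `p₁`, `p₃`, three colors at `d 2`, and one designated at `d 3` before.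
  obtain ⟨e₂, -, -, -, -, h₃⟩ := h₂.exists_extend a32 (fun b hb => by
      rw [col_addArc] at hb
      rcases hb with hb | ⟨-, ⟨-, hb⟩ | ⟨hb, -⟩⟩
      exacts [hn3 _ _ hb, cdn l2 l3 hb, cdn l3 l3 hb]) ∅ (by
    have m1 : colAt (addArc (addArc K (c 1) (c 2) e₁) (c 3) (d 3) p₃) (c 1) = {e₁, p₁} := by
      rw [colAt_addArc_of_ne (ccn l1 l3 (by norm_num)) (cdn l1 l3), colAt_addArc_left, k1]
    have m2 : colAt (addArc (addArc K (c 1) (c 2) e₁) (c 3) (d 3) p₃) (d 2) = colAt K (d 2) := by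
      rw [colAt_addArc_of_ne (dcn l2 l3) (ddn l2 l3 (by norm_num)),
        colAt_addArc_of_ne (dcn l2 l1) (dcn l2 l2)]
    have m3 : colAt (addArc (addArc K (c 1) (c 2) e₁) (c 3) (d 3) p₃) (c 3) = {p₃} := by
      rw [colAt_addArc_left, colAt_addArc_of_ne (ccn l3 l1 (by norm_num))
        (ccn l3 l2 (by norm_num)), k3]
      rfl
    have m4 : inAt (addArc (addArc K (c 1) (c 2) e₁) (c 3) (d 3) p₃) (d 3) =
        insert p₃ (inAt K (d 3)) := by
      rw [inAt_addArc_head, inAt_addArc_of_ne (dcn l3 l2)]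
    have m5 : inAt (addArc (addArc K (c 1) (c 2) e₁) (c 3) (d 3) p₃) (c 4) ⊆ {e₁, p₃} := by
      rw [inAt_addArc, inAt_addArc, i4]
      split_ifs <;> intro t <;> simp <;> tauto
    have hsub := forbidden_subset (G := G)
      (K := addArc (addArc K (c 1) (c 2) e₁) (c 3) (d 3) p₃) (u := c 3) (v := c 2)
      (u₁ := d 3) (u₂ := c 4) (v₁ := c 1) (v₂ := d 2)
      (Z := ({e₁, p₁, p₃} ∪ colAt K (d 2)) ∪ inAt K (d 3))
      (fun x hx => by have := (nb3 x).1 hx; tauto) (fun x hx => by have := (nb2 x).1 hx; tauto)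
      (by rw [m1]; intro t; simp; tauto)
      (by rw [m2]; intro t; simp; tauto)
      (by rw [m3]; intro t; simp; tauto)
      (by rw [m4]; intro t; simp; tauto)
      (m5.trans (by intro t; simp; tauto))
    rw [Finset.union_empty]
    refine (Finset.card_le_card hsub).trans ?_
    exact card_union_le_of (card_union_le_of Finset.card_le_three q2 le_rfl)
      (hle' 3 le_rfl l3) (by norm_num))
  have hedge' : ∀ x y, (∃ a, Col (addArc (addArc (addArc K (c 1) (c 2) e₁) (c 3) (d 3) p₃)
      (c 3) (c 2) e₂) x y a) ↔ (∃ a, Col K₀ x y a) ∨ s(x, y) = s(c 1, d 1) ∨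
      s(x, y) = s(c 2, d 2) ∨ s(x, y) = s(c 1, c 2) ∨ s(x, y) = s(c 3, d 3) ∨
      s(x, y) = s(c 3, c 2) := by
    intro x y
    rw [exists_col_addArc, exists_col_addArc, exists_col_addArc, hedge]
    simp only [← Sym2.eq_iff, or_assoc]
  refine ⟨_, h₃, ?_, ?_, ?_, ?_, ?_, ?_⟩
  · exact h.cov_upTo_three hcov h₃ hedge'
  · rw [inAt_addArc_of_ne (ccn l3 l2 (by norm_num)), inAt_addArc_of_ne (cdn l3 l3),
      inAt_addArc_of_ne (ccn l3 l2 (by norm_num)), i3]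
  · rw [inAt_addArc_of_ne (ccn l1 l2 (by norm_num)), inAt_addArc_of_ne (cdn l1 l3),
      inAt_addArc_of_ne (ccn l1 l2 (by norm_num)), i1]
  · rw [inAt_addArc_of_ne (dcn l0 l2), inAt_addArc_of_ne (ddn l0 l3 (by norm_num)),
      inAt_addArc_of_ne (dcn l0 l2), id0]
  · intro j hj hjk
    rw [inAt_addArc_of_ne (dcn hjk l2), inAt_addArc_of_ne (ddn hjk l3 (by omega)),
      inAt_addArc_of_ne (dcn hjk l2)]
    exact hle' j (by omega) hjk
  -- Let `Q` be `p₂` with the colors at `d 1`, at most four, and `D` the colors near `d 0` in `K`.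
  -- Suppose the two sets agree and have six elements. The first lies in `Q ∪ {e₁, e₂}`, so `e₁ ∉
  -- Q`, and `e₁` is near `d 0`. The only new edge that can meet a neighbor of `d 0` other than `c
  -- 0` is the one at `d 3`, of color `p₃ ≠ e₁`; so `e₁ ∈ D`. Moreover `D \ Q ⊆ {e₁, e₂}`, hence `F`
  -- was `D \ Q`, and `e₁` was chosen outside it.
  · by_contra! hcon
    obtain ⟨heq, hcard⟩ := hcon
    have hX1 : near G (addArc (addArc (addArc K (c 1) (c 2) e₁) (c 3) (d 3) p₃) (c 3) (c 2) e₂)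
        (c 0) (c 1) ⊆ insert e₁ (insert e₂ (insert p₂ (colAt K (d 1)))) := by
      refine (near_subset fun x hx => (nb1 x).1 hx).trans ?_
      rw [colAt_addArc_right, colAt_addArc_of_ne (ccn l2 l3 (by norm_num)) (cdn l2 l3),
        colAt_addArc_right, k2, colAt_addArc_of_ne (dcn l1 l3) (dcn l1 l2),
        colAt_addArc_of_ne (dcn l1 l3) (ddn l1 l3 (by norm_num)),
        colAt_addArc_of_ne (dcn l1 l1) (dcn l1 l2)]
      intro t
      simp
      tauto
    have he₁X : e₁ ∈ near G (addArc (addArc (addArc K (c 1) (c 2) e₁) (c 3) (d 3) p₃)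
        (c 3) (c 2) e₂) (c 0) (c 1) :=
      mem_near.2 ⟨c 2, ccn l2 l0 (by norm_num), a12, c 1, by simp [col_addArc]⟩
    have hQ : (insert p₂ (colAt K (d 1))).card ≤ 4 := card_insert_le_of q1
    have he₁Q : e₁ ∉ insert p₂ (colAt K (d 1)) := by
      intro hmem
      rw [Finset.insert_eq_of_mem (Finset.mem_insert_of_mem hmem)] at hX1
      have := (Finset.card_le_card hX1).trans (card_insert_le_of hQ)
      omega
    rw [heq] at he₁X hX1
    have he₁D : e₁ ∈ near G K (c 0) (d 0) := by
      obtain ⟨w, hw, hadj, x, hx⟩ := mem_near.1 he₁X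
      have hwc : ∀ j, j < k → w ≠ c j := by
        rintro j hj rfl
        have := h.d_adj_c l0 hj hadj
        subst this
        exact hw rfl
      refine mem_near.2 ⟨w, hw, hadj, x, ?_⟩
      simp only [col_addArc] at hx
      rcases hx with ((hx | ⟨-, ⟨hx, -⟩ | ⟨hx, -⟩⟩) | ⟨hx, -⟩) | ⟨-, ⟨hx, -⟩ | ⟨hx, -⟩⟩
      exacts [hx, (hwc 1 l1 hx).elim, (hwc 2 l2 hx).elim, (hp₃e hx.symm).elim,
        (hwc 3 l3 hx).elim, (hwc 2 l2 hx).elim]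
    by_cases hD : (near G K (c 0) (d 0) \ insert p₂ (colAt K (d 1))).card ≤ 2
    · rw [hFD hD] at he₁F
      exact he₁F (Finset.mem_sdiff.2 ⟨he₁D, he₁Q⟩)
    · apply hD
      refine (Finset.card_le_card (t := {e₁, e₂}) ?_).trans Finset.card_le_two
      intro t ht
      rw [Finset.mem_sdiff] at ht
      obtain ⟨w, hw, hadj, x, hx⟩ := mem_near.1 ht.1
      have := @hX1 t (mem_near.2 ⟨w, hw, hadj, x, by simp [col_addArc, hx]⟩)
      rw [Finset.mem_insert, Finset.mem_insert] at this
      rw [Finset.mem_insert, Finset.mem_singleton]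
      tauto

end Cycle

end SemistrongColoring

namespace SemistrongColoring

/-! ### Shortest cycles in cubic graphs without small pieces -/

section ShortestCycle

set_option linter.unusedSectionVars false

variable {V : Type*} [Fintype V] [DecidableEq V] {G : SimpleGraph V} [DecidableRel G.Adj]

variable (G) in
/-- The vertices `f 0, …, f (k - 1)` form a cycle in this order. -/
structure IsCyc (k : ℕ) (f : ℕ → V) : Prop where
  three_le : 3 ≤ k
  inj : ∀ i j, i < k → j < k → f i = f j → i = j
  adj : ∀ i, i + 1 < k → G.Adj (f i) (f (i + 1))
  close : G.Adj (f (k - 1)) (f 0)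

/-- A set of vertices that induces a subgraph of minimum degree at least two contains a cycle. -/
lemma exists_isCyc {T : Finset V} (hne : T.Nonempty) (hT : ∀ w ∈ T, 2 ≤ degOn G T w) :
    ∃ k f, IsCyc G k f ∧ k ≤ T.card := by
  have hnext : ∀ u v, v ∈ T → ∃ w ∈ T, G.Adj v w ∧ w ≠ u := by
    intro u v hv
    have h1 := hT v hv
    unfold degOn at h1
    obtain ⟨w, hw, hwu⟩ := Finset.exists_mem_ne (by omega : 1 < (G.neighborFinset v ∩ T).card) u
    rw [Finset.mem_inter, G.mem_neighborFinset] at hw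
    exact ⟨w, hw.2, hw.1, hwu⟩
  choose! nx hnx using hnext
  obtain ⟨v, hv⟩ := hne
  -- A walk that never turns back, recorded by pairs of consecutive vertices. Its first repetition
  -- closes a cycle.
  let p : ℕ → V × V := fun n => Nat.rec (v, nx v v) (fun _ q => (q.2, nx q.1 q.2)) n
  have hp0 : p 0 = (v, nx v v) := rfl
  have hps : ∀ n, p (n + 1) = ((p n).2, nx (p n).1 (p n).2) := fun n => rfl
  have hinv : ∀ n, (p n).1 ∈ T ∧ (p n).2 ∈ T ∧ G.Adj (p n).1 (p n).2 := by
    intro n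
    induction n with
    | zero =>
      rw [hp0]
      exact ⟨hv, (hnx v v hv).1, (hnx v v hv).2.1⟩
    | succ n ih =>
      rw [hps]
      have := hnx (p n).1 (p n).2 ih.2.1
      exact ⟨ih.2.1, this.1, this.2.1⟩
  let s : ℕ → V := fun n => (p n).1
  have hs1 : ∀ n, (p n).2 = s (n + 1) := fun n => by simp only [s, hps]
  have hsT : ∀ n, s n ∈ T := fun n => (hinv n).1
  have hadj : ∀ n, G.Adj (s n) (s (n + 1)) := fun n => hs1 n ▸ (hinv n).2.2
  have hne2 : ∀ n, s (n + 2) ≠ s n := by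
    intro n
    have h1 : s (n + 2) = nx (p n).1 (p n).2 := by simp only [s, hps]
    rw [h1]
    exact (hnx (p n).1 (p n).2 (hinv n).2.1).2.2
  have hex : ∃ j, ∃ i, i < j ∧ s i = s j := by
    obtain ⟨a, b, hab, he⟩ := Finite.exists_ne_map_eq_of_infinite s
    rcases lt_or_gt_of_ne hab with h | h
    exacts [⟨b, a, h, he⟩, ⟨a, b, h, he.symm⟩]
  classical
  obtain ⟨i, hij, he⟩ := Nat.find_spec hex
  have hmin := fun m (hm : m < Nat.find hex) => Nat.find_min hex hm
  generalize Nat.find hex = j at *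
  have hinj : ∀ a b, a < j → b < j → s a = s b → a = b := by
    intro a b ha hb hab
    rcases lt_trichotomy a b with h | h | h
    · exact (hmin b hb ⟨a, h, hab⟩).elim
    · exact h
    · exact (hmin a ha ⟨b, h, hab.symm⟩).elim
  have h3 : i + 3 ≤ j := by
    have n1 : j ≠ i + 1 := by
      rintro rfl
      exact (hadj i).ne he
    have n2 : j ≠ i + 2 := by
      rintro rfl
      exact hne2 i he.symm
    omega
  refine ⟨j - i, fun n => s (i + n), ⟨by omega, ?_, ?_, ?_⟩, ?_⟩
  · intro a b ha hb hab
    have := hinj _ _ (by omega) (by omega) hab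
    omega
  · intro a _
    exact hadj (i + a)
  · have h4 := hadj (j - 1)
    rw [Nat.sub_add_cancel (by omega), ← he] at h4
    have h5 : i + (j - i - 1) = j - 1 := by omega
    simpa [h5] using h4
  · have := Finset.card_le_card_of_injOn (s := Finset.range (j - i)) (t := T)
      (fun n => s (i + n)) (fun n _ => hsT _) (by
        intro a ha b hb hab
        simp only [Finset.coe_range, Set.mem_Iio] at ha hb
        have := hinj _ _ (by omega) (by omega) hab
        omega)
    simpa using this

/-- A shortest cycle, with a periodic parametrization. -/
structure ShortestCycle (G : SimpleGraph V) (k : ℕ) (c : ℕ → V) : Prop where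
  three_le : 3 ≤ k
  adj : ∀ i, G.Adj (c i) (c (i + 1))
  per : ∀ i, c (i + k) = c i
  inj : ∀ s i j, i < k → j < k → c (s + i) = c (s + j) → i = j
  min : ∀ k' f, IsCyc G k' f → k ≤ k'

lemma exists_shortestCycle (h : ∃ k f, IsCyc G k f) : ∃ k c, ShortestCycle G k c := by
  classical
  obtain ⟨f, hf⟩ := Nat.find_spec h
  have hmin : ∀ k' f, IsCyc G k' f → Nat.find h ≤ k' := fun k' f hf => Nat.find_min' h ⟨f, hf⟩
  generalize Nat.find h = k at *
  have h3 := hf.three_le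
  -- Reducing indices modulo `k` allows arcs of the cycle to start anywhere and to wrap around.
  refine ⟨k, fun n => f (n % k), h3, ?_, ?_, ?_, hmin⟩
  · intro i
    have hlt := Nat.mod_lt i (by omega : 0 < k)
    by_cases hi : i % k + 1 < k
    · have : (i + 1) % k = i % k + 1 := by
        rw [Nat.add_mod, Nat.mod_eq_of_lt (by omega : 1 < k), Nat.mod_eq_of_lt hi]
      simp only [this]
      exact hf.adj _ hi
    · have h1 : i % k = k - 1 := by omega
      have : (i + 1) % k = 0 := by
        rw [Nat.add_mod, h1, Nat.mod_eq_of_lt (by omega : 1 < k), Nat.sub_add_cancel (by omega),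
          Nat.mod_self]
      simp only [this, h1]
      exact hf.close
  · intro i
    simp
  · intro s i j hi hj he
    have h1 := hf.inj _ _ (Nat.mod_lt _ (by omega)) (Nat.mod_lt _ (by omega)) he
    have h2 : i ≡ j [MOD k] := Nat.ModEq.add_left_cancel' s h1
    unfold Nat.ModEq at h2
    rwa [Nat.mod_eq_of_lt hi, Nat.mod_eq_of_lt hj] at h2

namespace ShortestCycle

variable {k : ℕ} {c : ℕ → V}

/-- The chord closes the arc of length `L` from `c s` to a cycle with `L + 1` vertices, which cannot
be shorter than `k`. One or two outside vertices give the analogous bounds below. -/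
lemma chord (h : ShortestCycle G k c) {s L : ℕ} (h2 : 2 ≤ L) (hL : L < k)
    (hadj : G.Adj (c (s + L)) (c s)) : k ≤ L + 1 := by
  refine h.min (L + 1) (fun n => c (s + n)) ⟨by omega, ?_, fun i _ => h.adj (s + i), ?_⟩
  · intro i j hi hj he
    exact h.inj s i j (by omega) (by omega) he
  · simpa using hadj

lemma ear_one (h : ShortestCycle G k c) {s L : ℕ} {x : V} (h1 : 1 ≤ L) (hL : L < k)
    (hx : ∀ i, x ≠ c i) (hxs : G.Adj x (c s)) (hxL : G.Adj x (c (s + L))) : k ≤ L + 2 := by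
  refine h.min (L + 2) (fun n => if n ≤ L then c (s + n) else x) ⟨by omega, ?_, ?_, ?_⟩
  · intro i j hi hj he
    split_ifs at he with a b b
    · exact h.inj s i j (by omega) (by omega) he
    · exact (hx _ he.symm).elim
    · exact (hx _ he).elim
    · omega
  · intro i hi
    by_cases hiL : i + 1 ≤ L
    · rw [if_pos (by omega), if_pos hiL]
      exact h.adj (s + i)
    · have : i = L := by omega
      subst this
      rw [if_pos le_rfl, if_neg (by omega)]
      exact hxL.symm
  · simpa using hxs

lemma ear_two (h : ShortestCycle G k c) {s L : ℕ} {x y : V} (hL : L < k)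
    (hx : ∀ i, x ≠ c i) (hy : ∀ i, y ≠ c i) (hxy : G.Adj x y) (hxs : G.Adj x (c s))
    (hyL : G.Adj y (c (s + L))) : k ≤ L + 3 := by
  refine h.min (L + 3) (fun n => if n ≤ L then c (s + n) else if n = L + 1 then y else x)
    ⟨by omega, ?_, ?_, ?_⟩
  · intro i j hi hj he
    have hne := hxy.ne
    split_ifs at he with a b b a1 b b b b
    · exact h.inj s i j (by omega) (by omega) he
    · exact (hy _ he.symm).elim
    · exact (hx _ he.symm).elim
    · exact (hy _ he).elim
    · omega
    · exact (hne he.symm).elim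
    · exact (hx _ he).elim
    · exact (hne he).elim
    · omega
  · intro i hi
    by_cases hiL : i + 1 ≤ L
    · rw [if_pos (by omega), if_pos hiL]
      exact h.adj (s + i)
    · by_cases hi2 : i = L
      · subst hi2
        rw [if_pos le_rfl, if_neg (by omega), if_pos rfl]
        exact hyL.symm
      · have : i = L + 1 := by omega
        subst this
        rw [if_neg (by omega), if_pos rfl, if_neg (by omega), if_neg (by omega)]
        exact hxy.symm
  · simpa using hxs

lemma adj_cases (h : ShortestCycle G k c) {i j : ℕ} (hi : i < k) (hj : j < k)
    (hadj : G.Adj (c i) (c j)) : c j = c (i + 1) ∨ c j = c (i + k - 1) := by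
  have h3 := h.three_le
  have key : ∀ {i j}, i < j → j < k → G.Adj (c i) (c j) → j = i + 1 ∨ (i = 0 ∧ j = k - 1) := by
    intro i j hij hj hadj
    by_cases hji : j = i + 1
    · exact Or.inl hji
    · have := h.chord (s := i) (L := j - i) (by omega) (by omega)
        (by rw [Nat.add_sub_cancel' hij.le]; exact hadj.symm)
      omega
  rcases lt_trichotomy i j with hij | rfl | hij
  · rcases key hij hj hadj with rfl | ⟨rfl, rfl⟩
    · exact Or.inl rfl
    · exact Or.inr (by rw [Nat.zero_add])
  · exact (G.loopless.irrefl _ hadj).elim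
  · rcases key hij hi hadj.symm with rfl | ⟨rfl, rfl⟩
    · right
      rw [show j + 1 + k - 1 = j + k by omega, h.per]
    · left
      rw [Nat.sub_add_cancel (by omega), ← h.per 0, Nat.zero_add]

lemma mod_eq (h : ShortestCycle G k c) (i : ℕ) : ∃ j < k, c i = c j := by
  have h3 := h.three_le
  induction i using Nat.strong_induction_on with
  | _ i ih =>
    by_cases hi : i < k
    · exact ⟨i, hi, rfl⟩
    · obtain ⟨j, hj, he⟩ := ih (i - k) (by omega)
      refine ⟨j, hj, ?_⟩
      rw [← he, ← h.per (i - k), Nat.sub_add_cancel (by omega)]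

/-- In a cubic graph without triangles and without two vertices with three common neighbors, a
shortest cycle is a rooted cycle. -/
lemma exists_rootedCycle (h : ShortestCycle G k c) (hd : ∀ v, G.degree v = 3)
    (htri : ∀ x y z, G.Adj x y → G.Adj y z → ¬ G.Adj x z)
    (hK : ∀ x x' a b e, x ≠ x' → a ≠ b → a ≠ e → b ≠ e → G.Adj x a → G.Adj x b → G.Adj x e →
      G.Adj x' a → G.Adj x' b → ¬ G.Adj x' e) : ∃ d, RootedCycle G k c d := by
  have h3 := h.three_le
  have h4 : 4 ≤ k := by
    by_contra hcon
    have hk : k = 3 := by omega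
    have h0 := h.per 0
    rw [hk, Nat.zero_add] at h0
    have a2 := h.adj 2
    norm_num at a2
    rw [h0] at a2
    exact htri _ _ _ (h.adj 0) (h.adj 1) a2.symm
  have hprev : ∀ i, G.Adj (c i) (c (i + k - 1)) := by
    intro i
    have := h.adj (i + k - 1)
    rw [show i + k - 1 + 1 = i + k by omega, h.per] at this
    exact this.symm
  have hpn : ∀ i, c (i + 1) ≠ c (i + k - 1) := by
    intro i he
    have := h.inj i 1 (k - 1) (by omega) (by omega) (by rwa [← Nat.add_sub_assoc (by omega)])
    omega
  have hthird := fun i => exists_third (hd (c i)) (h.adj i) (hprev i) (hpn i)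
  choose d hd1 hd2 hd3 using hthird
  have hcd : ∀ i, G.Adj (c i) (d i) := fun i => (hd3 i _).2 (by simp)
  have hoff : ∀ i j, i < k → j < k → d i ≠ c j := by
    intro i j hi hj he
    rcases h.adj_cases hi hj (he ▸ hcd i) with h' | h'
    · exact hd1 i (he.trans h')
    · exact hd2 i (he.trans h')
  have hoff' : ∀ i j, i < k → d i ≠ c j := by
    intro i j hi
    obtain ⟨j', hj', he⟩ := h.mod_eq j
    rw [he]
    exact hoff i j' hi hj'
  -- A common outside neighbor closes both arcs between `c i` and `c j`, so both have length at
  -- least `k - 2`. Hence `k = 4` and `j = i + 2`, and `c i`, `c j` have three common neighbors.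
  have hdinj : ∀ i j, i < j → j < k → d i ≠ d j := by
    intro i j hij hj he
    have e1 := h.ear_one (s := i) (L := j - i) (x := d i) (by omega) (by omega)
      (fun l => hoff' i l (by omega)) (hcd i).symm
      (by rw [Nat.add_sub_cancel' hij.le, he]; exact (hcd j).symm)
    have hper : c (j + (k - (j - i))) = c i := by
      rw [show j + (k - (j - i)) = i + k by omega, h.per]
    have e2 := h.ear_one (s := j) (L := k - (j - i)) (x := d i) (by omega) (by omega)
      (fun l => hoff' i l (by omega)) (by rw [he]; exact (hcd j).symm)
      (by rw [hper]; exact (hcd i).symm)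
    have hj2 : j = i + 2 := by omega
    have hk4 : k = 4 := by omega
    subst hj2
    subst hk4
    refine hK (c i) (c (i + 2)) (c (i + 1)) (c (i + 3)) (d i) ?_ ?_ (hd1 i).symm
      (hoff' i _ (by omega)).symm (h.adj i) (hprev i) (hcd i) (h.adj (i + 1)).symm (h.adj (i + 2))
      (by rw [he]; exact hcd (i + 2))
    · intro he'
      have := h.inj i 0 2 (by omega) (by omega) he'
      omega
    · intro he'
      have := h.inj i 1 3 (by omega) (by omega) he'
      omega
  refine ⟨d, h4, ?_, ?_, ?_, ?_, hoff, ?_, ?_⟩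
  · intro i j hi hj he
    exact h.inj 0 i j hi hj (by simpa using he)
  · have := h.per 0
    rwa [Nat.zero_add] at this
  · intro i hi x
    rw [hd3 (i + 1) x, show i + 1 + k - 1 = i + k by omega, h.per]
    tauto
  · intro x
    rw [hd3 0 x, Nat.zero_add, Nat.zero_add]
  · intro i j hi hj he
    rcases lt_trichotomy i j with hij | hij | hij
    · exact (hdinj i j hij hj he).elim
    · exact hij
    · exact (hdinj j i hij hi he.symm).elim
  -- An edge between `d 0` and `d j` closes the arc of length `k - j` from `c j` on to `c k = c 0`,
  -- so `k ≤ k - j + 3`.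
  · intro j hj hadj
    by_cases hj0 : j = 0
    · omega
    have := h.ear_two (s := j) (L := k - j) (x := d j) (y := d 0) (by omega)
      (fun l => hoff' j l hj) (fun l => hoff' 0 l (by omega)) hadj.symm (hcd j).symm (by
        rw [Nat.add_sub_cancel' hj.le]
        have := h.per 0
        rw [Nat.zero_add] at this
        rw [this]
        exact (hcd 0).symm)
    omega

end ShortestCycle

lemma RootedCycle.degOn_d {k : ℕ} {c d : ℕ → V} (h : RootedCycle G k c d)
    (hd : ∀ v, G.degree v = 3) {j : ℕ} (hj : j < k) : degOn G (upTo k c 0) (d j) = 2 := by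
  have hk := h.four_le
  have hadj : G.Adj (d j) (c j) := by
    rcases j with _ | j
    · exact ((h.nbr_zero _).2 (by simp)).symm
    · exact ((h.nbr j hj _).2 (by simp)).symm
  have : G.neighborFinset (d j) ∩ upTo k c 0 = (G.neighborFinset (d j)).erase (c j) := by
    ext x
    rw [Finset.mem_inter, Finset.mem_erase, G.mem_neighborFinset, mem_upTo]
    constructor
    · rintro ⟨h1, h2⟩
      refine ⟨?_, h1⟩
      rintro rfl
      have := h2 j hj rfl
      omega
    · rintro ⟨h1, h2⟩
      refine ⟨h2, ?_⟩
      rintro l hl rfl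
      have := h.d_adj_c hj hl h2
      subst this
      exact (h1 rfl).elim
  unfold degOn
  rw [this, Finset.card_erase_of_mem (by simpa using hadj), G.card_neighborFinset_eq_degree, hd]

/-- Cubic graphs without triangles and without two vertices with three common neighbors. -/
lemma exists_full_of_no_small (hd : ∀ v, G.degree v = 3) (hc : ConnOn G Finset.univ)
    (htri : ∀ x y z, G.Adj x y → G.Adj y z → ¬ G.Adj x z)
    (hK : ∀ x x' a b e, x ≠ x' → a ≠ b → a ≠ e → b ≠ e → G.Adj x a → G.Adj x b → G.Adj x e →
      G.Adj x' a → G.Adj x' b → ¬ G.Adj x' e) : ∃ K, Ok G K ∧ Full G K := by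
  have hG : ∀ v, G.degree v ≤ 3 := fun v => (hd v).le
  obtain ⟨k, f, hf, -⟩ := exists_isCyc (G := G) (T := Finset.univ) hc.1 (by
    intro w _
    unfold degOn
    rw [Finset.inter_univ, G.card_neighborFinset_eq_degree, hd]
    norm_num)
  obtain ⟨k, c, hsc⟩ := exists_shortestCycle ⟨k, f, hf⟩
  obtain ⟨d, h⟩ := hsc.exists_rootedCycle hd htri hK
  have hk := h.four_le
  have hlight : Light G (upTo k c 0) := light_sdiff hG hc
    ⟨c 0, Finset.mem_image.2 ⟨0, by simp; omega, rfl⟩⟩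
  -- A cycle component through `d 0` consists of vertices `d j` and contains a cycle, so it has at
  -- least `k` vertices. It therefore contains every `d j`, in particular the exempt `d 2`.
  obtain ⟨K, hok, hcov, h0, hle⟩ := hlight.exists_root_exempt hG (r := d 0) (s := d 2)
    (h.d_mem (by omega)) (h.degOn_d hd (by omega)).le (h.d_ne (by omega) (by omega) (by omega)) (by
      intro T hT0 hT
      have hsub : T ⊆ (Finset.range k).image d := by
        intro w hw
        obtain ⟨x, hx, hwx⟩ := CycleComponent.exists_adj hd hT hw
        have hwS := hT.sub hw
        rw [mem_upTo] at hwS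
        rw [Finset.mem_image] at hx
        obtain ⟨j, hj, rfl⟩ := hx
        rw [Finset.mem_filter, Finset.mem_range] at hj
        have hjk := hj.1
        have hoff : ∀ l, l < k → w ≠ c l := fun l hl he => by
          have := hwS l hl he.symm
          omega
        rw [Finset.mem_image]
        refine ⟨j, Finset.mem_range.2 hjk, ?_⟩
        rcases j with _ | j
        · rcases (h.nbr_zero w).1 hwx.symm with H | H | H
          · exact (hoff 1 (by omega) H).elim
          · exact (hoff _ (by omega) H).elim
          · exact H.symm
        · rcases (h.nbr j hjk w).1 hwx.symm with H | H | H
          · exact (hoff j (by omega) H).elim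
          · by_cases hj2 : j + 2 = k
            · rw [hj2, h.per] at H
              exact (hoff 0 (by omega) H).elim
            · exact (hoff _ (by omega) H).elim
          · exact H.symm
      obtain ⟨k', f', hf', hk'⟩ := exists_isCyc (G := G) hT.conn.1 (fun w hw => by
        rw [degOn_congr_of_closed hT.sub hT.closed hw, hT.deg w hw])
      have h1 := hsc.min k' f' hf'
      have h2 : ((Finset.range k).image d).card ≤ k :=
        Finset.card_image_le.trans (Finset.card_range k).le
      rw [Finset.eq_of_subset_of_card_le hsub (by omega)]
      exact Finset.mem_image.2 ⟨2, by simp; omega, rfl⟩)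
  obtain ⟨K', hK'⟩ := h.exists_stage hG hok hcov h0 (fun j hj hj2 =>
    hle (d j) (h.d_mem hj) (h.d_ne hj (by omega) hj2) (h.degOn_d hd hj))
  exact exists_full_of_stage hG h hK'

end ShortestCycle

end SemistrongColoring

namespace SemistrongColoring

/-! ### Case analysis for simple graphs -/

section Core

set_option linter.unusedSectionVars false

variable {V : Type*} [Fintype V] [DecidableEq V] {G : SimpleGraph V} [DecidableRel G.Adj]

lemma adj_iff_of_degree {v a b e : V} (hd : G.degree v = 3) (ha : G.Adj v a) (hb : G.Adj v b)
    (he : G.Adj v e) (hab : a ≠ b) (hae : a ≠ e) (hbe : b ≠ e) (x : V) :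
    G.Adj v x ↔ x = a ∨ x = b ∨ x = e := by
  obtain ⟨f, hfa, hfb, hf⟩ := exists_third hd ha hb hab
  have : e = f := by
    rcases (hf e).1 he with h | h | h
    exacts [(hae h.symm).elim, (hbe h.symm).elim, h]
  rw [this]
  exact hf x

/-- Two triangles with a common edge. -/
lemma exists_full_of_two_triangles (hd : ∀ v, G.degree v = 3) (hc : ConnOn G Finset.univ)
    {u v c₁ c₂ : V} (huv : G.Adj u v) (hu₁ : G.Adj u c₁) (hu₂ : G.Adj u c₂) (hv₁ : G.Adj v c₁)
    (hv₂ : G.Adj v c₂) (hne : c₁ ≠ c₂) : ∃ K, Ok G K ∧ Full G K := by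
  have hG : ∀ v, G.degree v ≤ 3 := fun v => (hd v).le
  have hu := adj_iff_of_degree (hd u) huv hu₁ hu₂ hv₁.ne hv₂.ne hne
  have hv := adj_iff_of_degree (hd v) huv.symm hv₁ hv₂ hu₁.ne hu₂.ne hne
  obtain ⟨p₁, n1, n2, hc₁⟩ := exists_third (hd c₁) hu₁.symm hv₁.symm huv.ne
  obtain ⟨p₂, n3, n4, hc₂⟩ := exists_third (hd c₂) hu₂.symm hv₂.symm huv.ne
  have m1 : p₁ ≠ c₁ := ((hc₁ p₁).2 (by simp)).ne'
  have m2 : p₂ ≠ c₂ := ((hc₂ p₂).2 (by simp)).ne'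
  have iff1 : p₁ = c₂ ↔ p₂ = c₁ := by
    constructor
    · rintro rfl
      rcases (hc₂ c₁).1 ((hc₁ p₁).2 (by simp)).symm with h | h | h
      exacts [(hu₁.ne' h).elim, (hv₁.ne' h).elim, h.symm]
    · rintro rfl
      rcases (hc₁ c₂).1 ((hc₂ p₂).2 (by simp)).symm with h | h | h
      exacts [(hu₂.ne' h).elim, (hv₂.ne' h).elim, h.symm]
  by_cases h : p₁ = c₂
  · have h' := iff1.1 h
    subst h
    subst h'
    exact exists_full_of_complete hG hc hu hv hc₁ hc₂
  · have h' : p₂ ≠ c₁ := fun h' => h (iff1.2 h')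
    exact exists_full_of_diamond hG hc hne hu hv hc₁ hc₂ (by simp [n1, n2, m1, h])
      (by simp [n3, n4, m2, h'])

/-- If two vertices of the triangle share their third neighbor, there are two triangles with a
common edge; otherwise the third neighbors are distinct. -/
lemma exists_full_of_exists_triangle (hd : ∀ v, G.degree v = 3) (hc : ConnOn G Finset.univ)
    {r y₁ y₂ : V} (h1 : G.Adj r y₁) (h2 : G.Adj r y₂) (h12 : G.Adj y₁ y₂) :
    ∃ K, Ok G K ∧ Full G K := by
  obtain ⟨d₀, a1, a2, hr⟩ := exists_third (hd r) h1 h2 h12.ne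
  obtain ⟨d₁, b1, b2, hy₁⟩ := exists_third (hd y₁) h1.symm h12 h2.ne
  obtain ⟨d₂, e1, e2, hy₂⟩ := exists_third (hd y₂) h2.symm h12.symm h1.ne
  have hrd : G.Adj r d₀ := (hr d₀).2 (by simp)
  have hyd₁ : G.Adj y₁ d₁ := (hy₁ d₁).2 (by simp)
  have hyd₂ : G.Adj y₂ d₂ := (hy₂ d₂).2 (by simp)
  by_cases h01 : d₀ = d₁
  · subst h01
    exact exists_full_of_two_triangles hd hc h1 h2 hrd h12 hyd₁ a2.symm
  by_cases h02 : d₀ = d₂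
  · subst h02
    exact exists_full_of_two_triangles hd hc h2 h1 hrd h12.symm hyd₂ a1.symm
  by_cases h12' : d₁ = d₂
  · subst h12'
    exact exists_full_of_two_triangles hd hc h12 h1.symm hyd₁ h2.symm hyd₂ b1.symm
  exact exists_full_of_triangle hd hc hr hy₁ hy₂ h01 h02 h12'
    (by simp [a1, a2, hrd.symm.ne]) (by simp [b1, b2, hyd₁.symm.ne])
    (by simp [e1, e2, hyd₂.symm.ne])

/-- A connected cubic graph in which three vertices have the same three neighbors. -/
lemma nonempty_iso_of_common_neighbors (hc : ConnOn G Finset.univ)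
    {x x' p c₁ c₂ c₃ : V} (h12 : c₁ ≠ c₂) (h13 : c₁ ≠ c₃) (h23 : c₂ ≠ c₃) (hxx : x ≠ x')
    (hxp : x ≠ p) (hxp' : x' ≠ p)
    (hx : ∀ w, G.Adj x w ↔ w = c₁ ∨ w = c₂ ∨ w = c₃)
    (hx' : ∀ w, G.Adj x' w ↔ w = c₁ ∨ w = c₂ ∨ w = c₃)
    (hp : ∀ w, G.Adj p w ↔ w = c₁ ∨ w = c₂ ∨ w = c₃)
    (hc₁ : ∀ w, G.Adj c₁ w ↔ w = x ∨ w = x' ∨ w = p)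
    (hc₂ : ∀ w, G.Adj c₂ w ↔ w = x ∨ w = x' ∨ w = p)
    (hc₃ : ∀ w, G.Adj c₃ w ↔ w = x ∨ w = x' ∨ w = p) :
    Nonempty (G ≃g completeBipartiteGraph (Fin 3) (Fin 3)) := by
  have hL : ∀ i : Fin 3, ∀ w, G.Adj ((![x, x', p] : Fin 3 → V) i) w ↔
      ∃ j, w = (![c₁, c₂, c₃] : Fin 3 → V) j := by
    intro i w
    fin_cases i <;> simp [hx, hx', hp, Fin.exists_fin_succ]
  have hR : ∀ i : Fin 3, ∀ w, G.Adj ((![c₁, c₂, c₃] : Fin 3 → V) i) w ↔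
      ∃ j, w = (![x, x', p] : Fin 3 → V) j := by
    intro i w
    fin_cases i <;> simp [hc₁, hc₂, hc₃, Fin.exists_fin_succ]
  have hLR : ∀ i j, (![x, x', p] : Fin 3 → V) i ≠ (![c₁, c₂, c₃] : Fin 3 → V) j := by
    intro i j
    exact ((hL i _).2 ⟨j, rfl⟩).ne
  have iL : Function.Injective (![x, x', p] : Fin 3 → V) := by
    intro i j h
    fin_cases i <;> fin_cases j <;> simp_all
  have iR : Function.Injective (![c₁, c₂, c₃] : Fin 3 → V) := by
    intro i j h
    fin_cases i <;> fin_cases j <;> simp_all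
  have hbij : Function.Bijective (Sum.elim ![x, x', p] ![c₁, c₂, c₃] : Fin 3 ⊕ Fin 3 → V) := by
    refine ⟨?_, ?_⟩
    · rintro (i | i) (j | j) h
      · exact congrArg _ (iL h)
      · exact (hLR i j h).elim
      · exact (hLR j i h.symm).elim
      · exact congrArg _ (iR h)
    · have := hc.2 (Finset.univ.image (Sum.elim ![x, x', p] ![c₁, c₂, c₃] : Fin 3 ⊕ Fin 3 → V))
        (Finset.subset_univ _) ⟨x, Finset.mem_image.2 ⟨Sum.inl 0, Finset.mem_univ _, rfl⟩⟩ (by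
          intro a ha b _ hab
          rw [Finset.mem_image] at ha ⊢
          obtain ⟨i | i, -, rfl⟩ := ha
          · obtain ⟨j, rfl⟩ := (hL i b).1 hab
            exact ⟨Sum.inr j, Finset.mem_univ _, rfl⟩
          · obtain ⟨j, rfl⟩ := (hR i b).1 hab
            exact ⟨Sum.inl j, Finset.mem_univ _, rfl⟩)
      intro v
      have hv : v ∈ Finset.univ.image
          (Sum.elim ![x, x', p] ![c₁, c₂, c₃] : Fin 3 ⊕ Fin 3 → V) := by
        rw [this]; exact Finset.mem_univ v
      obtain ⟨i, -, hi⟩ := Finset.mem_image.1 hv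
      exact ⟨i, hi⟩
  refine ⟨(⟨Equiv.ofBijective _ hbij, ?_⟩ : completeBipartiteGraph (Fin 3) (Fin 3) ≃g G).symm⟩
  rintro (i | i) (j | j)
  · simp only [Equiv.ofBijective_apply, Sum.elim_inl, completeBipartiteGraph_adj, hL]
    simp [hLR]
  · simp only [Equiv.ofBijective_apply, Sum.elim_inl, Sum.elim_inr, completeBipartiteGraph_adj, hL]
    simp
  · simp only [Equiv.ofBijective_apply, Sum.elim_inl, Sum.elim_inr, completeBipartiteGraph_adj, hR]
    simp
  · simp only [Equiv.ofBijective_apply, Sum.elim_inr, completeBipartiteGraph_adj, hR]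
    simp [fun i j => (hLR i j).symm]

/-- If the third neighbors of `c₁`, `c₂`, `c₃` coincide, connectedness makes the graph `K_{3,3}`.
Otherwise one of them differs from `p₁`, and after relabeling it plays the role of `p₃`. -/
lemma exists_full_of_common_neighbors (hd : ∀ v, G.degree v = 3) (hc : ConnOn G Finset.univ)
    (htri : ∀ x y z, G.Adj x y → G.Adj y z → ¬ G.Adj x z)
    (hK : ¬ Nonempty (G ≃g completeBipartiteGraph (Fin 3) (Fin 3)))
    {x x' c₁ c₂ c₃ : V} (hxx : x ≠ x') (h12 : c₁ ≠ c₂) (h13 : c₁ ≠ c₃) (h23 : c₂ ≠ c₃)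
    (a1 : G.Adj x c₁) (a2 : G.Adj x c₂) (a3 : G.Adj x c₃) (b1 : G.Adj x' c₁) (b2 : G.Adj x' c₂)
    (b3 : G.Adj x' c₃) : ∃ K, Ok G K ∧ Full G K := by
  have hG : ∀ v, G.degree v ≤ 3 := fun v => (hd v).le
  have hx := adj_iff_of_degree (hd x) a1 a2 a3 h12 h13 h23
  have hx' := adj_iff_of_degree (hd x') b1 b2 b3 h12 h13 h23
  obtain ⟨p₁, m1, m2, hc₁⟩ := exists_third (hd c₁) a1.symm b1.symm hxx
  obtain ⟨p₂, n1, n2, hc₂⟩ := exists_third (hd c₂) a2.symm b2.symm hxx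
  obtain ⟨p₃, o1, o2, hc₃⟩ := exists_third (hd c₃) a3.symm b3.symm hxx
  have ap₁ : G.Adj c₁ p₁ := (hc₁ p₁).2 (by simp)
  have ap₂ : G.Adj c₂ p₂ := (hc₂ p₂).2 (by simp)
  have ap₃ : G.Adj c₃ p₃ := (hc₃ p₃).2 (by simp)
  have hoff : ∀ {c p}, G.Adj x c → G.Adj c p → p ≠ c₁ ∧ p ≠ c₂ ∧ p ≠ c₃ := by
    intro c p hxc hcp
    refine ⟨?_, ?_, ?_⟩ <;> rintro rfl
    exacts [htri _ _ _ hxc hcp a1, htri _ _ _ hxc hcp a2, htri _ _ _ hxc hcp a3]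
  have f1 := hoff a1 ap₁
  have f2 := hoff a2 ap₂
  have f3 := hoff a3 ap₃
  by_cases h : p₁ = p₃
  · by_cases h' : p₁ = p₂
    · exfalso
      apply hK
      subst h
      subst h'
      exact nonempty_iso_of_common_neighbors hc h12 h13 h23 hxx m1.symm m2.symm hx hx'
        (adj_iff_of_degree (hd p₁) ap₁.symm ap₂.symm ap₃.symm h12 h13 h23) hc₁ hc₂ hc₃
    · exact exists_full_of_bipartite hG hc h13 h12 h23.symm hxx
        (fun w => (hx w).trans (by tauto)) (fun w => (hx' w).trans (by tauto)) hc₁ hc₃ hc₂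
        (by simp [m1, m2, f1]) (by simp [o1, o2, f3]) (by simp [n1, n2, f2]) h'
  · exact exists_full_of_bipartite hG hc h12 h13 h23 hxx hx hx' hc₁ hc₂ hc₃
      (by simp [m1, m2, f1]) (by simp [n1, n2, f2]) (by simp [o1, o2, f3]) h

/-- Every connected subcubic simple graph other than `K_{3,3}` has a valid coloring of all its
edges by eight colors. -/
theorem exists_full (hG : ∀ v, G.degree v ≤ 3) (hconn : G.Connected)
    (hK : (∀ v, G.degree v = 3) → ¬ Nonempty (G ≃g completeBipartiteGraph (Fin 3) (Fin 3))) :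
    ∃ K, Ok G K ∧ Full G K := by
  have hc := connOn_univ hconn
  by_cases hd : ∀ v, G.degree v = 3
  · by_cases htri : ∀ x y z, G.Adj x y → G.Adj y z → ¬ G.Adj x z
    · by_cases hcom : ∀ x x' a b e, x ≠ x' → a ≠ b → a ≠ e → b ≠ e → G.Adj x a → G.Adj x b →
        G.Adj x e → G.Adj x' a → G.Adj x' b → ¬ G.Adj x' e
      · exact exists_full_of_no_small hd hc htri hcom
      · push Not at hcom
        obtain ⟨x, x', a, b, e, h1, h2, h3, h4, h5, h6, h7, h8, h9, h10⟩ := hcom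
        exact exists_full_of_common_neighbors hd hc htri (hK hd) h1 h2 h3 h4 h5 h6 h7 h8 h9 h10
    · push Not at htri
      obtain ⟨x, y, z, h1, h2, h3⟩ := htri
      exact exists_full_of_exists_triangle hd hc h1 h3 h2
  -- A vertex of degree at most two roots the whole graph. Whether the root stays free is irrelevant
  -- here.
  · push Not at hd
    obtain ⟨v, hv⟩ := hd
    have hdv : degOn G Finset.univ v ≤ 2 := by
      have h1 := degOn_le_degree (G := G) Finset.univ v
      have h2 := hG v
      omega
    obtain ⟨K, hgood, -⟩ := exists_good hG Finset.univ v (Finset.mem_univ v) hc hdv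
    exact ⟨K, hgood.ok, fun x y hxy => (hgood.cov x y).2 ⟨hxy, Finset.mem_univ _, Finset.mem_univ _⟩⟩

end Core

end SemistrongColoring

namespace SemistrongColoring

/-! ### From the underlying simple graph to the multigraph -/

section Multigraph

open scoped Graph

variable {α β : Type*} {G : Graph α β}

variable (G) in
/-- A coloring of the edges in `A` with a designated end of every edge. -/
structure IsPartial (A : Set β) (col : β → Fin 8) (des : β → α) : Prop where
  inc : ∀ e ∈ A, G.Inc e (des e)
  proper : ∀ e ∈ A, ∀ f ∈ A, e ≠ f → col e = col f → ∀ x, ¬ (G.Inc e x ∧ G.Inc f x)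
  far : ∀ e ∈ A, ∀ f ∈ A, e ≠ f → col e = col f → ∀ w, G.Inc f w → ¬ G.Adj (des e) w

/-- A partial coloring of all edges is a semistrong coloring. -/
lemma IsPartial.isSemistrongColoring (hl : G.Loopless) {col : β → Fin 8} {des : β → α}
    (h : IsPartial G E(G) col des) :
    IsSemistrongColoring G (fun e : E(G) => col e) := by
  have hmem : ∀ i e, e ∈ colorClass G (fun e : E(G) => col e) i ↔ e ∈ E(G) ∧ col e = i := by
    intro i e
    simp [colorClass]
  intro i
  refine ⟨⟨fun e he => ((hmem i e).1 he).1, ?_⟩, ?_⟩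
  · intro e he f hf hef x
    rw [hmem] at he hf
    exact h.proper e he.1 f hf.1 hef (he.2.trans hf.2.symm) x
  · intro e he
    have he' := (hmem i e).1 he
    have hinc := h.inc e he'.1
    refine ⟨des e, hinc, ?_⟩
    obtain ⟨y, hy⟩ := hinc
    have : {z | z ∈ endSet G (colorClass G (fun e : E(G) => col e) i) ∧ des e ≠ z ∧
        G.Adj (des e) z} = {y} := by
      ext z
      simp only [Set.mem_ofPred_eq, Set.mem_singleton_iff]
      constructor
      · rintro ⟨⟨f, hf, hfz⟩, hne, hadj⟩
        have hf' := (hmem i f).1 hf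
        by_cases hef : e = f
        · subst hef
          rcases hfz.eq_or_eq_of_isLink hy with h' | h'
          · exact (hne h'.symm).elim
          · exact h'
        · exact (h.far e he'.1 f hf'.1 hef (he'.2.trans hf'.2.symm) z hfz hadj).elim
      · rintro rfl
        exact ⟨⟨e, he, hy.inc_right⟩, hy.ne, hy.adj⟩
    rw [inducedDegree, this, Set.encard_singleton]

lemma exists_inc_finset (hdeg : maxDegree G ≤ 3) (x : α) :
    ∃ B : Finset β, B.card ≤ 3 ∧ ∀ e, e ∈ B ↔ G.Inc e x := by
  by_cases hx : x ∈ V(G)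
  · have h1 : {e | G.Inc e x}.encard ≤ 3 :=
      (le_self_add).trans ((le_iSup₂ (f := fun x (_ : x ∈ V(G)) => degree G x) x hx).trans hdeg)
    have hfin : {e | G.Inc e x}.Finite := Set.finite_of_encard_le_coe (k := 3) h1
    refine ⟨hfin.toFinset, ?_, fun e => by simp⟩
    rw [hfin.encard_eq_coe_toFinset_card] at h1
    exact_mod_cast h1
  · exact ⟨∅, by simp, fun e => ⟨by simp, fun h => (hx h.vertex_mem).elim⟩⟩

/-- The edges that meet the third edge at an end of a pair of parallel edges. -/
lemma exists_third_finset (hdeg : maxDegree G ≤ 3) {x : α} {e e' : β} (hee : e ≠ e')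
    (he : G.Inc e x) (he' : G.Inc e' x) :
    ∃ B : Finset β, B.card ≤ 3 ∧ ∀ g, G.Inc g x → g ≠ e → g ≠ e' → g ∈ B ∧
      ∀ w, G.Inc g w → w ≠ x → ∀ f, G.Inc f w → f ∈ B := by
  classical
  obtain ⟨A, hA, hmem⟩ := exists_inc_finset hdeg x
  have hc : ((A.erase e).erase e').card ≤ 1 := by
    rw [Finset.card_erase_of_mem, Finset.card_erase_of_mem]
    · omega
    · rwa [hmem]
    · rw [Finset.mem_erase, hmem]
      exact ⟨hee.symm, he'⟩
  have huniq := Finset.card_le_one.1 hc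
  by_cases hg : ∃ g, G.Inc g x ∧ g ≠ e ∧ g ≠ e'
  · obtain ⟨g, hgx, hge, hge'⟩ := hg
    obtain ⟨y, hy⟩ := id hgx
    obtain ⟨B, hB, hBm⟩ := exists_inc_finset hdeg y
    refine ⟨B, hB, fun g' h1 h2 h3 => ?_⟩
    have : g' = g := huniq g' (by simp [hmem, h1, h2, h3]) g (by simp [hmem, hgx, hge, hge'])
    subst this
    refine ⟨(hBm _).2 hy.inc_right, fun w hw hwx f hf => ?_⟩
    rcases hw.eq_or_eq_of_isLink hy with h' | h'
    · exact (hwx h').elim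
    · subst h'
      exact (hBm f).2 hf
  · push Not at hg
    exact ⟨∅, by simp, fun g h1 h2 h3 => (h3 (hg g h1 h2)).elim⟩

/-- A further edge that is parallel to a colored one can be colored. -/
lemma IsPartial.exists_insert (hdeg : maxDegree G ≤ 3) {A : Set β}
    {col : β → Fin 8} {des : β → α} (h : IsPartial G A col des) {e e' : β}
    (heA : e ∉ A) (hee : e ≠ e') {x y : α} (he : G.IsLink e x y)
    (he' : G.IsLink e' x y) : ∃ col' des', IsPartial G (insert e A) col' des' := by
  classical
  obtain ⟨B, hB, hBm⟩ := exists_third_finset hdeg hee he.inc_left he'.inc_left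
  obtain ⟨C, hC, hCm⟩ := exists_third_finset hdeg hee he.inc_right he'.inc_right
  -- An edge that can conflict with `e` meets `x` or `y`, or the far end of the third edge at `x` or
  -- `y`.
  have hnear : ∀ f, f ≠ e → ∀ z w, G.Inc e z → G.Inc f w → (z = w ∨ G.Adj z w) →
      f ∈ insert e' (B ∪ C) := by
    have hx : ∀ f, f ≠ e → G.Inc f x → f ∈ insert e' (B ∪ C) := by
      intro f hf hfx
      by_cases hfe : f = e'
      · simp [hfe]
      · simp [(hBm f hfx hf hfe).1]
    have hy : ∀ f, f ≠ e → G.Inc f y → f ∈ insert e' (B ∪ C) := by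
      intro f hf hfy
      by_cases hfe : f = e'
      · simp [hfe]
      · simp [(hCm f hfy hf hfe).1]
    intro f hf z w hz hw hzw
    by_cases hwx : w = x
    · exact hx f hf (hwx ▸ hw)
    by_cases hwy : w = y
    · exact hy f hf (hwy ▸ hw)
    have hz' := hz.eq_or_eq_of_isLink he
    rcases hzw with rfl | ⟨g, hg⟩
    · exact (hz'.elim hwx hwy).elim
    · have hge : ∀ p, G.IsLink p x y → g ≠ p := by
        rintro p hp rfl
        exact (hg.inc_right.eq_or_eq_of_isLink hp).elim hwx hwy
      rcases hz' with rfl | rfl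
      · have := (hBm g hg.inc_left (hge e he) (hge e' he')).2 w hg.inc_right hwx f hw
        simp [this]
      · have := (hCm g hg.inc_left (hge e he) (hge e' he')).2 w hg.inc_right hwy f hw
        simp [this]
  -- These are at most 1 + 3 + 3 edges, so `e` may be designated at either end.
  obtain ⟨a, ha⟩ := exists_notMem_of_card_le (F := (insert e' (B ∪ C)).image col) (by
    have h1 := Finset.card_image_le (s := insert e' (B ∪ C)) (f := col)
    have h2 := Finset.card_insert_le e' (B ∪ C)
    have h3 := Finset.card_union_le B C
    omega)
  have hfar : ∀ f, f ≠ e → col f = a → ∀ z w, G.Inc e z → G.Inc f w → ¬ (z = w ∨ G.Adj z w) :=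
    fun f hf hfa z w hz hw hzw =>
      ha (hfa ▸ Finset.mem_image_of_mem col (hnear f hf z w hz hw hzw))
  have hne : ∀ f ∈ A, f ≠ e := fun f hf hfe => heA (hfe ▸ hf)
  refine ⟨Function.update col e a, Function.update des e x, ?_, ?_, ?_⟩
  · intro f hf
    by_cases hfe : f = e
    · subst hfe
      simpa using he.inc_left
    · rw [Function.update_of_ne hfe]
      exact h.inc f (hf.resolve_left hfe)
  · intro f hf g hg hfg hcol z hz
    by_cases hfe : f = e
    · subst hfe
      rw [Function.update_self, Function.update_of_ne hfg.symm] at hcol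
      exact hfar g hfg.symm hcol.symm z z hz.1 hz.2 (Or.inl rfl)
    · by_cases hge : g = e
      · subst hge
        rw [Function.update_self, Function.update_of_ne hfg] at hcol
        exact hfar f hfg hcol z z hz.2 hz.1 (Or.inl rfl)
      · rw [Function.update_of_ne hfe, Function.update_of_ne hge] at hcol
        exact h.proper f (hf.resolve_left hfe) g (hg.resolve_left hge) hfg hcol z hz
  · intro f hf g hg hfg hcol w hw hadj
    by_cases hfe : f = e
    · subst hfe
      rw [Function.update_self, Function.update_of_ne hfg.symm] at hcol
      rw [Function.update_self] at hadj
      exact hfar g hfg.symm hcol.symm x w he.inc_left hw (Or.inr hadj)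
    · rw [Function.update_of_ne hfe] at hadj
      by_cases hge : g = e
      · subst hge
        rw [Function.update_self, Function.update_of_ne hfg] at hcol
        exact hfar f hfg hcol w (des f) hw (h.inc f (hf.resolve_left hfe)) (Or.inr hadj.symm)
      · rw [Function.update_of_ne hfe, Function.update_of_ne hge] at hcol
        exact h.far f (hf.resolve_left hfe) g (hg.resolve_left hge) hfg hcol w hw hadj

/-- A partial coloring of a set of representatives for the classes of parallel edges extends to
all edges. -/
lemma IsPartial.exists_extend (hdeg : maxDegree G ≤ 3) (hV : V(G).Finite) {A : Set β}
    (hAE : A ⊆ E(G)) {col : β → Fin 8} {des : β → α} (h : IsPartial G A col des)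
    (hrep : ∀ e x y, G.IsLink e x y → ∃ e' ∈ A, G.IsLink e' x y) :
    ∃ col' des', IsPartial G E(G) col' des' := by
  classical
  have hE : E(G).Finite := by
    choose B _ hB using fun x => exists_inc_finset hdeg x
    refine (hV.biUnion fun x _ => (B x).finite_toSet).subset fun e he => ?_
    obtain ⟨x, y, hxy⟩ := Graph.exists_isLink_of_mem_edgeSet he
    simp only [Set.mem_iUnion]
    exact ⟨x, hxy.left_mem, (hB x e).2 hxy.inc_left⟩
  have key : ∀ B : Finset β, (B : Set β) ⊆ E(G) → ∃ col' des', IsPartial G (A ∪ B) col' des' := by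
    intro B
    induction B using Finset.induction_on with
    | empty => exact fun _ => ⟨col, des, by simpa using h⟩
    | insert e B heB ih =>
      intro hB
      rw [Finset.coe_insert, Set.insert_subset_iff] at hB
      obtain ⟨col', des', h'⟩ := ih hB.2
      rw [Finset.coe_insert, Set.union_insert]
      by_cases he : e ∈ A ∪ (B : Set β)
      · rw [Set.insert_eq_of_mem he]
        exact ⟨col', des', h'⟩
      · obtain ⟨x, y, hxy⟩ := Graph.exists_isLink_of_mem_edgeSet hB.1
        obtain ⟨e', he', hxy'⟩ := hrep e x y hxy
        have hne : e ≠ e' := by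
          rintro rfl
          exact he (Or.inl he')
        exact h'.exists_insert hdeg he hne hxy hxy'
  simpa [Set.union_eq_self_of_subset_left hAE] using key hE.toFinset (by simp)

/-- A valid coloring of the underlying simple graph gives a semistrong coloring. -/
lemma exists_isPartial_of_full [Nonempty V(G)] (hl : G.Loopless)
    {K : V(G) → V(G) → Fin 8 → Prop} (hK : Ok G.toSimpleGraph K) (hF : Full G.toSimpleGraph K) :
    ∃ A ⊆ E(G), ∃ col des, IsPartial G A col des ∧
      ∀ e x y, G.IsLink e x y → ∃ e' ∈ A, G.IsLink e' x y := by
  classical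
  -- One edge from each class of parallel edges, the classes being told apart by their sets of ends.
  obtain ⟨A, hAE, hbij⟩ := Set.exists_subset_bijOn E(G) (fun e => {x | G.Inc e x})
  have hends : ∀ e f u v, G.IsLink e u v → G.IsLink f u v → {x | G.Inc e x} = {x | G.Inc f x} := by
    intro e f u v he hf
    ext x
    constructor
    · intro hx
      rcases Graph.Inc.eq_or_eq_of_isLink hx he with rfl | rfl
      exacts [hf.inc_left, hf.inc_right]
    · intro hx
      rcases Graph.Inc.eq_or_eq_of_isLink hx hf with rfl | rfl
      exacts [he.inc_left, he.inc_right]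
  have hpar : ∀ e ∈ A, ∀ f ∈ A, ∀ u v, G.IsLink e u v → G.IsLink f u v → e = f :=
    fun e he f hf u v heu hfu => hbij.injOn he hf (hends e f u v heu hfu)
  have hcol : ∀ e ∈ E(G), ∃ (u v : V(G)) (a : Fin 8), G.IsLink e u v ∧ K u v a := by
    intro e he
    obtain ⟨x, y, hxy⟩ := Graph.exists_isLink_of_mem_edgeSet he
    have hadj : G.toSimpleGraph.Adj ⟨x, hxy.left_mem⟩ ⟨y, hxy.right_mem⟩ :=
      (Graph.toSimpleGraph_adj_iff _ _).2 hxy.adj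
    obtain ⟨a, ha | ha⟩ := hF _ _ hadj
    · exact ⟨_, _, a, hxy, ha⟩
    · exact ⟨_, _, a, hxy.symm, ha⟩
  choose! u v a hlink hKa using hcol
  refine ⟨A, hAE, a, fun e => (v e : α), ⟨?_, ?_, ?_⟩, ?_⟩
  · exact fun e he => (hlink e (hAE he)).inc_right
  · intro e he f hf hef hcol x hx
    have le := hlink e (hAE he)
    have lf := hlink f (hAE hf)
    have ke : Col K (u e) (v e) (a e) := Or.inl (hKa e (hAE he))
    have kf : Col K (u f) (v f) (a e) := hcol ▸ Or.inl (hKa f (hAE hf))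
    have key : ∀ x y y' : V(G), Col K x y (a e) → Col K x y' (a e) → G.IsLink e x y →
        G.IsLink f x y' → False := by
      intro x y y' h1 h2 h3 h4
      obtain rfl := hK.proper h1 h2
      exact hef (hpar e he f hf _ _ h3 h4)
    rcases hx.1.eq_or_eq_of_isLink le with h1 | h1 <;>
      rcases hx.2.eq_or_eq_of_isLink lf with h2 | h2 <;>
      have h3 := Subtype.ext (h1.symm.trans h2)
    · rw [h3] at ke le
      exact key _ _ _ ke kf le lf
    · rw [h3] at ke le
      exact key _ _ _ ke kf.symm le lf.symm
    · rw [h3] at ke le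
      exact key _ _ _ ke.symm kf le.symm lf
    · rw [h3] at ke le
      exact key _ _ _ ke.symm kf.symm le.symm lf.symm
  · intro e he f hf hef hcol w hw hadj
    have le := hlink e (hAE he)
    have ke := hKa e (hAE he)
    have hfw : ∃ z : V(G), G.IsLink f w z ∧ ∃ hwV : w ∈ V(G), Col K ⟨w, hwV⟩ z (a e) := by
      have lf := hlink f (hAE hf)
      have kf : Col K (u f) (v f) (a e) := hcol ▸ Or.inl (hKa f (hAE hf))
      rcases hw.eq_or_eq_of_isLink lf with rfl | rfl
      · exact ⟨v f, lf, (u f).2, kf⟩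
      · exact ⟨u f, lf.symm, (v f).2, kf.symm⟩
    obtain ⟨z, hlz, hwV, hcz⟩ := hfw
    have hadj' : G.toSimpleGraph.Adj (v e) ⟨w, hwV⟩ := (Graph.toSimpleGraph_adj_iff _ _).2 hadj
    by_cases hwu : (⟨w, hwV⟩ : V(G)) = u e
    · rw [hwu] at hcz
      obtain rfl := hK.proper (Or.inl ke) hcz
      have hw' : w = u e := congrArg Subtype.val hwu
      rw [hw'] at hlz
      exact hef (hpar e he f hf _ _ le hlz)
    · exact hK.des ke hadj' hwu hcz
  · intro e x y hxy
    obtain ⟨e', he', heq⟩ := hbij.surjOn ⟨e, hxy.edge_mem, rfl⟩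
    have heq' : {z | G.Inc e' z} = {z | G.Inc e z} := heq
    refine ⟨e', he', ?_⟩
    obtain ⟨x', y', hxy'⟩ := Graph.exists_isLink_of_mem_edgeSet (hAE he')
    have hx : G.Inc e' x := by
      have : x ∈ {x | G.Inc e x} := hxy.inc_left
      rwa [← heq'] at this
    have hy : G.Inc e' y := by
      have : y ∈ {x | G.Inc e x} := hxy.inc_right
      rwa [← heq'] at this
    have hne := hxy.ne
    rcases hx.eq_or_eq_of_isLink hxy' with rfl | rfl <;>
      rcases hy.eq_or_eq_of_isLink hxy' with rfl | rfl
    · exact (hne rfl).elim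
    · exact hxy'
    · exact hxy'.symm
    · exact (hne rfl).elim

/-- A vertex with three distinct neighbors meets no parallel edges. So if the underlying graph is
cubic, then `G` is simple, and excluding `K_{3,3}` for `G` excludes it for the underlying graph. -/
theorem semistrongChromaticIndex_le_eight (hl : G.Loopless) (hV : V(G).Finite)
    (hconn : G.toSimpleGraph.Connected) (hdeg : maxDegree G ≤ 3) (hK : ¬ IsK33 G) :
    semistrongChromaticIndex G ≤ 8 := by
  classical
  have := hV.fintype
  have := hconn.nonempty
  have hdeg' : ∀ x, G.toSimpleGraph.degree x ≤ 3 ∧ (G.toSimpleGraph.degree x = 3 →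
      ∀ e f (y : V(G)), G.IsLink e x y → G.IsLink f x y → e = f) := by
    intro x
    obtain ⟨B, hB, hBm⟩ := exists_inc_finset hdeg (x : α)
    by_cases hd : G.toSimpleGraph.degree x = 0
    · simp [hd]
    obtain ⟨y₀, hy₀⟩ : ∃ y, G.toSimpleGraph.Adj x y := by
      by_contra! hcon
      apply hd
      rw [← G.toSimpleGraph.card_neighborFinset_eq_degree, Finset.card_eq_zero,
        Finset.eq_empty_iff_forall_notMem]
      simpa using hcon
    have h : ∀ y : V(G), G.toSimpleGraph.Adj x y → ∃ e : β, G.IsLink e x y := fun y hy => hy.2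
    have : Nonempty β := ⟨(h y₀ hy₀).choose⟩
    choose! t ht using h
    have hinj : Set.InjOn t (G.toSimpleGraph.neighborFinset x) := by
      intro y hy z hz hyz
      rw [SimpleGraph.coe_neighborFinset, SimpleGraph.mem_neighborSet] at hy hz
      have h1 := ht y hy
      rw [hyz] at h1
      exact Subtype.ext (h1.right_unique (ht z hz))
    have himg : (G.toSimpleGraph.neighborFinset x).image t ⊆ B := by
      intro e he
      obtain ⟨y, hy, rfl⟩ := Finset.mem_image.1 he
      rw [SimpleGraph.mem_neighborFinset] at hy
      exact (hBm _).2 (ht y hy).inc_left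
    have hcard : ((G.toSimpleGraph.neighborFinset x).image t).card = G.toSimpleGraph.degree x := by
      rw [Finset.card_image_of_injOn hinj, SimpleGraph.card_neighborFinset_eq_degree]
    refine ⟨by rw [← hcard]; exact (Finset.card_le_card himg).trans hB, fun h3 e f y he hf => ?_⟩
    have heq : (G.toSimpleGraph.neighborFinset x).image t = B :=
      Finset.eq_of_subset_of_card_le himg (by omega)
    have hform : ∀ g, G.IsLink g x y → g = t y := by
      intro g hg
      have hgB : g ∈ B := (hBm g).2 hg.inc_left
      rw [← heq] at hgB
      obtain ⟨z, hz, rfl⟩ := Finset.mem_image.1 hgB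
      rw [SimpleGraph.mem_neighborFinset] at hz
      rw [Subtype.ext ((ht z hz).right_unique hg)]
    rw [hform e he, hform f hf]
  obtain ⟨K, hok, hfull⟩ := exists_full (G := G.toSimpleGraph) (fun v => (hdeg' v).1) hconn (by
    intro h3 hiso
    refine hK ⟨{ eq_of_isLink := ?_ }, hiso⟩
    intro e f x y he hf
    exact (hdeg' ⟨x, he.left_mem⟩).2 (h3 _) e f ⟨y, he.right_mem⟩ he hf)
  obtain ⟨A, hAE, col, des, hpart, hrep⟩ := exists_isPartial_of_full hl hok hfull
  obtain ⟨col', des', hpart'⟩ := hpart.exists_extend hdeg hV hAE hrep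
  exact iInf₂_le 8 ⟨_, hpart'.isSemistrongColoring hl⟩

end Multigraph

end SemistrongColoring

namespace SemistrongColoring

/-! ### The 5-prism -/

section Prism

open scoped Graph

/-- Adjacency in the 5-prism. -/
def prismAdj (x y : Fin 5 × Fin 2) : Bool :=
  (decide (x.2 = y.2) && (decide (x.1 - y.1 = 1) || decide (y.1 - x.1 = 1))) ||
    (decide (x.1 = y.1) && !decide (x.2 = y.2))

lemma prismAdj_iff (x y : Fin 5 × Fin 2) : prismAdj x y = true ↔
    ((SimpleGraph.cycleGraph 5).boxProd (⊤ : SimpleGraph (Fin 2))).Adj x y := by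
  rw [SimpleGraph.boxProd_adj, SimpleGraph.cycleGraph_adj, SimpleGraph.top_adj]
  simp only [prismAdj, Bool.or_eq_true, Bool.and_eq_true, decide_eq_true_eq, Bool.not_eq_true',
    decide_eq_false_iff_not]
  tauto

/-- The edges `xy` and `zw` can occur together in a semistrong matching of the 5-prism in which
`x` and `z` have degree one. -/
def prismCompat (x y z w : Fin 5 × Fin 2) : Bool :=
  !prismAdj x z && !prismAdj x w && !prismAdj z y &&
    !decide (x = z) && !decide (x = w) && !decide (y = z) && !decide (y = w)

set_option maxRecDepth 10000 in
-- A finite check; it rules out semistrong matchings with three edges.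
lemma not_prismCompat : ∀ x₁ y₁ : Fin 5 × Fin 2, prismAdj x₁ y₁ = true →
    ∀ x₂ y₂, prismAdj x₂ y₂ = true → prismCompat x₁ y₁ x₂ y₂ = true →
    ∀ x₃ y₃, prismAdj x₃ y₃ = true → prismCompat x₁ y₁ x₃ y₃ = true →
      ¬ prismCompat x₂ y₂ x₃ y₃ = true := by
  decide +kernel

lemma fivePrism_isLink_iff {e : Sym2 (Fin 5 × Fin 2)} {x y : Fin 5 × Fin 2} :
    fivePrism.IsLink e x y ↔ e = s(x, y) ∧ prismAdj x y = true := by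
  rw [prismAdj_iff, ← SimpleGraph.mem_edgeSet]
  change (e = s(x, y) ∧ e ∈ _) ↔ _
  constructor
  · rintro ⟨rfl, h⟩
    exact ⟨rfl, h⟩
  · rintro ⟨rfl, h⟩
    exact ⟨rfl, h⟩

lemma fivePrism_adj_iff {x y : Fin 5 × Fin 2} : fivePrism.Adj x y ↔ prismAdj x y = true := by
  simp [Graph.Adj, fivePrism_isLink_iff]

lemma fivePrism_simple : fivePrism.Simple where
  not_isLoopAt e x h := by
    have h' : fivePrism.IsLink e x x := h
    rw [fivePrism_isLink_iff, prismAdj_iff] at h'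
    exact h'.2.ne rfl
  eq_of_isLink e f x y he hf := by
    rw [fivePrism_isLink_iff] at he hf
    exact he.1.trans hf.1.symm

lemma fivePrism_connected : fivePrism.toSimpleGraph.Connected :=
  (Graph.toSimpleGraphOfSimpleGraphIso _).connected_iff.2
    (SimpleGraph.cycleGraph_connected.boxProd SimpleGraph.connected_top)

lemma degree_fivePrism (x : Fin 5 × Fin 2) : degree fivePrism x = 3 := by
  have h1 : {e | fivePrism.IsLoopAt e x} = ∅ := by
    ext e
    simpa using fivePrism_simple.not_isLoopAt e x
  have h2 : {e | fivePrism.Inc e x} =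
      ((Finset.univ.filter (fun y => prismAdj x y = true)).image (fun y => s(x, y)) : Finset _) := by
    ext e
    simp [Graph.Inc, fivePrism_isLink_iff, and_comm, @eq_comm _ e]
  have h3 : ∀ x, (Finset.univ.filter (fun y => prismAdj x y = true)).card = 3 := by decide
  rw [degree, h1, h2, Set.encard_empty, add_zero, Set.encard_coe_eq_coe_finsetCard,
    Finset.card_image_of_injective, h3]
  · rfl
  · intro y z h
    exact Sym2.congr_right.1 h

lemma maxDegree_fivePrism : maxDegree fivePrism = 3 := by
  have hV : ∀ x, x ∈ V(fivePrism) := fun x => Set.mem_univ x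
  simp only [maxDegree, degree_fivePrism, hV, iSup_pos]
  exact ciSup_const

lemma not_isK33_fivePrism : ¬ IsK33 fivePrism := by
  rintro ⟨-, ⟨φ⟩⟩
  have h := Fintype.card_congr
    ((Graph.toSimpleGraphOfSimpleGraphIso _).symm.trans φ : _ ≃g _).toEquiv
  simp at h

/-- The edges of the 5-prism. -/
def prismEdge (p : Fin 5 × Fin 3) : (Fin 5 × Fin 2) × (Fin 5 × Fin 2) :=
  if p.2 = 0 then ((p.1, 0), (p.1 + 1, 0))
  else if p.2 = 1 then ((p.1, 1), (p.1 + 1, 1))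
  else ((p.1, 0), (p.1, 1))

lemma prismAdj_prismEdge : ∀ p, prismAdj (prismEdge p).1 (prismEdge p).2 = true := by decide

lemma prismEdge_injective : Function.Injective fun p => s((prismEdge p).1, (prismEdge p).2) := by
  unfold Function.Injective
  decide +kernel

/-- The only neighbor of a degree-one end inside `V(M)` is the other end of its edge, which no other
edge of `M` meets. -/
lemma IsSemistrongMatching.exists_isLink {α β : Type*} {G : Graph α β} (hl : G.Loopless)
    {M : Set β} (hM : IsSemistrongMatching G M) {e : β} (he : e ∈ M) :
    ∃ x y, G.IsLink e x y ∧ ∀ f ∈ M, f ≠ e → ∀ z, G.Inc f z → ¬ G.Adj x z := by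
  obtain ⟨x, ⟨y, hxy⟩, hdeg⟩ := hM.2 e he
  refine ⟨x, y, hxy, fun f hf hfe z hz hadj => ?_⟩
  obtain ⟨a, ha⟩ := Set.encard_eq_one.1 hdeg
  have hy : y ∈ ({a} : Set α) := ha ▸ ⟨⟨e, he, hxy.inc_right⟩, hxy.ne, hxy.adj⟩
  have hz' : z ∈ ({a} : Set α) := ha ▸ ⟨⟨f, hf, hz⟩, hadj.ne, hadj⟩
  rw [Set.mem_singleton_iff] at hy hz'
  exact hM.1.2 f hf e he hfe z ⟨hz, by rw [hz', ← hy]; exact hxy.inc_right⟩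

lemma prismCompat_of_isMatching {M : Set (Sym2 (Fin 5 × Fin 2))} (hM : IsMatching fivePrism M)
    {e f : Sym2 (Fin 5 × Fin 2)} (he : e ∈ M) (hf : f ∈ M) (hef : e ≠ f)
    {x y z w : Fin 5 × Fin 2} (hxy : fivePrism.IsLink e x y) (hzw : fivePrism.IsLink f z w)
    (hx : ∀ f ∈ M, f ≠ e → ∀ z, fivePrism.Inc f z → ¬ fivePrism.Adj x z)
    (hz : ∀ e ∈ M, e ≠ f → ∀ x, fivePrism.Inc e x → ¬ fivePrism.Adj z x) :
    prismCompat x y z w = true := by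
  have h1 := hx f hf hef.symm z hzw.inc_left
  have h2 := hx f hf hef.symm w hzw.inc_right
  have h3 := hz e he hef y hxy.inc_right
  rw [fivePrism_adj_iff] at h1 h2 h3
  have h4 := hM.2 e he f hf hef
  have h5 : x ≠ z := by rintro rfl; exact h4 _ ⟨hxy.inc_left, hzw.inc_left⟩
  have h6 : x ≠ w := by rintro rfl; exact h4 _ ⟨hxy.inc_left, hzw.inc_right⟩
  have h7 : y ≠ z := by rintro rfl; exact h4 _ ⟨hxy.inc_right, hzw.inc_left⟩
  have h8 : y ≠ w := by rintro rfl; exact h4 _ ⟨hxy.inc_right, hzw.inc_right⟩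
  simp [prismCompat, h1, h2, h3, h5, h6, h7, h8]

/-- A semistrong matching of the 5-prism has at most two edges. -/
lemma IsSemistrongMatching.not_three_of_fivePrism {M : Set (Sym2 (Fin 5 × Fin 2))}
    (hM : IsSemistrongMatching fivePrism M) {e f g : Sym2 (Fin 5 × Fin 2)} (he : e ∈ M)
    (hf : f ∈ M) (hg : g ∈ M) (hef : e ≠ f) (heg : e ≠ g) : f = g := by
  by_contra hfg
  have hl : fivePrism.Loopless := fivePrism_simple.toLoopless
  obtain ⟨x₁, y₁, h₁, k₁⟩ := hM.exists_isLink hl he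
  obtain ⟨x₂, y₂, h₂, k₂⟩ := hM.exists_isLink hl hf
  obtain ⟨x₃, y₃, h₃, k₃⟩ := hM.exists_isLink hl hg
  exact not_prismCompat x₁ y₁ (fivePrism_isLink_iff.1 h₁).2
    x₂ y₂ (fivePrism_isLink_iff.1 h₂).2 (prismCompat_of_isMatching hM.1 he hf hef h₁ h₂ k₁ k₂)
    x₃ y₃ (fivePrism_isLink_iff.1 h₃).2 (prismCompat_of_isMatching hM.1 he hg heg h₁ h₃ k₁ k₃)
    (prismCompat_of_isMatching hM.1 hf hg hfg h₂ h₃ k₂ k₃)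

lemma semistrongChromaticIndex_fivePrism : semistrongChromaticIndex fivePrism = 8 := by
  apply le_antisymm
  · exact semistrongChromaticIndex_le_eight fivePrism_simple.toLoopless (Set.toFinite _)
      fivePrism_connected maxDegree_fivePrism.le not_isK33_fivePrism
  refine le_iInf₂ fun k hk => ?_
  obtain ⟨c, hc⟩ := hk
  by_contra hlt
  have hlt' : k < 8 := by exact_mod_cast not_le.1 hlt
  have hE (p : Fin 5 × Fin 3) : s((prismEdge p).1, (prismEdge p).2) ∈ E(fivePrism) :=
    (fivePrism_isLink_iff.2 ⟨rfl, prismAdj_prismEdge p⟩).edge_mem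
  -- Fifteen edges in at most seven classes force three into one class.
  obtain ⟨i, hi⟩ := Fintype.exists_lt_card_fiber_of_mul_lt_card
    (f := fun p => c ⟨_, hE p⟩) (n := 2) (by simp; omega)
  obtain ⟨p, q, r, hp, hq, hr, hpq, hpr, hqr⟩ := Finset.two_lt_card_iff.1 hi
  simp only [Finset.mem_filter, Finset.mem_univ, true_and] at hp hq hr
  exact hqr (prismEdge_injective ((hc i).not_three_of_fivePrism ⟨hE p, hp⟩ ⟨hE q, hq⟩ ⟨hE r, hr⟩
    (prismEdge_injective.ne hpq) (prismEdge_injective.ne hpr)))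

end Prism

end SemistrongColoring

open SemistrongColoring in
open scoped Graph in
theorem theorem2 :
    (∀ (α β : Type*) (G : Graph α β), G.Loopless → V(G).Finite →
      G.toSimpleGraph.Connected → maxDegree G ≤ 3 → ¬ IsK33 G →
      semistrongChromaticIndex G ≤ 8) ∧
    (fivePrism.Simple ∧ fivePrism.toSimpleGraph.Connected ∧ maxDegree fivePrism = 3 ∧
      ¬ IsK33 fivePrism ∧ semistrongChromaticIndex fivePrism = 8) :=
  ⟨fun _ _ _ hl hV hc hd hK => semistrongChromaticIndex_le_eight hl hV hc hd hK,
    fivePrism_simple, fivePrism_connected, maxDegree_fivePrism, not_isK33_fivePrism,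
    semistrongChromaticIndex_fivePrism⟩
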